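/- **Conventions.** A *weight sequence* is a sequence $\mathbb M=(M_p)_{p\ge 0}$ of positive reals with $M_0=1$, $M_p^2\le M_{p-1}M_{p+1}$ for $p\ge1$ and $M_p^{1/p}\to\infty$; it is *normalized* if $M_1=1$. Put $m_p=M_{p+1}/M_p$, $\omega(\mathbb M)=\liminf_{p\to\infty}\log m_p/\log p$, $\omega_{\mathbb M}(t)=\sup_{p\ge 0}\log(t^p/M_p)$ for $t>0$, $\omega_{\mathbb M}(0)=0$, and $d_{\mathbb M}(t)=\log\omega_{\mathbb M}(t)/\log t$. $\mathbb M$ is *strongly regular* if $M_0=1$, it is logarithmically convex, $M_{p+q}\le A^{p+q}M_pM_q$ for some $A>0$ and all $p,q$, and $\sum_{q\ge p}\frac{M_q}{(q+1)M_{q+1}}\le B\frac{M_p}{M_{p+1}}$ for some $B>0$ and all $p$. $\mathbb M$ *admits a nonzero proximate order* if there is a nonzero proximate order $\rho$ (a continuous, piecewise continuously differentiable function $\rho\ge0$ on some $(c,\infty)$, $c\ge 0$, whose points of non-differentiability are finitely many in every bounded interval and have distinct finite one-sided derivatives, with $\lim_{r\to\infty}\rho(r)\in(0,\infty)$ and $r\rho'(r)\log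 r\to0$) such that $\log(t)(\rho(t)-d_{\mathbb M}(t))$ is bounded for large $t$. The product $\mathbb M_1\cdot\mathbb M_2$ is taken termwise. $\mathcal R$ is the Riemann surface of the logarithm, $S(d,\gamma)=\{z\in\mathcal R:|\arg z-d|<\gamma\pi/2\}$ and $S_\gamma=S(0,\gamma)$. A sectorial region $G(d,\gamma)$ is an open connected $G\subset S(d,\gamma)$ that contains, for each $\beta\in(0,\gamma)$, the points of $S(d,\beta)$ of small modulus. $\mathcal O^{\mathbb M}(S)$ is the set of holomorphic functions $f$ on the unbounded sector $S$ that have a limit at $0$ in every bounded proper subsector and satisfy, on each unbounded proper subsector, $|f(z)|\le c\,e^{\omega_{\mathbb M}(|z|/k)}$ for large $|z|$, with some $c,k>0$. Let $\mathbb M$ be strongly regular with $\omega(\mathbb M)<2$. Functions $e,E$ are *strong kernel functions for $\mathbb M$-summability* if: $e$ is holomorphic in $S_{\omega(\mathbb M)}$; for every $\varepsilon>0$ there are $c,k>0$ with $|e(z)|\le c\,e^{-\omega_{\mathbb M}(|z|/k)}$ on $S_{\omega(\mathbb M)-\varepsilon}$; $e(x)>0$ for $x>0$; with $m_e(\lambda)=\int_0^\infty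 t^{\lambda-1}e(t)\,dt$ ($\Re\lambda\ge0$), the function $E(z)=\sum_n z^n/m_e(n)$ is entire and $|E(z)|\le Ce^{\omega_{\mathbb M}(|z|/K)}$ on $\mathbb C$ for some $C,K>0$; (II.B) there is $\alpha>0$ such that for every $\tau\in(0,\omega(\mathbb M))$ there are $C_\tau,\varepsilon_\tau>0$ with $|e(z)|\le C_\tau|z|^\alpha$ for $z\in S_\tau$, $|z|\le\varepsilon_\tau$; (VI.B) there is $\beta>0$ such that for every $\tau\in(0,2-\omega(\mathbb M))$ there are $K_\tau,M_\tau>0$ with $|E(z)|\le K_\tau|z|^{-\beta}$ for $z\in S(\pi,\tau)$, $|z|\ge M_\tau$. They are *kernel functions* if, instead of (II.B) and (VI.B), there is $t_0>0$ such that each $z_0\in S_{\omega(\mathbb M)}$ has a neighbourhood $U\subset S_{\omega(\mathbb M)}$ with $\int_0^{t_0}t^{-1}\sup_{z\in U}|e(t/z)|\,dt<\infty$, and there is $t_0>0$ such that each $z_0\in S(\pi,2-\omega(\mathbb M))$ has a neighbourhood $U\subset S(\pi,2-\omega(\mathbb M))$ with $\int_0^{t_0}t^{-1}\sup_{z\in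 U}|E(z/t)|\,dt<\infty$. For $f$ on $S(d,\alpha)$, $T_ef$ denotes the holomorphic function on a sectorial region $G(d,\alpha+\omega(\mathbb M))$ given near the origin by $\int_0^{\infty(\tau)}e(u/z)f(u)\frac{du}{u}$ for directions $|\tau-d|<\alpha\pi/2$ and $|\arg z-\tau|<\omega(\mathbb M)\pi/2$. The Borel transform is $T_e^-f(u)=\frac{-1}{2\pi i}\int_{\delta(\tau)}E(u/z)f(z)\frac{dz}{z}$ for $\arg u$ near $\tau$, where $\delta(\tau)$ is a segment from $0$ to a point of argument $\tau+\omega(\mathbb M)(\pi+\varepsilon)/2$, a circular arc traversed clockwise to argument $\tau-\omega(\mathbb M)(\pi+\varepsilon)/2$, and a segment back to $0$, with small $\varepsilon>0$. **Proposition.** Let $\mathbb M_1,\mathbb M_2$ be normalized weight sequences admitting nonzero proximate orders with $\omega(\mathbb M_1)+\omega(\mathbb M_2)<2$, write $\omega_j=\omega(\mathbb M_j)$, and let $e_j$ (with associated $E_j$) be strong kernels for $\mathbb M_j$-summability, $j=1,2$. 1. The function $e_1*e_2(z):=T_{e_1}(e_2(1/u))(1/z)$ is well defined on $S_{\omega_1+\omega_2}$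 (the function $u\mapsto e_2(1/u)$ belongs to $\mathcal O^{\mathbb M_1}(S_{\omega_2})$, and the defining integrals converge and do not depend on the admissible direction). It is a strong kernel of $\mathbb M_1\cdot\mathbb M_2$-summability, and its moment function is $m_{e_1}(\lambda)m_{e_2}(\lambda)$, $\Re\lambda\ge0$. If $E$ is the function associated with $e_1*e_2$, then $E=T^-_{e_2}E_1$ on $\mathbb C\setminus\{0\}$. 2. $e_1*e_2$ is the unique kernel of $\mathbb M_1\cdot\mathbb M_2$-summability with moment sequence $(m_{e_1}(p)m_{e_2}(p))_{p\ge0}$. 3. For every unbounded sector $S=S(d,\alpha)$ and $f\in\mathcal O^{\mathbb M_1\cdot\mathbb M_2}(S)$, the transform $T_{e_2}f$ is defined on $S(d,\alpha+\omega_2)$ and belongs to $\mathcal O^{\mathbb M_1}(S(d,\alpha+\omega_2))$, and $T_{e_1*e_2}f=T_{e_1}(T_{e_2}f)$, both being defined on a sectorial region $G(d,\alpha+\omega_1+\omega_2)$. 4. For $f(u)=(1-u)^{-1}$ on $S(\pi,2)$, the transform $T_{e_2}f$ is defined on $S(\pi,2+\omega_2)$ and belongs to $\mathcal O^{\mathbb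 M_1}(S(\pi,2+\omega_2))$, the function $g=T_{e_1}(T_{e_2}f)$ is defined on $S(\pi,2+\omega_1+\omega_2)$, and $e_1*e_2(1/z)=\dfrac{g(z)-g(ze^{2\pi i})}{2\pi i}$ for $z\in S_{\omega_1+\omega_2}$. -/

import Mathlib

open Filter Topology MeasureTheory Set

noncomputable section

namespace MSumm

/-! ## Weight sequences -/

/-- `M` is a weight sequence: positive terms, `M 0 = 1`, logarithmically convex, and
`(M p)^(1/p) → ∞`. -/
structure IsWeightSequence (M : ℕ → ℝ) : Prop where
  pos : ∀ p, 0 < M p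
  zero : M 0 = 1
  logConvex : ∀ p, M (p + 1) ^ 2 ≤ M p * M (p + 2)
  root_tendsto : Tendsto (fun p : ℕ => M p ^ (1 / (p : ℝ))) atTop atTop

/-- Normalized weight sequence: in addition `M 1 = 1`. -/
structure IsNormalizedWeightSequence (M : ℕ → ℝ) : Prop extends IsWeightSequence M where
  one : M 1 = 1

/-- Strongly regular sequence: (lc), moderate growth (mg), and strong non-quasianalyticity (snq). -/
structure IsStronglyRegular (M : ℕ → ℝ) : Prop where
  pos : ∀ p, 0 < M p
  zero : M 0 = 1
  logConvex : ∀ p, M (p + 1) ^ 2 ≤ M p * M (p + 2)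
  moderateGrowth : ∃ A > 0, ∀ p q, M (p + q) ≤ A ^ (p + q) * M p * M q
  summable : Summable (fun q : ℕ => M q / ((q + 1 : ℝ) * M (q + 1)))
  snq : ∃ B > 0, ∀ p : ℕ,
    ∑' j : ℕ, M (p + j) / (((p + j : ℕ) + 1 : ℝ) * M (p + j + 1)) ≤ B * (M p / M (p + 1))

/-- The growth index `ω(M) = liminf log(m_p) / log p`, with `m_p = M (p+1) / M p`, as an extended
real number. -/
def growthIndex (M : ℕ → ℝ) : EReal :=
  liminf (fun p : ℕ => ((Real.log (M (p + 1) / M p) / Real.log p : ℝ) : EReal)) atTop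

/-- The growth index as a real number (used only when it is finite). -/
def growthOrder (M : ℕ → ℝ) : ℝ := (growthIndex M).toReal

/-- The associated function `ω_M(t) = sup_p log(t^p / M_p)`, `t > 0`. (At `t = 0` the formula gives
the value `0` when `M 0 = 1`, since `Real.log 0 = 0`.) -/
def assocFun (M : ℕ → ℝ) (t : ℝ) : ℝ := ⨆ p : ℕ, Real.log (t ^ p / M p)

/-- `d_M(t) = log(ω_M(t)) / log t`. -/
def orderFun (M : ℕ → ℝ) (t : ℝ) : ℝ := Real.log (assocFun M t) / Real.log t

/-- `ρ` is a proximate order on `(c, ∞)` with limit `l` at infinity. The set `D` is the set of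
points (finitely many in each bounded interval) where `ρ` is not differentiable. -/
structure IsProximateOrder (ρ : ℝ → ℝ) (c l : ℝ) : Prop where
  c_nonneg : 0 ≤ c
  continuousOn : ContinuousOn ρ (Ioi c)
  nonneg : ∀ r, c < r → 0 ≤ ρ r
  tendsto : Tendsto ρ atTop (𝓝 l)
  piecewise : ∃ D : Set ℝ, D ⊆ Ioi c ∧ (∀ x, (D ∩ Iic x).Finite) ∧
    (∀ r, c < r → r ∉ D → DifferentiableAt ℝ ρ r ∧ ContinuousAt (deriv ρ) r) ∧
    (∀ r ∈ D, ∃ a b : ℝ, a ≠ b ∧ HasDerivWithinAt ρ a (Iio r) r ∧ HasDerivWithinAt ρ b (Ioi r) r) ∧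
    Tendsto (fun r => r * deriv ρ r * Real.log r) (atTop ⊓ 𝓟 Dᶜ) (𝓝 0)

/-- `M` admits a nonzero proximate order. -/
def AdmitsNonzeroProximateOrder (M : ℕ → ℝ) : Prop :=
  ∃ (ρ : ℝ → ℝ) (c l : ℝ), 0 < l ∧ IsProximateOrder ρ c l ∧
    ∃ C D : ℝ, ∀ᶠ t in atTop,
      C ≤ Real.log t * (ρ t - orderFun M t) ∧ Real.log t * (ρ t - orderFun M t) ≤ D

/-! ## The Riemann surface of the logarithm

The Riemann surface of the logarithm is identified with `ℂ` through its global holomorphic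
coordinate `log`: the point with modulus `r > 0` and argument `θ ∈ ℝ` is the complex number
`log r + i θ`. So the modulus of the point `z` is `exp (re z)`, its argument is `im z`, the product
and the quotient of two points are `z + w` and `z - w`, the inverse `1/z` is `-z`, multiplication by
`e^{2πi}` is `z + 2πi`, and the projection to the punctured plane is `Complex.exp`. A function is
holomorphic on an open subset of the surface iff it is so in this coordinate. -/

/-- The modulus of a point of the Riemann surface of the logarithm. -/
def modulus (z : ℂ) : ℝ := Real.exp z.re

/-- The point of modulus `r` and argument `θ`. -/
def polar (r θ : ℝ) : ℂ := (Real.log r : ℂ) + (θ : ℂ) * Complex.I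

/-- The unbounded sector `S(d, γ)`, with bisecting direction `d` and opening `γπ`. -/
def sector (d γ : ℝ) : Set ℂ := {z | |z.im - d| < γ * Real.pi / 2}

/-- The bounded sector `S(d, γ, r)`. -/
def bddSector (d γ r : ℝ) : Set ℂ := {z | |z.im - d| < γ * Real.pi / 2 ∧ modulus z < r}

/-- `G` is a sectorial region `G(d, γ)`. -/
structure IsSectorialRegion (d γ : ℝ) (G : Set ℂ) : Prop where
  isOpen : IsOpen G
  isConnected : IsConnected G
  subset : G ⊆ sector d γ
  bddSector_subset : ∀ β, 0 < β → β < γ → ∃ r > 0, bddSector d β r ⊆ G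

/-- The filter of points tending to the origin (modulus tending to `0`). -/
def nhdsOrigin : Filter ℂ := comap modulus (𝓝 0)

/-- The space `O^M(S)` for `S = S(d, α)`: holomorphic in `S`, continuous at the origin (a limit at
the origin exists along every bounded proper subsector), and of `M`-growth on every unbounded proper
subsector. -/
structure HasMGrowth (M : ℕ → ℝ) (d α : ℝ) (f : ℂ → ℂ) : Prop where
  holomorphic : DifferentiableOn ℂ f (sector d α)
  origin : ∀ θ β r : ℝ, 0 < β → 0 < r → closure (bddSector θ β r) ⊆ sector d α →
    ∃ a : ℂ, Tendsto f (nhdsOrigin ⊓ 𝓟 (bddSector θ β r)) (𝓝 a)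
  growth : ∀ θ β : ℝ, 0 < β → closure (sector θ β) ⊆ sector d α →
    ∃ r > 0, ∃ c > 0, ∃ k > 0, ∀ z ∈ sector θ β, r ≤ modulus z →
      ‖f z‖ ≤ c * Real.exp (assocFun M (modulus z / k))

/-! ## Kernels -/

/-- The moment function `m_e(lam) = ∫_0^∞ t^(lam-1) e(t) dt`. -/
def momentFun (e : ℂ → ℂ) (lam : ℂ) : ℂ := mellin (fun t : ℝ => e (polar t 0)) lam

/-- The function `E(z) = ∑ z^n / m_e(n)` associated with `e`. -/
def borelKernel (e : ℂ → ℂ) (z : ℂ) : ℂ := ∑' n : ℕ, z ^ n / momentFun e n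

/-- The conditions shared by kernels and strong kernels. Here `e` is a function on (a sector of) the
Riemann surface of the logarithm and `E` is a function on `ℂ`. -/
structure IsPreKernel (M : ℕ → ℝ) (e E : ℂ → ℂ) : Prop where
  stronglyRegular : IsStronglyRegular M
  index_lt : growthIndex M < 2
  holomorphic : DifferentiableOn ℂ e (sector 0 (growthOrder M))
  bound : ∀ ε > 0, ∃ c > 0, ∃ k > 0, ∀ z ∈ sector 0 (growthOrder M - ε),
    ‖e z‖ ≤ c * Real.exp (-assocFun M (modulus z / k))
  positive : ∀ x : ℝ, 0 < x → ∃ y : ℝ, 0 < y ∧ e (polar x 0) = y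
  hasSum : ∀ z : ℂ, HasSum (fun n : ℕ => z ^ n / momentFun e n) (E z)
  bound_borel : ∃ C > 0, ∃ K > 0, ∀ z : ℂ, ‖E z‖ ≤ C * Real.exp (assocFun M (‖z‖ / K))

/-- `e`, `E` are kernel functions for `M`-summability: in addition `z⁻¹ e(z)` and `z⁻¹ E(1/z)` are
locally uniformly integrable at the origin, in `S(0, ω(M))` and in `S(π, 2 - ω(M))`. -/
structure IsKernel (M : ℕ → ℝ) (e E : ℂ → ℂ) : Prop extends IsPreKernel M e E where
  integrable : ∃ t₀ > 0, ∀ z₀ ∈ sector 0 (growthOrder M),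
    ∃ U ∈ 𝓝 z₀, U ⊆ sector 0 (growthOrder M) ∧
      ∫⁻ t in Ioc (0 : ℝ) t₀, (⨆ z ∈ U, ‖e (polar t 0 - z)‖ₑ) / ENNReal.ofReal t < ⊤
  integrable_borel : ∃ t₀ > 0, ∀ z₀ ∈ sector Real.pi (2 - growthOrder M),
    ∃ U ∈ 𝓝 z₀, U ⊆ sector Real.pi (2 - growthOrder M) ∧
      ∫⁻ t in Ioc (0 : ℝ) t₀, (⨆ z ∈ U, ‖E (Complex.exp (z - polar t 0))‖ₑ) / ENNReal.ofReal t < ⊤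

/-- `e`, `E` are strong kernel functions for `M`-summability. -/
structure IsStrongKernel (M : ℕ → ℝ) (e E : ℂ → ℂ) : Prop extends IsPreKernel M e E where
  origin : ∃ a > 0, ∀ τ, 0 < τ → τ < growthOrder M → ∃ C > 0, ∃ ε > 0,
    ∀ z ∈ sector 0 τ, modulus z ≤ ε → ‖e z‖ ≤ C * modulus z ^ (a : ℝ)
  infinity_borel : ∃ b > 0, ∀ τ, 0 < τ → τ < 2 - growthOrder M → ∃ K > 0, ∃ R > 0,
    ∀ z ∈ sector Real.pi τ, R ≤ modulus z → ‖E (Complex.exp z)‖ ≤ K / modulus z ^ (b : ℝ)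

/-! ## Laplace and Borel transforms -/

/-- The integrand of the Laplace transform along the half-line `t ↦ t e^{iτ}` (where `du/u = dt/t`):
`e(u/z) f(u) / t` at `u = t e^{iτ}`. -/
def laplaceIntegrand (e f : ℂ → ℂ) (τ : ℝ) (z : ℂ) (t : ℝ) : ℂ :=
  e (polar t τ - z) * f (polar t τ) / (t : ℂ)

/-- The `e`-Laplace transform of `f` in direction `τ`: `∫_0^{∞(τ)} e(u/z) f(u) du/u`. -/
def laplaceDir (e f : ℂ → ℂ) (τ : ℝ) (z : ℂ) : ℂ :=
  ∫ t in Ioi (0 : ℝ), laplaceIntegrand e f τ z t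

/-- `g` is the `e`-Laplace transform `T_e f` on `G`, where `f` is a function on `S(d, α)` and the
kernel `e` lives on `S(0, ω)`: `G` is a sectorial region `G(d, α + ω)`, `g` is holomorphic on `G`,
and the transforms of `f` in the directions `τ` of `S(d, α)` all converge to `g` near the origin. -/
structure IsLaplaceTransform (ω : ℝ) (e f : ℂ → ℂ) (d α : ℝ) (G : Set ℂ) (g : ℂ → ℂ) : Prop where
  region : IsSectorialRegion d (α + ω) G
  holomorphic : DifferentiableOn ℂ g G
  eq_laplaceDir : ∀ τ, |τ - d| < α * Real.pi / 2 → ∀ β, 0 < β → β < ω → ∃ r > 0,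
    ∀ z ∈ bddSector τ β r, z ∈ G ∧ IntegrableOn (laplaceIntegrand e f τ z) (Ioi 0) ∧
      g z = laplaceDir e f τ z

/-- The integrand `E(u/z) f(z) / r` of the Borel transform on the ray `z = r e^{iθ}`. -/
def borelRay (E f : ℂ → ℂ) (u : ℂ) (θ r : ℝ) : ℂ :=
  E (Complex.exp (u - polar r θ)) * f (polar r θ) / (r : ℂ)

/-- The Borel transform `-1/(2πi) ∫ E(u/z) f(z) dz/z` in direction `τ`, along the path that consists
of the segment from the origin to the point of modulus `R` and argument `τ + ω(π+ε)/2`, of the arc of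
radius `R`, traversed clockwise, to the argument `τ - ω(π+ε)/2`, and of the segment back to the
origin. -/
def borelDir (ω : ℝ) (E f : ℂ → ℂ) (τ ε R : ℝ) (u : ℂ) : ℂ :=
  -1 / (2 * Real.pi * Complex.I) *
    ((∫ r in Ioc (0 : ℝ) R, borelRay E f u (τ + ω * (Real.pi + ε) / 2) r)
      + Complex.I * (∫ θ in (τ + ω * (Real.pi + ε) / 2)..(τ - ω * (Real.pi + ε) / 2),
          E (Complex.exp (u - polar R θ)) * f (polar R θ))
      - ∫ r in Ioc (0 : ℝ) R, borelRay E f u (τ - ω * (Real.pi + ε) / 2) r)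

/-- The convolution `(e₁ ∗ e₂)(z) = T_{e₁}(e₂(1/u))(1/z)`, for `z` in `S(0, ω₁ + ω₂)`. The function
`u ↦ e₂(1/u)` lives on `S(0, ω₂)`; at the point `1/z` the Laplace integral is taken along the
direction `τ = -(ω₂/(ω₁+ω₂)) arg z`, which satisfies `|τ| < ω₂π/2` and `|arg(1/z) - τ| < ω₁π/2`. -/
def convKernel (ω₁ ω₂ : ℝ) (e₁ e₂ : ℂ → ℂ) (z : ℂ) : ℂ :=
  laplaceDir e₁ (fun u => e₂ (-u)) (-(ω₂ / (ω₁ + ω₂) * z.im)) (-z)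

end MSumm

end

open MSumm

/-!
In the coordinate `log` on the Riemann surface of the logarithm a sector is a horizontal strip, a
Laplace transform in the direction `τ` is the integral of `e(ζ - z) f(ζ)` over the line `im ζ = τ`,
and the convolution of two kernels is their additive convolution along such a line
(`convKernel_eq_integral`). Everything rests on exponential decay in strips (`HasKernelBound`,
`LaplaceDominated`), which allows lines to be moved (`integral_horizontal_eq_of_decay`) and local
transforms in different directions to be glued into one holomorphic function (`laplaceGlue`,
`isLaplaceTransform_sector`, `exists_isLaplaceTransform`).

*Growth.* The estimate behind all statements about the product sequence is
`ω_{M₁ M₂}(st) ≤ ω_{M₁}(s) + ω_{M₂}(t)` (`assocFun_mul_le`). It gives the decay of the convolution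
(`hasKernelBound_convKernel`) and the `M₁`-growth of the transform by `e₂` of a function of
`M₁ M₂`-growth (`hasMGrowth_laplaceGlue`). The proximate orders serve to turn the lower limits in the
growth indices into limits (`exists_tendsto_log_ratio`), so that indices add.

*Moments and composition.* Both the product formula for moments (`momentFun_convKernel`) and the
composition of the Laplace operators (`exists_laplaceLine_comp`, `isLaplaceTransform_comp_iff`) are
Fubini's theorem. The latter holds near the origin, and the identity theorem does the rest.

*The Borel kernel.* The function associated with the convolution is the Hadamard product of `E₁` and
`E₂`. Cauchy's estimates bound its coefficients (`norm_inv_coeff_le`), hence its growth. The rays of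
the Borel path cancel, by periodicity, up to a full circle, on which the integral is the Hadamard
product (`borelDir_eq`); with the path of radius `|z|` the same formula yields the power decay
in the sector about the negative axis (`exists_hadamard_decay`).

*Recovery and uniqueness.* A kernel is the jump between two branches of its Laplace transform of
`1 / (1 - u)` (`laplaceGlue_geomFun_sub`). For a difference `D` of two kernels with the same moments,
expanding `1 / (1 - u)` into a geometric series shows that this transform is flat of order
`exp (-ω_M)` in every sector of opening less than `2π` (`exists_norm_laplaceGlue_geomFun_le`). As the
index of `M` is less than `2`, a Watson lemma (`eqOn_zero_of_flat`), which is a Phragmén–Lindelöf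
principle in a half-plane, makes it vanish, and so `D` vanishes (`IsPreKernel.eqOn_of_momentFun_eq`).
-/

namespace MSumm

/-! ### Integrals along half-lines and horizontal lines -/

theorem integrableOn_comp_log_div_iff (F : ℝ → ℂ) {s : Set ℝ} (hs : MeasurableSet s) :
    IntegrableOn (fun t : ℝ => F (Real.log t) / (t : ℂ)) (Real.exp '' s) ↔ IntegrableOn F s := by
  rw [integrableOn_image_iff_integrableOn_abs_deriv_smul hs
    (fun x _ => (Real.hasDerivAt_exp x).hasDerivWithinAt) Real.exp_injective.injOn]
  refine integrableOn_congr_fun (fun x _ => ?_) hs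
  have : (Real.exp x : ℂ) ≠ 0 := by exact_mod_cast (Real.exp_pos x).ne'
  simp only [abs_of_pos (Real.exp_pos x), Real.log_exp, Complex.real_smul]
  field_simp

/-- The substitution `t = exp x` turns the measure `dt / t` into `dx`. -/
theorem setIntegral_comp_log_div (F : ℝ → ℂ) {s : Set ℝ} (hs : MeasurableSet s) :
    ∫ t in Real.exp '' s, F (Real.log t) / (t : ℂ) = ∫ x in s, F x := by
  rw [integral_image_eq_integral_abs_deriv_smul hs
    (fun x _ => (Real.hasDerivAt_exp x).hasDerivWithinAt) Real.exp_injective.injOn]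
  refine setIntegral_congr_fun hs (fun x _ => ?_)
  have : (Real.exp x : ℂ) ≠ 0 := by exact_mod_cast (Real.exp_pos x).ne'
  simp only [abs_of_pos (Real.exp_pos x), Real.log_exp, Complex.real_smul]
  field_simp

theorem image_exp_univ : Real.exp '' univ = Ioi 0 := by
  rw [image_univ, Real.range_exp]

theorem image_exp_Iic {R : ℝ} (hR : 0 < R) : Real.exp '' Iic (Real.log R) = Ioc 0 R := by
  ext t
  constructor
  · rintro ⟨x, hx, rfl⟩
    exact ⟨Real.exp_pos x, (Real.le_log_iff_exp_le hR).1 hx⟩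
  · rintro ⟨h0, h1⟩
    exact ⟨Real.log t, Real.log_le_log h0 h1, Real.exp_log h0⟩

theorem integrable_exp_neg_mul_abs {a : ℝ} (ha : 0 < a) (c : ℝ) :
    Integrable (fun x : ℝ => Real.exp (-a * |x - c|)) := by
  have h0 : Integrable (fun x : ℝ => Real.exp (-a * |x|)) := by
    rw [← integrableOn_univ, ← Iic_union_Ioi (a := (0 : ℝ))]
    refine IntegrableOn.union ?_ ?_
    · refine (integrableOn_exp_mul_Iic ha 0).congr_fun (fun x hx => ?_) measurableSet_Iic
      simp [abs_of_nonpos (show x ≤ 0 from hx)]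
    · refine (integrableOn_exp_mul_Ioi (neg_lt_zero.2 ha) 0).congr_fun (fun x hx => ?_)
        measurableSet_Ioi
      simp [abs_of_pos (show 0 < x from hx)]
  exact h0.comp_sub_right c

theorem tendsto_exp_neg_mul_atTop {a : ℝ} (ha : 0 < a) :
    Tendsto (fun R : ℝ => Real.exp (-a * R)) atTop (𝓝 0) :=
  Real.tendsto_exp_atBot.comp ((tendsto_const_mul_atBot_of_neg (neg_lt_zero.2 ha)).2 tendsto_id)

theorem continuous_horizontal {f : ℂ → ℂ} {c : ℝ}
    (hf : ∀ z : ℂ, z.im = c → ContinuousAt f z) :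
    Continuous (fun x : ℝ => f (x + c * Complex.I)) := by
  rw [continuous_iff_continuousAt]
  intro x
  refine ContinuousAt.comp (f := fun x : ℝ => (x + c * Complex.I : ℂ)) (hf _ (by simp)) ?_
  fun_prop

/-- The integral of a holomorphic function along a horizontal line does not change when the line
moves within a strip in which the function decays exponentially at both ends. -/
theorem integral_horizontal_eq_of_decay {f : ℂ → ℂ} {c d a C : ℝ} (ha : 0 < a)
    (hf : ∀ z : ℂ, z.im ∈ uIcc c d → DifferentiableAt ℂ f z)
    (hb : ∀ z : ℂ, z.im ∈ uIcc c d → ‖f z‖ ≤ C * Real.exp (-a * |z.re|)) :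
    ∫ x : ℝ, f (x + c * Complex.I) = ∫ x : ℝ, f (x + d * Complex.I) := by
  have hint : ∀ s ∈ uIcc c d, Integrable (fun x : ℝ => f (x + s * Complex.I)) := by
    intro s hs
    refine Integrable.mono' (((integrable_exp_neg_mul_abs ha 0)).const_mul C) ?_ ?_
    · exact (continuous_horizontal fun z hz =>
        (hf z (by rw [hz]; exact hs)).continuousAt).aestronglyMeasurable
    · refine Eventually.of_forall fun x => ?_
      simpa using hb (x + s * Complex.I) (by simpa using hs)
  have hv : Tendsto (fun R : ℝ =>
      Complex.I • (∫ y : ℝ in c..d, f ((R : ℝ) + y * Complex.I)) -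
      Complex.I • (∫ y : ℝ in c..d, f ((-R : ℝ) + y * Complex.I))) atTop (𝓝 0) := by
    have key : ∀ R : ℝ, ‖∫ y : ℝ in c..d, f ((R : ℝ) + y * Complex.I)‖ ≤
        C * Real.exp (-a * |R|) * |d - c| := by
      intro R
      refine intervalIntegral.norm_integral_le_of_norm_le_const fun y hy => ?_
      simpa using hb (R + y * Complex.I) (by simpa using uIoc_subset_uIcc hy)
    refine squeeze_zero_norm' (a := fun R : ℝ => 2 * (C * Real.exp (-a * R) * |d - c|)) ?_ ?_
    · filter_upwards [eventually_ge_atTop 0] with R hR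
      have h1 := key R
      have h2 := key (-R)
      rw [abs_neg] at h2
      rw [abs_of_nonneg hR] at h1 h2
      refine (norm_sub_le _ _).trans ?_
      rw [norm_smul, norm_smul, Complex.norm_I, one_mul, one_mul]
      linarith
    · have := ((tendsto_exp_neg_mul_atTop ha).const_mul C).mul_const (|d - c|)
      simpa using this.const_mul 2
  have hlim : ∀ s ∈ uIcc c d, Tendsto (fun R : ℝ => ∫ x : ℝ in (-R)..R, f (x + s * Complex.I)) atTop
      (𝓝 (∫ x : ℝ, f (x + s * Complex.I))) := fun s hs =>
    intervalIntegral_tendsto_integral (hint s hs) tendsto_neg_atTop_atBot tendsto_id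
  have h := ((hlim c left_mem_uIcc).sub (hlim d right_mem_uIcc)).add hv
  have hz : ∀ R : ℝ, (∫ x : ℝ in (-R)..R, f (x + c * Complex.I)) -
      (∫ x : ℝ in (-R)..R, f (x + d * Complex.I)) +
      (Complex.I • (∫ y : ℝ in c..d, f ((R : ℝ) + y * Complex.I)) -
      Complex.I • (∫ y : ℝ in c..d, f ((-R : ℝ) + y * Complex.I))) = 0 := by
    intro R
    have := Complex.integral_boundary_rect_eq_zero_of_differentiableOn f
      (⟨-R, c⟩ : ℂ) (⟨R, d⟩ : ℂ) (fun z hz => (hf z hz.2).differentiableWithinAt)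
    rw [← this]
    simp only
    ring
  simp only [hz] at h
  have := tendsto_nhds_unique h tendsto_const_nhds
  rw [add_zero, sub_eq_zero] at this
  exact this

/-- Cauchy's theorem for the left half-strip with right edge on `re z = x₀`. -/
theorem integral_horizontal_Iic_sub {f : ℂ → ℂ} {c d a C x₀ : ℝ} (ha : 0 < a)
    (hf : ∀ z : ℂ, z.im ∈ uIcc c d → DifferentiableAt ℂ f z)
    (hb : ∀ z : ℂ, z.im ∈ uIcc c d → z.re ≤ x₀ → ‖f z‖ ≤ C * Real.exp (a * z.re)) :
    (∫ x : ℝ in Iic x₀, f (x + c * Complex.I)) - (∫ x : ℝ in Iic x₀, f (x + d * Complex.I)) =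
      -(Complex.I * ∫ y : ℝ in c..d, f (x₀ + y * Complex.I)) := by
  have hint : ∀ s ∈ uIcc c d, IntegrableOn (fun x : ℝ => f (x + s * Complex.I)) (Iic x₀) := by
    intro s hs
    refine Integrable.mono' ((integrableOn_exp_mul_Iic ha x₀).const_mul C) ?_ ?_
    · exact (continuous_horizontal fun z hz =>
        (hf z (by rw [hz]; exact hs)).continuousAt).aestronglyMeasurable
    · filter_upwards [ae_restrict_mem measurableSet_Iic] with x hx
      simpa using hb (x + s * Complex.I) (by simpa using hs) (by simpa using hx)
  have hv : Tendsto (fun R : ℝ =>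
      Complex.I • (∫ y : ℝ in c..d, f (x₀ + y * Complex.I)) -
      Complex.I • (∫ y : ℝ in c..d, f ((-R : ℝ) + y * Complex.I))) atTop
      (𝓝 (Complex.I • (∫ y : ℝ in c..d, f (x₀ + y * Complex.I)) - 0)) := by
    refine tendsto_const_nhds.sub ?_
    refine squeeze_zero_norm' (a := fun R : ℝ => C * Real.exp (-a * R) * |d - c|) ?_ ?_
    · filter_upwards [eventually_ge_atTop (-x₀)] with R hR
      rw [norm_smul, Complex.norm_I, one_mul]
      refine intervalIntegral.norm_integral_le_of_norm_le_const fun y hy => ?_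
      have := hb ((-R : ℝ) + y * Complex.I) (by simpa using uIoc_subset_uIcc hy)
        (by simp; linarith)
      simpa using this
    · have := ((tendsto_exp_neg_mul_atTop ha).const_mul C).mul_const (|d - c|)
      simpa using this
  have hlim : ∀ s ∈ uIcc c d, Tendsto (fun R : ℝ => ∫ x : ℝ in (-R)..x₀, f (x + s * Complex.I))
      atTop (𝓝 (∫ x : ℝ in Iic x₀, f (x + s * Complex.I))) := fun s hs =>
    intervalIntegral_tendsto_integral_Iic _ (hint s hs) tendsto_neg_atTop_atBot
  have h := ((hlim c left_mem_uIcc).sub (hlim d right_mem_uIcc)).add hv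
  have hz : ∀ R : ℝ, (∫ x : ℝ in (-R)..x₀, f (x + c * Complex.I)) -
      (∫ x : ℝ in (-R)..x₀, f (x + d * Complex.I)) +
      (Complex.I • (∫ y : ℝ in c..d, f (x₀ + y * Complex.I)) -
      Complex.I • (∫ y : ℝ in c..d, f ((-R : ℝ) + y * Complex.I))) = 0 := by
    intro R
    have := Complex.integral_boundary_rect_eq_zero_of_differentiableOn f
      (⟨-R, c⟩ : ℂ) (⟨x₀, d⟩ : ℂ) (fun z hz => (hf z hz.2).differentiableWithinAt)
    rw [← this]
    simp only
    ring
  simp only [hz] at h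
  have := tendsto_nhds_unique h tendsto_const_nhds
  rw [sub_zero, smul_eq_mul] at this
  exact eq_neg_of_add_eq_zero_left this

/-- A parametric integral of holomorphic functions is holomorphic if the integrands are locally
dominated; the derivatives are dominated by Cauchy's estimate. -/
theorem differentiableOn_integral_of_locally_dominated {U : Set ℂ} {F : ℂ → ℝ → ℂ}
    (hd : ∀ x, DifferentiableOn ℂ (fun z => F z x) U)
    (hm : ∀ z ∈ U, AEStronglyMeasurable (F z) volume)
    (hb : ∀ z₀ ∈ U, ∃ ε > 0, Metric.ball z₀ ε ⊆ U ∧ ∃ g : ℝ → ℝ, Integrable g ∧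
      ∀ z ∈ Metric.ball z₀ ε, ∀ x, ‖F z x‖ ≤ g x) :
    DifferentiableOn ℂ (fun z => ∫ x, F z x) U := by
  intro z₀ hz₀
  obtain ⟨ε, hε, hU, g, hg, hbd⟩ := hb z₀ hz₀
  have hdat : ∀ z ∈ Metric.ball z₀ ε, ∀ x,
      HasDerivAt (fun z => F z x) (deriv (fun z => F z x) z) z :=
    fun z hz x => (((hd x).mono hU).differentiableAt (Metric.isOpen_ball.mem_nhds hz)).hasDerivAt
  have hsub : ∀ z ∈ Metric.ball z₀ (ε / 2), Metric.closedBall z (ε / 4) ⊆ Metric.ball z₀ ε := by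
    intro z hz w hw
    rw [Metric.mem_ball] at hz ⊢
    rw [Metric.mem_closedBall] at hw
    linarith [dist_triangle w z z₀]
  have hmem : z₀ ∈ Metric.ball z₀ ε := Metric.mem_ball_self hε
  -- the derivative in `z` is measurable in `x`, as a limit of difference quotients
  have hmeas' : AEStronglyMeasurable (fun x => deriv (fun z => F z x) z₀) volume := by
    have hu : Tendsto (fun n : ℕ => ((ε / 2 / ((n : ℝ) + 1) : ℝ) : ℂ)) atTop (𝓝[≠] 0) := by
      refine tendsto_nhdsWithin_iff.2 ⟨?_, Eventually.of_forall fun n => ?_⟩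
      · have : Tendsto (fun n : ℕ => ε / 2 / ((n : ℝ) + 1)) atTop (𝓝 0) := by
          have := (tendsto_one_div_add_atTop_nhds_zero_nat (𝕜 := ℝ)).const_mul (ε / 2)
          simpa [div_eq_mul_inv] using this
        exact (Complex.continuous_ofReal.tendsto' 0 0 Complex.ofReal_zero).comp this
      · have : (0 : ℝ) < ε / 2 / ((n : ℝ) + 1) := by positivity
        exact Complex.ofReal_ne_zero.2 this.ne'
    refine aestronglyMeasurable_of_tendsto_ae atTop
      (f := fun (n : ℕ) x => (((ε / 2 / ((n : ℝ) + 1) : ℝ) : ℂ))⁻¹ •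
        (F (z₀ + ((ε / 2 / ((n : ℝ) + 1) : ℝ) : ℂ)) x - F z₀ x)) (fun n => ?_) ?_
    · have hmn : z₀ + ((ε / 2 / ((n : ℝ) + 1) : ℝ) : ℂ) ∈ U := hU ?_
      · exact ((hm _ hmn).sub (hm _ hz₀)).const_smul (((ε / 2 / ((n : ℝ) + 1) : ℝ) : ℂ))⁻¹
      have h1 : (0 : ℝ) < ε / 2 / ((n : ℝ) + 1) := by positivity
      have h2 : ε / 2 / ((n : ℝ) + 1) ≤ ε / 2 :=
        div_le_self (by positivity) (by linarith [(Nat.cast_nonneg n : (0 : ℝ) ≤ n)])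
      rw [Metric.mem_ball, dist_eq_norm, add_sub_cancel_left, Complex.norm_real, Real.norm_eq_abs,
        abs_of_pos h1]
      linarith
    · exact Eventually.of_forall fun x => (hdat z₀ hmem x).tendsto_slope_zero.comp hu
  refine ((hasDerivAt_integral_of_dominated_loc_of_deriv_le (F := F)
    (F' := fun z x => deriv (fun z => F z x) z) (bound := fun x => g x / (ε / 4))
    (Metric.ball_mem_nhds z₀ (half_pos hε)) ?_ ?_ hmeas' ?_ ?_
    ?_).2).differentiableAt.differentiableWithinAt
  · filter_upwards [Metric.ball_mem_nhds z₀ hε] with z hz using hm z (hU hz)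
  · exact hg.mono' (hm z₀ hz₀) (Eventually.of_forall fun x => hbd z₀ hmem x)
  · refine Eventually.of_forall fun x z hz => ?_
    refine Complex.norm_deriv_le_of_forall_mem_sphere_norm_le (by positivity) ?_ fun w hw => ?_
    · refine DifferentiableOn.diffContOnCl_ball (U := Metric.ball z₀ ε) ((hd x).mono hU) (hsub z hz)
    · exact hbd w (hsub z hz (Metric.sphere_subset_closedBall hw)) x
  · exact hg.div_const _
  · refine Eventually.of_forall fun x z hz => hdat z ?_ x
    exact Metric.ball_subset_ball (by linarith) hz

/-! ### Weight sequences and their associated functions -/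

section Weights

variable {M M₁ M₂ : ℕ → ℝ}

theorem IsWeightSequence.mul (h₁ : IsWeightSequence M₁) (h₂ : IsWeightSequence M₂) :
    IsWeightSequence (M₁ * M₂) where
  pos p := mul_pos (h₁.pos p) (h₂.pos p)
  zero := by simp [h₁.zero, h₂.zero]
  logConvex p := by
    have := mul_le_mul (h₁.logConvex p) (h₂.logConvex p) (sq_nonneg _)
      (mul_pos (h₁.pos p) (h₁.pos (p + 2))).le
    simp only [Pi.mul_apply]
    nlinarith
  root_tendsto := by
    refine (h₁.root_tendsto.atTop_mul_atTop₀ h₂.root_tendsto).congr fun p => ?_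
    rw [Pi.mul_apply, Real.mul_rpow (h₁.pos p).le (h₂.pos p).le]

theorem IsWeightSequence.bddAbove_log (hM : IsWeightSequence M) {t : ℝ} (ht : 0 < t) :
    BddAbove (range fun p : ℕ => Real.log (t ^ p / M p)) := by
  refine IsBoundedUnder.bddAbove_range ⟨0, ?_⟩
  rw [eventually_map]
  filter_upwards [hM.root_tendsto.eventually_ge_atTop t, eventually_ge_atTop 1] with p hp hp1
  have hMp := hM.pos p
  refine Real.log_nonpos (by positivity) ((div_le_one hMp).2 ?_)
  have h := pow_le_pow_left₀ ht.le hp p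
  rwa [← Real.rpow_natCast (M p ^ _), ← Real.rpow_mul hMp.le, one_div_mul_cancel
    (by positivity), Real.rpow_one] at h

theorem IsWeightSequence.log_le_assocFun (hM : IsWeightSequence M) {t : ℝ} (ht : 0 < t) (p : ℕ) :
    Real.log (t ^ p / M p) ≤ assocFun M t :=
  le_ciSup (hM.bddAbove_log ht) p

theorem IsWeightSequence.pow_div_le_exp (hM : IsWeightSequence M) {t : ℝ} (ht : 0 < t) (p : ℕ) :
    t ^ p / M p ≤ Real.exp (assocFun M t) := by
  have h0 : 0 < t ^ p / M p := div_pos (pow_pos ht p) (hM.pos p)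
  rw [← Real.exp_log h0]
  exact Real.exp_le_exp.2 (hM.log_le_assocFun ht p)

theorem IsWeightSequence.pow_mul_exp_neg_le (hM : IsWeightSequence M) {t : ℝ} (ht : 0 < t)
    (p : ℕ) : t ^ p * Real.exp (-assocFun M t) ≤ M p := by
  have h := hM.pow_div_le_exp ht p
  rw [div_le_iff₀ (hM.pos p)] at h
  rw [Real.exp_neg, ← div_eq_mul_inv, div_le_iff₀ (Real.exp_pos _)]
  linarith

theorem IsWeightSequence.assocFun_nonneg (hM : IsWeightSequence M) {t : ℝ} (ht : 0 < t) :
    0 ≤ assocFun M t := by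
  simpa [hM.zero] using hM.log_le_assocFun ht 0

theorem IsWeightSequence.assocFun_mono (hM : IsWeightSequence M) {s t : ℝ} (hs : 0 < s)
    (hst : s ≤ t) : assocFun M s ≤ assocFun M t := by
  refine ciSup_le fun p => le_trans ?_ (hM.log_le_assocFun (hs.trans_le hst) p)
  have := hM.pos p
  exact Real.log_le_log (by positivity) (by gcongr)

/-- The converse of `IsWeightSequence.pow_div_le_exp`: a bound for all terms bounds the supremum. -/
theorem IsWeightSequence.exp_assocFun_le (hM : IsWeightSequence M) {t X : ℝ} (ht : 0 < t)
    (h : ∀ p : ℕ, t ^ p / M p ≤ X) : Real.exp (assocFun M t) ≤ X := by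
  have hX : 0 < X := lt_of_lt_of_le (div_pos (pow_pos ht 0) (hM.pos 0)) (h 0)
  rw [← Real.exp_log hX]
  refine Real.exp_le_exp.2 (ciSup_le fun p => Real.log_le_log ?_ (h p))
  exact div_pos (pow_pos ht p) (hM.pos p)

/-- The associated function of a product is subadditive across the factors, because
`(st)^p / (M₁ p M₂ p)` is a product. -/
theorem assocFun_mul_le (h₁ : IsWeightSequence M₁) (h₂ : IsWeightSequence M₂) {s t : ℝ}
    (hs : 0 < s) (ht : 0 < t) :
    assocFun (M₁ * M₂) (s * t) ≤ assocFun M₁ s + assocFun M₂ t := by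
  refine ciSup_le fun p => ?_
  have e : (s * t) ^ p / (M₁ * M₂) p = s ^ p / M₁ p * (t ^ p / M₂ p) := by
    rw [Pi.mul_apply, mul_pow, mul_div_mul_comm]
  rw [e, Real.log_mul (div_pos (pow_pos hs p) (h₁.pos p)).ne'
    (div_pos (pow_pos ht p) (h₂.pos p)).ne']
  exact add_le_add (h₁.log_le_assocFun hs p) (h₂.log_le_assocFun ht p)

/-- Moderate growth lets a factor `2` be absorbed by a dilation. -/
theorem IsWeightSequence.exists_two_mul_assocFun_le (hM : IsWeightSequence M)
    (hr : IsStronglyRegular M) :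
    ∃ A > 0, ∀ t > 0, 2 * assocFun M t ≤ assocFun M (A * t) := by
  obtain ⟨A, hA, hmg⟩ := hr.moderateGrowth
  refine ⟨A, hA, fun t ht => ?_⟩
  have h : assocFun M t ≤ assocFun M (A * t) / 2 := by
    refine ciSup_le fun p => ?_
    rw [le_div_iff₀ two_pos]
    refine le_trans ?_ (hM.log_le_assocFun (mul_pos hA ht) (p + p))
    have h1 := hM.pos p
    have h2 := hM.pos (p + p)
    have e : Real.log (t ^ p / M p) * 2 = Real.log ((t ^ p / M p) ^ 2) := by
      rw [Real.log_pow]; push_cast; ring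
    rw [e]
    refine Real.log_le_log (by positivity) ?_
    rw [div_pow, div_le_div_iff₀ (by positivity) h2]
    calc (t ^ p) ^ 2 * M (p + p) ≤ (t ^ p) ^ 2 * (A ^ (p + p) * M p * M p) := by
          gcongr; exact hmg p p
      _ = (A * t) ^ (p + p) * M p ^ 2 := by ring
  linarith

/-! ### The sequence of quotients -/

theorem IsWeightSequence.ratio_pos (hM : IsWeightSequence M) (p : ℕ) : 0 < M (p + 1) / M p :=
  div_pos (hM.pos _) (hM.pos _)

theorem IsWeightSequence.ratio_mono (hM : IsWeightSequence M) :
    Monotone fun p => M (p + 1) / M p := by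
  refine monotone_nat_of_le_succ fun p => ?_
  rw [div_le_div_iff₀ (hM.pos _) (hM.pos _)]
  have := hM.logConvex p
  nlinarith

theorem IsWeightSequence.le_mul_ratio_pow (hM : IsWeightSequence M) {q n k : ℕ} (h : q + k ≤ n) :
    M (q + k) ≤ M q * (M (n + 1) / M n) ^ k := by
  induction k with
  | zero => simp
  | succ k ih =>
    have h1 := ih (by omega)
    have h2 : M (q + k + 1) / M (q + k) ≤ M (n + 1) / M n := hM.ratio_mono (by omega)
    rw [div_le_iff₀ (hM.pos _)] at h2
    calc M (q + k + 1) ≤ M (n + 1) / M n * M (q + k) := h2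
      _ ≤ M (n + 1) / M n * (M q * (M (n + 1) / M n) ^ k) :=
        mul_le_mul_of_nonneg_left h1 (hM.ratio_pos n).le
      _ = _ := by ring

theorem IsWeightSequence.mul_ratio_pow_le (hM : IsWeightSequence M) (n k : ℕ) :
    M n * (M (n + 1) / M n) ^ k ≤ M (n + k) := by
  induction k with
  | zero => simp
  | succ k ih =>
    have h2 : M (n + 1) / M n ≤ M (n + k + 1) / M (n + k) := hM.ratio_mono (by omega)
    rw [le_div_iff₀ (hM.pos _)] at h2
    calc M n * (M (n + 1) / M n) ^ (k + 1)
        = M (n + 1) / M n * (M n * (M (n + 1) / M n) ^ k) := by ring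
      _ ≤ M (n + 1) / M n * M (n + k) := mul_le_mul_of_nonneg_left ih (hM.ratio_pos n).le
      _ ≤ M (n + k + 1) := h2

theorem IsWeightSequence.le_ratio_pow (hM : IsWeightSequence M) (p : ℕ) :
    M p ≤ (M (p + 1) / M p) ^ p := by
  have := hM.le_mul_ratio_pow (q := 0) (n := p) (k := p) (by simp)
  simpa [hM.zero] using this

/-- By logarithmic convexity the supremum defining the associated function at the `n`-th quotient
is attained at the index `n`. -/
theorem IsWeightSequence.exp_assocFun_ratio_le (hM : IsWeightSequence M) (n : ℕ) :
    Real.exp (assocFun M (M (n + 1) / M n)) ≤ (M (n + 1) / M n) ^ n / M n := by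
  have hm := hM.ratio_pos n
  refine hM.exp_assocFun_le hm fun q => ?_
  rw [div_le_div_iff₀ (hM.pos _) (hM.pos _)]
  rcases le_total q n with h | h
  · obtain ⟨k, rfl⟩ := Nat.exists_eq_add_of_le h
    calc (M (q + k + 1) / M (q + k)) ^ q * M (q + k)
        ≤ (M (q + k + 1) / M (q + k)) ^ q * (M q * (M (q + k + 1) / M (q + k)) ^ k) :=
          mul_le_mul_of_nonneg_left (hM.le_mul_ratio_pow le_rfl) (by positivity)
      _ = _ := by ring
  · obtain ⟨k, rfl⟩ := Nat.exists_eq_add_of_le h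
    calc (M (n + 1) / M n) ^ (n + k) * M n
        = (M (n + 1) / M n) ^ n * (M n * (M (n + 1) / M n) ^ k) := by ring
      _ ≤ _ := mul_le_mul_of_nonneg_left (hM.mul_ratio_pow_le n k) (by positivity)

theorem IsWeightSequence.le_assocFun_of_ratio_le (hM : IsWeightSequence M) {p : ℕ} {t : ℝ}
    (h : Real.exp 1 * (M (p + 1) / M p) ≤ t) : (p : ℝ) ≤ assocFun M t := by
  have hm := hM.ratio_pos p
  have ht : 0 < t := lt_of_lt_of_le (by positivity) h
  refine le_trans ?_ (hM.log_le_assocFun ht p)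
  rw [Real.le_log_iff_exp_le (div_pos (pow_pos ht p) (hM.pos p)), le_div_iff₀ (hM.pos p)]
  calc Real.exp p * M p ≤ Real.exp 1 ^ p * (M (p + 1) / M p) ^ p := by
        rw [← Real.exp_nat_mul, mul_one]
        exact mul_le_mul_of_nonneg_left (hM.le_ratio_pow p) (Real.exp_pos _).le
    _ = (Real.exp 1 * (M (p + 1) / M p)) ^ p := (mul_pow _ _ _).symm
    _ ≤ t ^ p := by gcongr

theorem IsWeightSequence.tendsto_ratio (hM : IsWeightSequence M) :
    Tendsto (fun p => M (p + 1) / M p) atTop atTop := by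
  refine tendsto_atTop_mono' _ ?_ hM.root_tendsto
  filter_upwards [eventually_ge_atTop 1] with p hp
  have h := Real.rpow_le_rpow (hM.pos p).le (hM.le_ratio_pow p)
    (by positivity : (0 : ℝ) ≤ 1 / (p : ℝ))
  rwa [← Real.rpow_natCast, ← Real.rpow_mul (hM.ratio_pos p).le, mul_one_div_cancel (by positivity),
    Real.rpow_one] at h

theorem IsNormalizedWeightSequence.one_le (hM : IsNormalizedWeightSequence M) (p : ℕ) :
    1 ≤ M p := by
  have := hM.toIsWeightSequence.mul_ratio_pow_le 0 p
  simpa [hM.zero, hM.one] using this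

/-! ### The growth index -/

theorem AdmitsNonzeroProximateOrder.exists_tendsto_orderFun (hP : AdmitsNonzeroProximateOrder M) :
    ∃ l > 0, Tendsto (orderFun M) atTop (𝓝 l) := by
  obtain ⟨ρ, c, l, hl, hρ, C, D, hCD⟩ := hP
  refine ⟨l, hl, ?_⟩
  have h0 : Tendsto (fun t => ρ t - orderFun M t) atTop (𝓝 0) := by
    refine squeeze_zero_norm' (a := fun t => max |C| |D| / Real.log t) ?_
      (tendsto_const_nhds.div_atTop Real.tendsto_log_atTop)
    filter_upwards [hCD, eventually_gt_atTop 1] with t ht h1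
    have hlog := Real.log_pos h1
    rw [le_div_iff₀ hlog, Real.norm_eq_abs]
    have : |ρ t - orderFun M t| * Real.log t = |Real.log t * (ρ t - orderFun M t)| := by
      rw [abs_mul, abs_of_pos hlog, mul_comm]
    rw [this]
    exact abs_le_max_abs_abs ht.1 ht.2
  have := hρ.tendsto.sub h0
  simpa using this

/-- A proximate order turns the lower limit defining the growth index into a limit: with
`m_p = M (p+1) / M p`, the bounds `p ≤ ω_M(e m_p)` and `ω_M(m_p) ≤ p log m_p` squeeze
`log p / log m_p`. -/
theorem exists_tendsto_log_ratio (hM : IsNormalizedWeightSequence M)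
    (hP : AdmitsNonzeroProximateOrder M) :
    ∃ w > 0, Tendsto (fun p : ℕ => Real.log (M (p + 1) / M p) / Real.log p) atTop (𝓝 w) := by
  obtain ⟨l, hl, hd⟩ := hP.exists_tendsto_orderFun
  have hW := hM.toIsWeightSequence
  have hm := hW.tendsto_ratio
  have hlogm := Real.tendsto_log_atTop.comp hm
  refine ⟨l⁻¹, inv_pos.2 hl, ?_⟩
  suffices H : Tendsto (fun p : ℕ => Real.log p / Real.log (M (p + 1) / M p)) atTop (𝓝 l) from
    (H.inv₀ hl.ne').congr fun p => inv_div _ _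
  -- the lower and the upper bound of the squeeze both tend to the limit `l` of `orderFun M`
  have hlo : Tendsto (fun p : ℕ => orderFun M (M (p + 1) / M p) -
      Real.log (Real.log (M (p + 1) / M p)) / Real.log (M (p + 1) / M p)) atTop (𝓝 l) := by
    have h2 : Tendsto (fun x : ℝ => Real.log x / x) atTop (𝓝 0) :=
      Real.isLittleO_log_id_atTop.tendsto_div_nhds_zero
    simpa using (hd.comp hm).sub (h2.comp hlogm)
  have hhi : Tendsto (fun p : ℕ => orderFun M (Real.exp 1 * (M (p + 1) / M p)) *
      (1 / Real.log (M (p + 1) / M p) + 1)) atTop (𝓝 l) := by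
    have h1 := hd.comp (hm.const_mul_atTop (Real.exp_pos 1))
    have h2 : Tendsto (fun p : ℕ => 1 / Real.log (M (p + 1) / M p) + 1) atTop (𝓝 (0 + 1)) :=
      (tendsto_const_nhds.div_atTop hlogm).add tendsto_const_nhds
    simpa using h1.mul h2
  refine tendsto_of_tendsto_of_tendsto_of_le_of_le' hlo hhi ?_ ?_
  · filter_upwards [hm.eventually_gt_atTop 1, (hd.comp hm).eventually_const_lt hl,
      eventually_ge_atTop 1] with p h1 h2 h3
    have hL := Real.log_pos h1
    have hp : (0 : ℝ) < p := by exact_mod_cast h3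
    have h2' : 0 < Real.log (assocFun M (M (p + 1) / M p)) := by
      have := mul_pos h2 hL
      simpa [orderFun, div_mul_cancel₀ _ hL.ne'] using this
    have hpos : 0 < assocFun M (M (p + 1) / M p) := by
      refine lt_of_le_of_ne (hW.assocFun_nonneg (hW.ratio_pos p)) fun h => ?_
      rw [← h, Real.log_zero] at h2'
      exact lt_irrefl _ h2'
    have hle : assocFun M (M (p + 1) / M p) ≤ p * Real.log (M (p + 1) / M p) := by
      rw [← Real.exp_le_exp]
      refine (hW.exp_assocFun_ratio_le p).trans ((div_le_self (pow_pos (hW.ratio_pos p) p).le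
        (hM.one_le p)).trans ?_)
      rw [Real.exp_nat_mul, Real.exp_log (hW.ratio_pos p)]
    rw [orderFun, ← sub_div]
    refine div_le_div_of_nonneg_right ?_ hL.le
    have := Real.log_le_log hpos hle
    rw [Real.log_mul hp.ne' hL.ne'] at this
    linarith
  · filter_upwards [hm.eventually_gt_atTop 1, eventually_ge_atTop 1] with p h1 h3
    have hL := Real.log_pos h1
    have hp : (0 : ℝ) < p := by exact_mod_cast h3
    have h4 := Real.log_le_log hp (hW.le_assocFun_of_ratio_le (p := p) le_rfl)
    have hL2 : Real.log (Real.exp 1 * (M (p + 1) / M p)) = 1 + Real.log (M (p + 1) / M p) := by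
      rw [Real.log_mul (Real.exp_pos 1).ne' (hW.ratio_pos p).ne', Real.log_exp]
    rw [div_le_iff₀ hL, mul_assoc, add_mul, one_div_mul_cancel hL.ne', one_mul, orderFun, hL2,
      div_mul_cancel₀ _ (by linarith)]
    exact h4

theorem growthIndex_eq_of_tendsto {w : ℝ}
    (h : Tendsto (fun p : ℕ => Real.log (M (p + 1) / M p) / Real.log p) atTop (𝓝 w)) :
    growthIndex M = (w : EReal) :=
  (((continuous_coe_real_ereal.tendsto w).comp h).liminf_eq)

theorem growthOrder_eq_of_tendsto {w : ℝ}
    (h : Tendsto (fun p : ℕ => Real.log (M (p + 1) / M p) / Real.log p) atTop (𝓝 w)) :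
    growthOrder M = w := by
  rw [growthOrder, growthIndex_eq_of_tendsto h, EReal.toReal_coe]

theorem tendsto_log_ratio_mul (h₁ : IsWeightSequence M₁) (h₂ : IsWeightSequence M₂) {w₁ w₂ : ℝ}
    (t₁ : Tendsto (fun p : ℕ => Real.log (M₁ (p + 1) / M₁ p) / Real.log p) atTop (𝓝 w₁))
    (t₂ : Tendsto (fun p : ℕ => Real.log (M₂ (p + 1) / M₂ p) / Real.log p) atTop (𝓝 w₂)) :
    Tendsto (fun p : ℕ => Real.log ((M₁ * M₂) (p + 1) / (M₁ * M₂) p) / Real.log p) atTop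
      (𝓝 (w₁ + w₂)) := by
  refine (t₁.add t₂).congr fun p => ?_
  rw [← add_div, ← Real.log_mul (h₁.ratio_pos p).ne' (h₂.ratio_pos p).ne', div_mul_div_comm]
  rfl

/-- The associated function of a sequence of growth order less than `γ` grows at least like
`t^(1/γ)`. -/
theorem eventually_rpow_le_assocFun (hM : IsWeightSequence M) {w γ : ℝ} (hw : 0 < w) (hγ : w < γ)
    (h : Tendsto (fun p : ℕ => Real.log (M (p + 1) / M p) / Real.log p) atTop (𝓝 w)) :
    ∀ᶠ t in atTop, (t / Real.exp 1) ^ (1 / γ) - 1 ≤ assocFun M t := by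
  have hγ0 : 0 < γ := hw.trans hγ
  have hp : ∀ᶠ p : ℕ in atTop, M (p + 1) / M p ≤ (p : ℝ) ^ γ := by
    filter_upwards [h.eventually_lt_const hγ, eventually_gt_atTop 1] with p h1 h2
    have hp0 : (1 : ℝ) < p := by exact_mod_cast h2
    rw [div_lt_iff₀ (Real.log_pos hp0)] at h1
    rw [← Real.log_le_log_iff (hM.ratio_pos p) (by positivity), Real.log_rpow (by positivity)]
    exact h1.le
  have hfl : Tendsto (fun t : ℝ => ⌊(t / Real.exp 1) ^ (1 / γ)⌋₊) atTop atTop :=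
    tendsto_nat_floor_atTop.comp ((tendsto_rpow_atTop (by positivity)).comp
      (tendsto_id.atTop_div_const (Real.exp_pos 1)))
  filter_upwards [hfl.eventually hp, eventually_ge_atTop 0] with t h1 h0
  have hx : 0 ≤ (t / Real.exp 1) ^ (1 / γ) := by positivity
  refine le_trans (Nat.sub_one_lt_floor _).le (hM.le_assocFun_of_ratio_le ?_)
  have h2 : ((⌊(t / Real.exp 1) ^ (1 / γ)⌋₊ : ℕ) : ℝ) ^ γ ≤ t / Real.exp 1 := by
    calc _ ≤ ((t / Real.exp 1) ^ (1 / γ)) ^ γ :=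
          Real.rpow_le_rpow (by positivity) (Nat.floor_le hx) hγ0.le
      _ = t / Real.exp 1 := by
          rw [← Real.rpow_mul (by positivity), one_div_mul_cancel hγ0.ne', Real.rpow_one]
  have := h1.trans h2
  rw [le_div_iff₀ (Real.exp_pos 1)] at this
  linarith

/-- The strong non-quasianalyticity of the product follows from that of one factor, because the
quotients `M₁ p / M₁ (p + 1)` decrease. -/
theorem IsStronglyRegular.mul (h₁ : IsStronglyRegular M₁) (h₂ : IsStronglyRegular M₂)
    (hW₁ : IsWeightSequence M₁) (hW₂ : IsWeightSequence M₂) : IsStronglyRegular (M₁ * M₂) := by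
  -- each term of the product series is a term for `M₂` times a quotient of `M₁` that decreases
  have hterm : ∀ p j : ℕ,
      (M₁ * M₂) (p + j) / (((p + j : ℕ) + 1 : ℝ) * (M₁ * M₂) (p + j + 1)) ≤
        M₁ p / M₁ (p + 1) * (M₂ (p + j) / (((p + j : ℕ) + 1 : ℝ) * M₂ (p + j + 1))) := by
    intro p j
    have h := hW₁.ratio_mono (show p ≤ p + j by omega)
    have h' : M₁ (p + j) / M₁ (p + j + 1) ≤ M₁ p / M₁ (p + 1) := by
      have := inv_anti₀ (hW₁.ratio_pos p) h
      simpa [inv_div] using this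
    have e : (M₁ * M₂) (p + j) / (((p + j : ℕ) + 1 : ℝ) * (M₁ * M₂) (p + j + 1)) =
        M₁ (p + j) / M₁ (p + j + 1) *
          (M₂ (p + j) / (((p + j : ℕ) + 1 : ℝ) * M₂ (p + j + 1))) := by
      simp only [Pi.mul_apply]
      rw [div_mul_div_comm]
      ring
    rw [e]
    have a := hW₂.pos (p + j)
    have b := hW₂.pos (p + j + 1)
    exact mul_le_mul_of_nonneg_right h' (by positivity)
  have hnonneg : ∀ p j : ℕ,
      0 ≤ (M₁ * M₂) (p + j) / (((p + j : ℕ) + 1 : ℝ) * (M₁ * M₂) (p + j + 1)) := by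
    intro p j
    have a := (hW₁.mul hW₂).pos (p + j)
    have b := (hW₁.mul hW₂).pos (p + j + 1)
    positivity
  have hs₂ : ∀ p : ℕ, Summable fun j : ℕ =>
      M₂ (p + j) / (((p + j : ℕ) + 1 : ℝ) * M₂ (p + j + 1)) := by
    intro p
    have := (summable_nat_add_iff p).2 h₂.summable
    refine this.congr fun j => ?_
    rw [add_comm j p]
  have hs : ∀ p : ℕ, Summable fun j : ℕ =>
      (M₁ * M₂) (p + j) / (((p + j : ℕ) + 1 : ℝ) * (M₁ * M₂) (p + j + 1)) := fun p =>
    Summable.of_nonneg_of_le (hnonneg p) (hterm p) ((hs₂ p).mul_left _)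
  refine ⟨(hW₁.mul hW₂).pos, (hW₁.mul hW₂).zero, (hW₁.mul hW₂).logConvex, ?_, ?_, ?_⟩
  · obtain ⟨A₁, hA₁, H₁⟩ := h₁.moderateGrowth
    obtain ⟨A₂, hA₂, H₂⟩ := h₂.moderateGrowth
    refine ⟨A₁ * A₂, mul_pos hA₁ hA₂, fun p q => ?_⟩
    have a := h₁.pos p
    have b := h₁.pos q
    have := mul_le_mul (H₁ p q) (H₂ p q) (h₂.pos _).le (by positivity)
    simp only [Pi.mul_apply, mul_pow]
    linarith
  · simpa using hs 0
  · obtain ⟨B, hB, H⟩ := h₂.snq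
    refine ⟨B, hB, fun p => ?_⟩
    have hr : 0 < M₁ p / M₁ (p + 1) := div_pos (hW₁.pos _) (hW₁.pos _)
    calc _ ≤ ∑' j : ℕ, M₁ p / M₁ (p + 1) *
          (M₂ (p + j) / (((p + j : ℕ) + 1 : ℝ) * M₂ (p + j + 1))) :=
          (hs p).tsum_le_tsum (hterm p) ((hs₂ p).mul_left _)
      _ = M₁ p / M₁ (p + 1) *
          ∑' j : ℕ, (M₂ (p + j) / (((p + j : ℕ) + 1 : ℝ) * M₂ (p + j + 1))) := tsum_mul_left
      _ ≤ M₁ p / M₁ (p + 1) * (B * (M₂ p / M₂ (p + 1))) :=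
          mul_le_mul_of_nonneg_left (H p) hr.le
      _ = B * ((M₁ * M₂) p / (M₁ * M₂) (p + 1)) := by
          simp only [Pi.mul_apply]
          rw [mul_left_comm, div_mul_div_comm]

end Weights

/-! ### Laplace transforms in the logarithmic coordinate -/

/-- The Laplace integral in direction `τ`, written in the logarithmic coordinate as an integral
over the horizontal line `im ζ = τ`. -/
noncomputable def laplaceLine (e f : ℂ → ℂ) (τ : ℝ) (z : ℂ) : ℂ :=
  ∫ x : ℝ, e (x + τ * Complex.I - z) * f (x + τ * Complex.I)

theorem laplaceDir_eq_laplaceLine (e f : ℂ → ℂ) (τ : ℝ) (z : ℂ) :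
    laplaceDir e f τ z = laplaceLine e f τ z := by
  have := setIntegral_comp_log_div
    (fun x : ℝ => e (x + τ * Complex.I - z) * f (x + τ * Complex.I)) MeasurableSet.univ
  rw [image_exp_univ, setIntegral_univ] at this
  exact this

theorem integrableOn_laplaceIntegrand_iff (e f : ℂ → ℂ) (τ : ℝ) (z : ℂ) :
    IntegrableOn (laplaceIntegrand e f τ z) (Ioi 0) ↔
      Integrable (fun x : ℝ => e (x + τ * Complex.I - z) * f (x + τ * Complex.I)) := by
  have := integrableOn_comp_log_div_iff
    (fun x : ℝ => e (x + τ * Complex.I - z) * f (x + τ * Complex.I)) MeasurableSet.univ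
  rw [image_exp_univ, integrableOn_univ] at this
  exact this

/-- The Laplace integrand `e(ζ - z) f(ζ)` decays exponentially in `|re ζ - re z|`, uniformly for
`ζ` in a closed strip of half-width `θ` about `d`, for `im z` within `η` of `im ζ`, and for
`re z ≤ ρ`. -/
def LaplaceDominated (e f : ℂ → ℂ) (d a θ η ρ C : ℝ) : Prop :=
  ∀ ζ z : ℂ, |ζ.im - d| ≤ θ → |z.im - ζ.im| ≤ η → z.re ≤ ρ →
    ‖e (ζ - z) * f ζ‖ ≤ C * Real.exp (-a * |ζ.re - z.re|)

theorem isOpen_strip_inter_re_lt (τ η ρ : ℝ) : IsOpen {z : ℂ | |z.im - τ| < η ∧ z.re < ρ} :=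
  (isOpen_lt (Complex.continuous_im.sub continuous_const).abs continuous_const).and
    (isOpen_lt Complex.continuous_re continuous_const)

section Laplace

variable {e f : ℂ → ℂ} {d a A B θ η ρ C : ℝ}

theorem continuous_laplaceLine_integrand (he : ∀ w : ℂ, |w.im| < B → DifferentiableAt ℂ e w)
    (hf : ∀ u : ℂ, |u.im - d| < A → DifferentiableAt ℂ f u) {τ : ℝ} {z : ℂ}
    (hτ : |τ - d| < A) (hz : |z.im - τ| < B) :
    Continuous (fun x : ℝ => e (x + τ * Complex.I - z) * f (x + τ * Complex.I)) := by
  refine continuous_horizontal (f := fun ζ => e (ζ - z) * f ζ) fun ζ hζ => ?_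
  have h1 : DifferentiableAt ℂ e (ζ - z) :=
    he _ (by rw [Complex.sub_im, hζ, abs_sub_comm]; exact hz)
  have h2 : DifferentiableAt ℂ f ζ := hf _ (by rw [hζ]; exact hτ)
  exact ((h1.comp ζ (differentiableAt_id.sub_const z)).mul h2).continuousAt

theorem LaplaceDominated.integrable (hD : LaplaceDominated e f d a θ η ρ C) (ha : 0 < a)
    (he : ∀ w : ℂ, |w.im| < B → DifferentiableAt ℂ e w)
    (hf : ∀ u : ℂ, |u.im - d| < A → DifferentiableAt ℂ f u) (hθ : θ < A) (hη : η < B)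
    {τ : ℝ} {z : ℂ} (hτ : |τ - d| ≤ θ) (hz : |z.im - τ| ≤ η) (hρ : z.re ≤ ρ) :
    Integrable (fun x : ℝ => e (x + τ * Complex.I - z) * f (x + τ * Complex.I)) := by
  refine Integrable.mono' ((integrable_exp_neg_mul_abs ha z.re).const_mul C)
    (continuous_laplaceLine_integrand he hf (hτ.trans_lt hθ)
      (hz.trans_lt hη)).aestronglyMeasurable (Eventually.of_forall fun x => ?_)
  simpa using hD (x + τ * Complex.I) z (by simpa using hτ) (by simpa using hz) hρ

/-- Independence of the direction, by Cauchy's theorem in the strip between the two lines. -/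
theorem LaplaceDominated.laplaceLine_eq (hD : LaplaceDominated e f d a θ η ρ C) (ha : 0 < a)
    (he : ∀ w : ℂ, |w.im| < B → DifferentiableAt ℂ e w)
    (hf : ∀ u : ℂ, |u.im - d| < A → DifferentiableAt ℂ f u) (hθ : θ < A) (hη : η < B)
    {τ τ' : ℝ} {z : ℂ} (hτ : |τ - d| ≤ θ) (hz : |z.im - τ| ≤ η) (hτ' : |τ' - d| ≤ θ)
    (hz' : |z.im - τ'| ≤ η) (hρ : z.re ≤ ρ) :
    laplaceLine e f τ z = laplaceLine e f τ' z := by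
  rw [abs_le] at hτ hz hτ' hz'
  have key : ∀ s ∈ uIcc τ τ', |s - d| ≤ θ ∧ |z.im - s| ≤ η := by
    intro s hs
    rcases mem_uIcc.1 hs with h | h <;>
      exact ⟨abs_le.2 ⟨by linarith, by linarith⟩, abs_le.2 ⟨by linarith, by linarith⟩⟩
  refine integral_horizontal_eq_of_decay (f := fun ζ => e (ζ - z) * f ζ) (a := a)
    (C := C * Real.exp (a * |z.re|)) ha
    (fun ζ hζ => ?_) (fun ζ hζ => ?_)
  · obtain ⟨h1, h2⟩ := key _ hζ
    have h3 : DifferentiableAt ℂ e (ζ - z) :=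
      he _ (by rw [Complex.sub_im, abs_sub_comm]; exact h2.trans_lt hη)
    exact (h3.comp ζ (differentiableAt_id.sub_const z)).mul (hf ζ (h1.trans_lt hθ))
  · obtain ⟨h1, h2⟩ := key _ hζ
    have h3 := hD ζ z h1 h2 hρ
    have hC : 0 ≤ C := by
      have := (norm_nonneg _).trans h3
      exact nonneg_of_mul_nonneg_left this (Real.exp_pos _)
    refine h3.trans ?_
    rw [mul_assoc, ← Real.exp_add]
    refine mul_le_mul_of_nonneg_left (Real.exp_le_exp.2 ?_) hC
    have h4 := abs_sub_abs_le_abs_sub ζ.re z.re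
    nlinarith

theorem LaplaceDominated.differentiableOn (hD : LaplaceDominated e f d a θ η ρ C) (ha : 0 < a)
    (he : ∀ w : ℂ, |w.im| < B → DifferentiableAt ℂ e w)
    (hf : ∀ u : ℂ, |u.im - d| < A → DifferentiableAt ℂ f u) (hθ : θ < A) (hη : η < B)
    {τ : ℝ} (hτ : |τ - d| ≤ θ) :
    DifferentiableOn ℂ (laplaceLine e f τ) {z : ℂ | |z.im - τ| < η ∧ z.re < ρ} := by
  have hopen : IsOpen {z : ℂ | |z.im - τ| < η ∧ z.re < ρ} :=
    isOpen_strip_inter_re_lt τ η ρ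
  refine differentiableOn_integral_of_locally_dominated
    (F := fun (z : ℂ) (x : ℝ) => e (x + τ * Complex.I - z) * f (x + τ * Complex.I)) ?_ ?_ ?_
  · intro x z hz
    have h3 : DifferentiableAt ℂ e (x + τ * Complex.I - z) :=
      he _ (by simp only [Complex.sub_im, Complex.add_im, Complex.ofReal_im, Complex.mul_im,
                Complex.I_re, Complex.I_im, Complex.ofReal_re]
               rw [abs_sub_comm]
               simpa using hz.1.trans hη)
    exact ((h3.comp z (differentiableAt_id.const_sub _)).mul_const _).differentiableWithinAt
  · intro z hz
    exact (continuous_laplaceLine_integrand he hf (hτ.trans_lt hθ)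
      (hz.1.trans hη)).aestronglyMeasurable
  · intro z₀ hz₀
    obtain ⟨ε, hε, hball⟩ := Metric.isOpen_iff.1 hopen z₀ hz₀
    refine ⟨ε, hε, hball, fun x => C * Real.exp (a * ε) * Real.exp (-a * |x - z₀.re|),
      (integrable_exp_neg_mul_abs ha _).const_mul _, fun z hz x => ?_⟩
    have hz' := hball hz
    have h3 := hD (x + τ * Complex.I) z (by simpa using hτ) (by simpa using hz'.1.le) hz'.2.le
    have hC : 0 ≤ C := nonneg_of_mul_nonneg_left ((norm_nonneg _).trans h3) (Real.exp_pos _)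
    refine h3.trans ?_
    beta_reduce
    rw [mul_assoc, ← Real.exp_add]
    refine mul_le_mul_of_nonneg_left (Real.exp_le_exp.2 ?_) hC
    have h5 : |z.re - z₀.re| ≤ ε := by
      rw [Metric.mem_ball, dist_eq_norm] at hz
      exact (Complex.abs_re_le_norm (z - z₀)).trans hz.le
    have h6 : |x - z₀.re| ≤ |x - z.re| + |z.re - z₀.re| := abs_sub_le _ _ _
    simp only [Complex.add_re, Complex.ofReal_re, Complex.mul_re, Complex.I_re, Complex.I_im,
      Complex.ofReal_im, mul_zero, sub_zero, add_zero, zero_mul]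
    nlinarith

/-- The Laplace transform with the direction chosen as an affine function of the argument of the
point: the direction `d + s (im z - d)` for a fixed ratio `s`. -/
noncomputable def laplaceGlue (e f : ℂ → ℂ) (d s : ℝ) (z : ℂ) : ℂ :=
  laplaceLine e f (d + s * (z.im - d)) z

theorem abs_glue_direction_lt {s : ℝ} (hA : 0 < A) (hB : 0 < B) (hs : s * (A + B) = A) {y : ℝ}
    (hy : |y - d| < A + B) :
    |d + s * (y - d) - d| < A ∧ |y - (d + s * (y - d))| < B := by
  have hs0 : 0 < s := by
    by_contra h
    nlinarith
  have hs1 : 0 < 1 - s := by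
    by_contra h
    nlinarith
  constructor
  · rw [add_sub_cancel_left, abs_mul, abs_of_pos hs0]
    nlinarith
  · have : y - (d + s * (y - d)) = (1 - s) * (y - d) := by ring
    rw [this, abs_mul, abs_of_pos hs1]
    nlinarith

section Glue

variable {s : ℝ} (ha : 0 < a) (hA : 0 < A) (hB : 0 < B) (hs : s * (A + B) = A)
  (he : ∀ w : ℂ, |w.im| < B → DifferentiableAt ℂ e w)
  (hf : ∀ u : ℂ, |u.im - d| < A → DifferentiableAt ℂ f u)
  (hD : ∀ θ < A, ∀ η < B, ∃ C, LaplaceDominated e f d a θ η ρ C)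

include ha he hf hD

theorem integrable_of_laplaceDominated {z : ℂ} {τ : ℝ} (hτ : |τ - d| < A) (hz : |z.im - τ| < B)
    (hρ : z.re ≤ ρ) :
    Integrable (fun x : ℝ => e (x + τ * Complex.I - z) * f (x + τ * Complex.I)) := by
  obtain ⟨C, hC⟩ := hD _ hτ _ hz
  exact hC.integrable ha he hf hτ hz le_rfl le_rfl hρ

theorem laplaceLine_eq_of_laplaceDominated {z : ℂ} {τ τ' : ℝ} (hτ : |τ - d| < A)
    (hz : |z.im - τ| < B) (hτ' : |τ' - d| < A) (hz' : |z.im - τ'| < B) (hρ : z.re ≤ ρ) :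
    laplaceLine e f τ z = laplaceLine e f τ' z := by
  obtain ⟨C, hC⟩ := hD _ (max_lt hτ hτ') _ (max_lt hz hz')
  exact hC.laplaceLine_eq ha he hf (max_lt hτ hτ') (max_lt hz hz') (le_max_left _ _)
    (le_max_left _ _) (le_max_right _ _) (le_max_right _ _) hρ

include hA hB hs

theorem laplaceGlue_eq_laplaceLine {z : ℂ} {τ : ℝ} (hτ : |τ - d| < A)
    (hz : |z.im - τ| < B) (hρ : z.re ≤ ρ) :
    laplaceGlue e f d s z = laplaceLine e f τ z := by
  have hy : |z.im - d| < A + B := by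
    calc |z.im - d| ≤ |z.im - τ| + |τ - d| := abs_sub_le _ _ _
      _ < A + B := by linarith
  obtain ⟨h1, h2⟩ := abs_glue_direction_lt hA hB hs hy
  exact laplaceLine_eq_of_laplaceDominated ha he hf hD h1 h2 hτ hz hρ

theorem differentiableAt_laplaceGlue {z : ℂ} (hz : |z.im - d| < A + B) (hρ : z.re < ρ) :
    DifferentiableAt ℂ (laplaceGlue e f d s) z := by
  obtain ⟨h1, h2⟩ := abs_glue_direction_lt hA hB hs hz
  set τ := d + s * (z.im - d) with hτ
  obtain ⟨η, hη, hηB⟩ := exists_between h2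
  obtain ⟨C, hC⟩ := hD _ h1 _ hηB
  have hopen : IsOpen {w : ℂ | |w.im - τ| < η ∧ w.re < ρ} :=
    isOpen_strip_inter_re_lt τ η ρ
  have hmem : {w : ℂ | |w.im - τ| < η ∧ w.re < ρ} ∈ 𝓝 z := hopen.mem_nhds ⟨hη, hρ⟩
  refine ((hC.differentiableOn ha he hf h1 hηB le_rfl).differentiableAt
    hmem).congr_of_eventuallyEq ?_
  filter_upwards [hmem] with w hw
  exact laplaceGlue_eq_laplaceLine ha hA hB hs he hf hD h1 (hw.1.trans hηB) hw.2.le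

end Glue

theorem isOpen_sector (d γ : ℝ) : IsOpen (sector d γ) :=
  isOpen_lt (Complex.continuous_im.sub continuous_const).abs continuous_const

theorem convex_sector (d γ : ℝ) : Convex ℝ (sector d γ) := by
  have : sector d γ = Complex.im ⁻¹' Metric.ball d (γ * Real.pi / 2) := by
    ext z; simp [sector, Real.dist_eq]
  rw [this]
  exact (convex_ball _ _).is_linear_preimage Complex.imLm.isLinear

theorem bddSector_eq (d γ : ℝ) {r : ℝ} (hr : 0 < r) :
    bddSector d γ r = sector d γ ∩ Complex.re ⁻¹' Iio (Real.log r) := by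
  ext z
  simp only [bddSector, sector, modulus, mem_ofPred_eq, mem_inter_iff, mem_preimage, mem_Iio,
    Real.lt_log_iff_exp_lt hr]

theorem isOpen_bddSector (d γ r : ℝ) : IsOpen (bddSector d γ r) :=
  (isOpen_lt (Complex.continuous_im.sub continuous_const).abs continuous_const).and
    (isOpen_lt (Real.continuous_exp.comp Complex.continuous_re) continuous_const)

theorem convex_bddSector (d γ : ℝ) {r : ℝ} (hr : 0 < r) : Convex ℝ (bddSector d γ r) := by
  rw [bddSector_eq d γ hr]
  exact (convex_sector d γ).inter ((convex_Iio _).is_linear_preimage Complex.reLm.isLinear)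

theorem isSectorialRegion_sector (d : ℝ) {γ : ℝ} (hγ : 0 < γ) :
    IsSectorialRegion d γ (sector d γ) where
  isOpen := isOpen_sector d γ
  isConnected := ⟨⟨⟨0, d⟩, by simp [sector]; positivity⟩, (convex_sector d γ).isPreconnected⟩
  subset := Subset.rfl
  bddSector_subset β _ hβ := ⟨1, one_pos, fun z hz => hz.1.trans (by
    have := Real.pi_pos
    nlinarith)⟩

/-- If the integrand is dominated without restriction on the modulus of the point, the Laplace
transform exists on the whole sector. -/
theorem isLaplaceTransform_sector {α ω : ℝ} (hα : 0 < α) (hω : 0 < ω) (ha : 0 < a)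
    (he : ∀ w : ℂ, |w.im| < ω * Real.pi / 2 → DifferentiableAt ℂ e w)
    (hf : ∀ u : ℂ, |u.im - d| < α * Real.pi / 2 → DifferentiableAt ℂ f u)
    (hD : ∀ ρ, ∀ θ < α * Real.pi / 2, ∀ η < ω * Real.pi / 2, ∃ C,
      LaplaceDominated e f d a θ η ρ C) :
    IsLaplaceTransform ω e f d α (sector d (α + ω)) (laplaceGlue e f d (α / (α + ω))) := by
  have hpi := Real.pi_pos
  have hs : α / (α + ω) * (α * Real.pi / 2 + ω * Real.pi / 2) = α * Real.pi / 2 := by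
    field_simp
  have hA : 0 < α * Real.pi / 2 := by positivity
  have hB : 0 < ω * Real.pi / 2 := by positivity
  refine ⟨isSectorialRegion_sector d (by positivity), fun z hz => ?_, fun τ hτ β hβ hβω => ?_⟩
  · exact (differentiableAt_laplaceGlue ha hA hB hs he hf (hD (z.re + 1))
      (by simp only [sector, mem_ofPred_eq] at hz; linarith) (lt_add_one _)).differentiableWithinAt
  · refine ⟨1, one_pos, fun z hz => ?_⟩
    have hzτ : |z.im - τ| < ω * Real.pi / 2 := hz.1.trans (by nlinarith)
    refine ⟨?_, ?_, ?_⟩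
    · have := abs_sub_le z.im τ d
      simp only [sector, mem_ofPred_eq]
      linarith
    · rw [integrableOn_laplaceIntegrand_iff]
      exact integrable_of_laplaceDominated ha he hf (hD z.re) hτ hzτ le_rfl
    · rw [laplaceDir_eq_laplaceLine]
      exact laplaceGlue_eq_laplaceLine ha hA hB hs he hf (hD z.re) hτ hzτ le_rfl

theorem LaplaceDominated.mono (hD : LaplaceDominated e f d a θ η ρ C) {θ' η' : ℝ} (hθ : θ' ≤ θ)
    (hη : η' ≤ η) : LaplaceDominated e f d a θ' η' ρ C :=
  fun ζ z h1 h2 h3 => hD ζ z (h1.trans hθ) (h2.trans hη) h3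

/-- If the integrand is dominated near the origin, with a bound on the modulus that may depend on
the subsectors, the Laplace transform exists on a sectorial region: a union over `c ∈ (0, 1)` of
bounded sectors of opening `c (α + ω)`. -/
theorem exists_isLaplaceTransform {α ω : ℝ} (hα : 0 < α) (hω : 0 < ω) (ha : 0 < a)
    (he : ∀ w : ℂ, |w.im| < ω * Real.pi / 2 → DifferentiableAt ℂ e w)
    (hf : ∀ u : ℂ, |u.im - d| < α * Real.pi / 2 → DifferentiableAt ℂ f u)
    (hD : ∀ θ < α * Real.pi / 2, ∀ η < ω * Real.pi / 2, ∃ ρ C,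
      LaplaceDominated e f d a θ η ρ C) :
    ∃ G g, IsLaplaceTransform ω e f d α G g := by
  have hpi := Real.pi_pos
  set A := α * Real.pi / 2 with hAdef
  set B := ω * Real.pi / 2 with hBdef
  have hA : 0 < A := by positivity
  have hB : 0 < B := by positivity
  have hlt : ∀ c : Ioo (0 : ℝ) 1, c.1 * A < A ∧ c.1 * B < B := fun c =>
    ⟨by have := c.2.2; nlinarith, by have := c.2.2; nlinarith⟩
  choose ρ C hρ using fun c : Ioo (0 : ℝ) 1 => hD _ (hlt c).1 _ (hlt c).2
  have hs : ∀ c : Ioo (0 : ℝ) 1, α / (α + ω) * (c.1 * A + c.1 * B) = c.1 * A := by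
    intro c
    rw [hAdef, hBdef]
    field_simp
  have hcA : ∀ c : Ioo (0 : ℝ) 1, 0 < c.1 * A := fun c => mul_pos c.2.1 hA
  have hcB : ∀ c : Ioo (0 : ℝ) 1, 0 < c.1 * B := fun c => mul_pos c.2.1 hB
  have he' : ∀ c : Ioo (0 : ℝ) 1, ∀ w : ℂ, |w.im| < c.1 * B → DifferentiableAt ℂ e w :=
    fun c w hw => he w (hw.trans (hlt c).2)
  have hf' : ∀ c : Ioo (0 : ℝ) 1, ∀ u : ℂ, |u.im - d| < c.1 * A → DifferentiableAt ℂ f u :=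
    fun c w hw => hf w (hw.trans (hlt c).1)
  have hD' : ∀ c : Ioo (0 : ℝ) 1, ∀ θ < c.1 * A, ∀ η < c.1 * B, ∃ K,
      LaplaceDominated e f d a θ η (ρ c) K :=
    fun c θ hθ η hη => ⟨C c, (hρ c).mono hθ.le hη.le⟩
  set V : Ioo (0 : ℝ) 1 → Set ℂ := fun c => bddSector d (c.1 * (α + ω)) (Real.exp (ρ c)) with hV
  have hmemV : ∀ (c : Ioo (0 : ℝ) 1) (z : ℂ), z ∈ V c ↔ |z.im - d| < c.1 * A + c.1 * B ∧
      z.re < ρ c := by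
    intro c z
    simp only [hV, bddSector, modulus, mem_ofPred_eq, Real.exp_lt_exp]
    rw [show c.1 * (α + ω) * Real.pi / 2 = c.1 * A + c.1 * B by rw [hAdef, hBdef]; ring]
  have hdir : ∀ τ, |τ - d| < A → ∀ β, 0 < β → β < ω → ∃ c : Ioo (0 : ℝ) 1,
      |τ - d| < c.1 * A ∧ β * Real.pi / 2 < c.1 * B := by
    intro τ hτ β hβ hβω
    have h1 : |τ - d| / A < 1 := (div_lt_one hA).2 hτ
    have h2 : β * Real.pi / 2 / B < 1 := (div_lt_one hB).2 (by rw [hBdef]; nlinarith)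
    obtain ⟨c, hc1, hc2⟩ := exists_between (max_lt h1 h2)
    have h3 := (le_max_left _ _).trans_lt hc1
    have h4 := (le_max_right _ _).trans_lt hc1
    refine ⟨⟨c, lt_of_le_of_lt (by positivity) h3, hc2⟩, ?_, ?_⟩
    · rwa [div_lt_iff₀ hA] at h3
    · rwa [div_lt_iff₀ hB] at h4
  refine ⟨⋃ c, V c, laplaceGlue e f d (α / (α + ω)), ⟨?_, ?_, ?_, ?_⟩, ?_, ?_⟩
  · exact isOpen_iUnion fun c => isOpen_bddSector _ _ _
  · have hne : Nonempty (Ioo (0 : ℝ) 1) := ⟨⟨1 / 2, by norm_num, by norm_num⟩⟩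
    refine IsConnected.iUnion_of_reflTransGen (fun c => ⟨⟨⟨ρ c - 1, d⟩, ?_⟩,
      (convex_bddSector _ _ (Real.exp_pos _)).isPreconnected⟩)
      (fun c c' => Relation.ReflTransGen.single ⟨⟨min (ρ c) (ρ c') - 1, d⟩, ?_, ?_⟩)
    · have := hcA c
      have := hcB c
      exact (hmemV c _).2 ⟨by simp; linarith, by simp⟩
    · have := hcA c
      have := hcB c
      exact (hmemV c _).2 ⟨by simp; linarith, (sub_one_lt _).trans_le (min_le_left _ _)⟩
    · have := hcA c'
      have := hcB c'
      exact (hmemV c' _).2 ⟨by simp; linarith, (sub_one_lt _).trans_le (min_le_right _ _)⟩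
  · refine iUnion_subset fun c z hz => ?_
    have := ((hmemV c z).1 hz).1
    have h1 := hlt c
    simp only [sector, mem_ofPred_eq]
    linarith
  · intro β hβ hβγ
    have hγ : 0 < α + ω := add_pos hα hω
    let c : Ioo (0 : ℝ) 1 := ⟨β / (α + ω), div_pos hβ hγ, (div_lt_one hγ).2 hβγ⟩
    refine ⟨Real.exp (ρ c), Real.exp_pos _, fun z hz => mem_iUnion.2 ⟨c, ?_⟩⟩
    have hcβ : c.1 * (α + ω) = β := div_mul_cancel₀ _ hγ.ne'
    simp only [hV, hcβ]
    exact hz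
  · intro z hz
    obtain ⟨c, hc⟩ := mem_iUnion.1 hz
    obtain ⟨h1, h2⟩ := (hmemV c z).1 hc
    exact (differentiableAt_laplaceGlue ha (hcA c) (hcB c) (hs c) (he' c) (hf' c) (hD' c)
      h1 h2).differentiableWithinAt
  · intro τ hτ β hβ hβω
    obtain ⟨c, h1, h2⟩ := hdir τ hτ β hβ hβω
    refine ⟨Real.exp (ρ c), Real.exp_pos _, fun z hz => ?_⟩
    have hzre : z.re < ρ c := Real.exp_lt_exp.1 hz.2
    have hzτ : |z.im - τ| < c.1 * B := hz.1.trans h2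
    refine ⟨mem_iUnion.2 ⟨c, (hmemV c z).2 ⟨?_, hzre⟩⟩, ?_, ?_⟩
    · have := abs_sub_le z.im τ d
      linarith
    · rw [integrableOn_laplaceIntegrand_iff]
      exact integrable_of_laplaceDominated ha (he' c) (hf' c) (hD' c) h1 hzτ hzre.le
    · rw [laplaceDir_eq_laplaceLine]
      exact laplaceGlue_eq_laplaceLine ha (hcA c) (hcB c) (hs c) (he' c) (hf' c) (hD' c)
        h1 hzτ hzre.le

end Laplace

/-! ### Growth conditions -/

/-- A holomorphic kernel on the strip `|im w| < B` of the logarithmic coordinate which is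
`O(exp(-a |re w|) exp(-ω_M(exp(re w) / k)))` on smaller strips. The first factor expresses both the
power decay of a strong kernel at the origin and its decay at infinity. -/
structure HasKernelBound (M : ℕ → ℝ) (B a : ℝ) (e : ℂ → ℂ) : Prop where
  differentiableAt : ∀ w : ℂ, |w.im| < B → DifferentiableAt ℂ e w
  bound : ∀ θ < B, ∃ C > 0, ∃ k > 0, ∀ w : ℂ, |w.im| ≤ θ →
    ‖e w‖ ≤ C * (Real.exp (-a * |w.re|) * Real.exp (-assocFun M (Real.exp w.re / k)))

section Growth

variable {M : ℕ → ℝ} {e f : ℂ → ℂ} {d a A B : ℝ}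

theorem HasKernelBound.mono (h : HasKernelBound M B a e) {a' : ℝ} (ha : a' ≤ a) :
    HasKernelBound M B a' e where
  differentiableAt := h.differentiableAt
  bound θ hθ := by
    obtain ⟨C, hC, k, hk, H⟩ := h.bound θ hθ
    refine ⟨C, hC, k, hk, fun w hw => (H w hw).trans ?_⟩
    gcongr

/-- A kernel bound also yields plain exponential decay. -/
theorem HasKernelBound.exists_norm_le (h : HasKernelBound M B a e) (hM : IsWeightSequence M)
    {θ : ℝ} (hθ : θ < B) :
    ∃ C > 0, ∀ w : ℂ, |w.im| ≤ θ → ‖e w‖ ≤ C * Real.exp (-a * |w.re|) := by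
  obtain ⟨C, hC, k, hk, H⟩ := h.bound θ hθ
  refine ⟨C, hC, fun w hw => (H w hw).trans ?_⟩
  have h1 : Real.exp (-assocFun M (Real.exp w.re / k)) ≤ 1 :=
    Real.exp_le_one_iff.2 (neg_nonpos.2 (hM.assocFun_nonneg (by positivity)))
  have h2 : Real.exp (-a * |w.re|) * Real.exp (-assocFun M (Real.exp w.re / k)) ≤
      Real.exp (-a * |w.re|) := mul_le_of_le_one_right (Real.exp_pos _).le h1
  gcongr

/-- Growth bound for `f` against a kernel: domination holds as long as `exp (re z) ≤ K / k`. -/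
theorem laplaceDominated_of_bounds (hM : IsWeightSequence M) {θ η C₁ k C₂ K : ℝ} (hC₁ : 0 < C₁)
    (hk : 0 < k) (hK : 0 < K)
    (he : ∀ w : ℂ, |w.im| ≤ η →
      ‖e w‖ ≤ C₁ * (Real.exp (-a * |w.re|) * Real.exp (-assocFun M (Real.exp w.re / k))))
    (hf : ∀ u : ℂ, |u.im - d| ≤ θ → ‖f u‖ ≤ C₂ * Real.exp (assocFun M (Real.exp u.re / K))) :
    LaplaceDominated e f d a θ η (Real.log (K / k)) (C₁ * C₂) := by
  intro ζ z h1 h2 h3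
  have g1 := he (ζ - z) (by rw [Complex.sub_im, abs_sub_comm]; exact h2)
  have g2 := hf ζ h1
  have hC₂ : 0 ≤ C₂ := nonneg_of_mul_nonneg_left ((norm_nonneg _).trans g2) (Real.exp_pos _)
  rw [norm_mul]
  refine (mul_le_mul g1 g2 (norm_nonneg _) (by positivity)).trans ?_
  rw [Complex.sub_re]
  have h4 : Real.exp z.re ≤ K / k := (Real.le_log_iff_exp_le (by positivity)).1 h3
  have h5 : assocFun M (Real.exp ζ.re / K) ≤ assocFun M (Real.exp (ζ.re - z.re) / k) := by
    refine hM.assocFun_mono (by positivity) ?_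
    rw [le_div_iff₀ hk] at h4
    rw [Real.exp_sub, div_div, div_le_div_iff₀ hK (by positivity)]
    gcongr
  have h6 : Real.exp (-assocFun M (Real.exp (ζ.re - z.re) / k)) *
      Real.exp (assocFun M (Real.exp ζ.re / K)) ≤ 1 := by
    rw [← Real.exp_add]
    exact Real.exp_le_one_iff.2 (by linarith)
  calc _ = C₁ * C₂ * Real.exp (-a * |ζ.re - z.re|) *
        (Real.exp (-assocFun M (Real.exp (ζ.re - z.re) / k)) *
          Real.exp (assocFun M (Real.exp ζ.re / K))) := by ring
    _ ≤ C₁ * C₂ * Real.exp (-a * |ζ.re - z.re|) * 1 := by gcongr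
    _ = _ := mul_one _

/-- A function of `M`-growth has a Laplace transform near the origin. -/
theorem HasKernelBound.exists_laplaceDominated (h : HasKernelBound M B a e)
    (hM : IsWeightSequence M)
    (hf : ∀ θ < A, ∃ C > 0, ∃ K > 0, ∀ u : ℂ, |u.im - d| ≤ θ →
      ‖f u‖ ≤ C * Real.exp (assocFun M (Real.exp u.re / K))) {θ η : ℝ} (hθ : θ < A) (hη : η < B) :
    ∃ ρ C, LaplaceDominated e f d a θ η ρ C := by
  obtain ⟨C₁, hC₁, k, hk, H₁⟩ := h.bound η hη
  obtain ⟨C₂, -, K, hK, H₂⟩ := hf θ hθ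
  exact ⟨_, _, laplaceDominated_of_bounds hM hC₁ hk hK H₁ H₂⟩

/-- If `f` grows more slowly than every dilation of `exp ω_M`, domination holds for all moduli. -/
theorem HasKernelBound.exists_laplaceDominated_of_forall (h : HasKernelBound M B a e)
    (hM : IsWeightSequence M)
    (hf : ∀ θ < A, ∀ K > 0, ∃ C, ∀ u : ℂ, |u.im - d| ≤ θ →
      ‖f u‖ ≤ C * Real.exp (assocFun M (Real.exp u.re / K))) (ρ : ℝ) {θ η : ℝ} (hθ : θ < A)
    (hη : η < B) :
    ∃ C, LaplaceDominated e f d a θ η ρ C := by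
  obtain ⟨C₁, hC₁, k, hk, H₁⟩ := h.bound η hη
  obtain ⟨C₂, H₂⟩ := hf θ hθ (k * Real.exp ρ) (by positivity)
  have := laplaceDominated_of_bounds hM hC₁ hk (by positivity) H₁ H₂
  rw [mul_div_cancel_left₀ _ hk.ne', Real.log_exp] at this
  exact ⟨_, this⟩

end Growth

/-! ### The convolution of two kernels -/

section Kernel

variable {M M₁ M₂ : ℕ → ℝ} {e e₁ e₂ E : ℂ → ℂ}

/-- By moderate growth the decay `exp (-ω_M)` can be written as a square, one factor of which can be
spent on polynomial decay at infinity. -/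
theorem IsPreKernel.exists_bound (h : IsPreKernel M e E) (hM : IsWeightSequence M) {θ : ℝ}
    (hθ : θ < growthOrder M * Real.pi / 2) :
    ∃ c > 0, ∃ k > 0, ∀ w : ℂ, |w.im| ≤ θ →
      ‖e w‖ ≤ c * (Real.exp (-assocFun M (Real.exp w.re / k)) *
        Real.exp (-assocFun M (Real.exp w.re / k))) := by
  have hpi := Real.pi_pos
  obtain ⟨A, hA, hmg⟩ := hM.exists_two_mul_assocFun_le h.stronglyRegular
  have hτ : 2 * θ / Real.pi < growthOrder M := by
    rw [div_lt_iff₀ hpi]; linarith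
  obtain ⟨τ, hτ1, hτ2⟩ := exists_between hτ
  obtain ⟨c, hc, k, hk, H⟩ := h.bound (growthOrder M - τ) (by linarith)
  rw [sub_sub_cancel] at H
  refine ⟨c, hc, k * A, by positivity, fun w hw => ?_⟩
  rw [div_lt_iff₀ hpi] at hτ1
  have h1 := H w (by simp only [sector, mem_ofPred_eq, sub_zero]; linarith)
  refine h1.trans (mul_le_mul_of_nonneg_left ?_ hc.le)
  rw [← Real.exp_add]
  refine Real.exp_le_exp.2 ?_
  have h2 := hmg (Real.exp w.re / (k * A)) (by positivity)
  have h3 : A * (Real.exp w.re / (k * A)) = modulus w / k := by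
    rw [modulus]; field_simp
  rw [h3] at h2
  linarith

/-- The two conditions on a strong kernel, power decay at the origin and decay of order `exp (-ω_M)`
at infinity, combine into a single bound with one exponent `a`. -/
theorem IsStrongKernel.exists_hasKernelBound (h : IsStrongKernel M e E) (hM : IsWeightSequence M)
    (hω : 0 < growthOrder M) :
    ∃ a > 0, HasKernelBound M (growthOrder M * Real.pi / 2) a e := by
  have hpi := Real.pi_pos
  obtain ⟨a₀, ha₀, hor⟩ := h.origin
  refine ⟨min a₀ 1, lt_min ha₀ one_pos, fun w hw => ?_, fun θ hθ => ?_⟩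
  · exact h.holomorphic.differentiableAt ((isOpen_sector _ _).mem_nhds
      (by simpa only [sector, mem_ofPred_eq, sub_zero] using hw))
  set a := min a₀ 1 with ha
  have ha0 : 0 < a := lt_min ha₀ one_pos
  obtain ⟨c, hc, k, hk, H⟩ := h.exists_bound hM hθ
  have hτ : max (2 * θ / Real.pi) 0 < growthOrder M :=
    max_lt (by rw [div_lt_iff₀ hpi]; linarith) hω
  obtain ⟨τ, hτ1, hτ2⟩ := exists_between hτ
  have hτθ := (le_max_left _ _).trans_lt hτ1
  rw [div_lt_iff₀ hpi] at hτθ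
  obtain ⟨C₀, hC₀, ε, hε, H₀⟩ := hor τ ((le_max_right _ _).trans_lt hτ1) hτ2
  set L := Real.exp (assocFun M (1 / k)) with hL
  have hL0 : 0 < L := Real.exp_pos _
  have hM1 := hM.pos 1
  refine ⟨c * (M 1 * k) + C₀ * L + c * L * ε ^ (-a), by positivity, k, hk, fun w hw => ?_⟩
  have hX : 0 < Real.exp (-a * |w.re|) := Real.exp_pos _
  have hY : 0 < Real.exp (-assocFun M (Real.exp w.re / k)) := Real.exp_pos _
  have hZ : Real.exp (-assocFun M (Real.exp w.re / k)) ≤ 1 :=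
    Real.exp_le_one_iff.2 (neg_nonpos.2 (hM.assocFun_nonneg (by positivity)))
  have hH := H w hw
  have hεa : 0 < ε ^ (-a) := by positivity
  set X := Real.exp (-a * |w.re|) with hXdef
  set Y := Real.exp (-assocFun M (Real.exp w.re / k)) with hYdef
  rcases le_total 0 w.re with hre | hre
  · have h1 : Y ≤ M 1 * k * X := by
      have h2 := hM.pow_mul_exp_neg_le (t := Real.exp w.re / k) (by positivity) 1
      rw [pow_one, ← hYdef, div_mul_eq_mul_div, div_le_iff₀ hk] at h2
      have h3 : Real.exp (-w.re) ≤ X := by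
        rw [hXdef, abs_of_nonneg hre]
        refine Real.exp_le_exp.2 ?_
        nlinarith [min_le_right a₀ 1]
      calc Y = Real.exp w.re * Y * Real.exp (-w.re) := by
            rw [mul_right_comm, ← Real.exp_add, add_neg_cancel, Real.exp_zero, one_mul]
        _ ≤ M 1 * k * X := mul_le_mul h2 h3 (Real.exp_pos _).le (by positivity)
    calc ‖e w‖ ≤ c * (Y * Y) := hH
      _ ≤ c * (M 1 * k * X * Y) := by gcongr
      _ = c * (M 1 * k) * (X * Y) := by ring
      _ ≤ _ := by gcongr; nlinarith [mul_pos hC₀ hL0, mul_pos (mul_pos hc hL0) hεa]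
  · have hLY : 1 ≤ L * Y := by
      rw [hL, hYdef, ← Real.exp_add]
      refine Real.one_le_exp ?_
      have := hM.assocFun_mono (s := Real.exp w.re / k) (t := 1 / k) (by positivity)
        (by gcongr; exact Real.exp_le_one_iff.2 hre)
      linarith
    have hXr : X = Real.exp w.re ^ a := by
      rw [hXdef, abs_of_nonpos hre, ← Real.exp_mul]; ring_nf
    rcases le_or_gt (Real.exp w.re) ε with hr | hr
    · have h1 := H₀ w (by simp only [sector, mem_ofPred_eq, sub_zero]; linarith) hr
      have h2 : modulus w ^ a₀ ≤ X := by
        rw [hXr, modulus]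
        exact Real.rpow_le_rpow_of_exponent_ge (Real.exp_pos _) (Real.exp_le_one_iff.2 hre)
          (min_le_left _ _)
      calc ‖e w‖ ≤ C₀ * X * 1 := by rw [mul_one]; exact h1.trans (by gcongr)
        _ ≤ C₀ * X * (L * Y) := by gcongr
        _ = C₀ * L * (X * Y) := by ring
        _ ≤ _ := by
          gcongr
          nlinarith [mul_pos hc (mul_pos hM1 hk), mul_pos (mul_pos hc hL0) hεa]
    · have h1 : 1 ≤ ε ^ (-a) * X := by
        rw [Real.rpow_neg hε.le, ← div_eq_inv_mul, one_le_div (by positivity), hXr]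
        exact Real.rpow_le_rpow hε.le hr.le ha0.le
      calc ‖e w‖ ≤ c * (Y * Y) := hH
        _ ≤ c * (1 * 1) := by gcongr
        _ ≤ c * ((L * Y) * (ε ^ (-a) * X)) := by gcongr
        _ = c * L * ε ^ (-a) * (X * Y) := by ring
        _ ≤ _ := by
          gcongr
          nlinarith [mul_pos hc (mul_pos hM1 hk), mul_pos hC₀ hL0]

variable {ω₁ ω₂ a : ℝ}

theorem HasKernelBound.differentiableAt_comp_neg {B : ℝ} (h : HasKernelBound M B a e) (u : ℂ)
    (hu : |u.im - 0| < B) : DifferentiableAt ℂ (fun u => e (-u)) u :=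
  (h.differentiableAt (-u) (by simpa using hu)).comp u differentiableAt_id.neg

/-- The function `u ↦ e₂(1/u)` is bounded on subsectors, so its Laplace transform by any kernel
exists on the whole sector. -/
theorem exists_laplaceDominated_comp_neg {B₁ B₂ : ℝ} (hM₁ : IsWeightSequence M₁)
    (hM₂ : IsWeightSequence M₂) (ha : 0 < a) (h₁ : HasKernelBound M₁ B₁ a e₁)
    (h₂ : HasKernelBound M₂ B₂ a e₂) (ρ : ℝ) :
    ∀ θ < B₂, ∀ η < B₁, ∃ C, LaplaceDominated e₁ (fun u => e₂ (-u)) 0 a θ η ρ C := by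
  intro θ hθ η hη
  refine h₁.exists_laplaceDominated_of_forall hM₁ (A := B₂) (fun θ hθ K hK => ?_) ρ hθ hη
  obtain ⟨C, hC, H⟩ := h₂.exists_norm_le hM₂ hθ
  refine ⟨C, fun u hu => (H (-u) (by simpa using hu)).trans ?_⟩
  gcongr
  have h1 := hM₁.assocFun_nonneg (t := Real.exp u.re / K) (by positivity)
  have h2 := mul_nonneg ha.le (abs_nonneg (-u).re)
  linarith

theorem convKernel_neg_eq (ω₁ ω₂ : ℝ) (e₁ e₂ : ℂ → ℂ) (z : ℂ) :
    convKernel ω₁ ω₂ e₁ e₂ (-z) = laplaceGlue e₁ (fun u => e₂ (-u)) 0 (ω₂ / (ω₂ + ω₁)) z := by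
  rw [convKernel, laplaceDir_eq_laplaceLine, laplaceGlue, neg_neg, add_comm ω₁ ω₂]
  congr 1
  simp

section Conv

variable (hω₁ : 0 < ω₁) (hω₂ : 0 < ω₂) (ha : 0 < a) (hM₁ : IsWeightSequence M₁)
  (hM₂ : IsWeightSequence M₂) (h₁ : HasKernelBound M₁ (ω₁ * Real.pi / 2) a e₁)
  (h₂ : HasKernelBound M₂ (ω₂ * Real.pi / 2) a e₂)

include hω₁ hω₂ ha hM₁ hM₂ h₁ h₂

theorem isLaplaceTransform_convKernel :
    IsLaplaceTransform ω₁ e₁ (fun u => e₂ (-u)) 0 ω₂ (sector 0 (ω₂ + ω₁))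
      (fun z => convKernel ω₁ ω₂ e₁ e₂ (-z)) := by
  have := isLaplaceTransform_sector hω₂ hω₁ ha h₁.differentiableAt h₂.differentiableAt_comp_neg
    (exists_laplaceDominated_comp_neg hM₁ hM₂ ha h₁ h₂)
  simpa only [convKernel_neg_eq] using this

theorem convKernel_eq_laplaceLine {z : ℂ} {τ : ℝ} (hτ : |τ| < ω₂ * Real.pi / 2)
    (hz : |(-z).im - τ| < ω₁ * Real.pi / 2) :
    convKernel ω₁ ω₂ e₁ e₂ z = laplaceLine e₁ (fun u => e₂ (-u)) τ (-z) := by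
  have hpi := Real.pi_pos
  rw [← neg_neg z, convKernel_neg_eq, neg_neg z]
  refine laplaceGlue_eq_laplaceLine (A := ω₂ * Real.pi / 2) (B := ω₁ * Real.pi / 2) ha
    (by positivity) (by positivity) (by field_simp)
    h₁.differentiableAt h₂.differentiableAt_comp_neg
    (exists_laplaceDominated_comp_neg hM₁ hM₂ ha h₁ h₂ (-z).re) (by simpa using hτ) hz le_rfl

omit hω₁ hω₂ in
theorem integrable_convKernel_laplaceLine {z : ℂ} {τ : ℝ} (hτ : |τ| < ω₂ * Real.pi / 2)
    (hz : |(-z).im - τ| < ω₁ * Real.pi / 2) :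
    Integrable (fun x : ℝ => e₁ (x + τ * Complex.I - -z) * e₂ (-(x + τ * Complex.I))) :=
  integrable_of_laplaceDominated (A := ω₂ * Real.pi / 2) (B := ω₁ * Real.pi / 2) ha
    h₁.differentiableAt h₂.differentiableAt_comp_neg
    (exists_laplaceDominated_comp_neg hM₁ hM₂ ha h₁ h₂ (-z).re) (by simpa using hτ) hz le_rfl

/-- In the logarithmic coordinate the convolution of kernels is the additive convolution along any
admissible horizontal line. -/
theorem convKernel_eq_integral {z : ℂ} {s : ℝ} (hs : |s| < ω₁ * Real.pi / 2)
    (hz : |z.im - s| < ω₂ * Real.pi / 2) :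
    convKernel ω₁ ω₂ e₁ e₂ z =
      ∫ x : ℝ, e₁ (x + s * Complex.I) * e₂ (z - (x + s * Complex.I)) := by
  rw [convKernel_eq_laplaceLine hω₁ hω₂ ha hM₁ hM₂ h₁ h₂ (τ := s - z.im)
    (by rwa [abs_sub_comm])
    (by rwa [Complex.neg_im, show -z.im - (s - z.im) = -s by ring, abs_neg]), laplaceLine,
    ← integral_sub_right_eq_self (μ := volume) _ z.re]
  congr 1
  ext x
  have h : ((x - z.re : ℝ) : ℂ) + ((s - z.im : ℝ) : ℂ) * Complex.I = x + s * Complex.I - z := by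
    conv_rhs => rw [← Complex.re_add_im z]
    push_cast
    ring
  rw [h, sub_neg_eq_add, sub_add_cancel, neg_sub]

omit hω₁ hω₂ in
theorem integrable_convKernel {z : ℂ} {s : ℝ} (hs : |s| < ω₁ * Real.pi / 2)
    (hz : |z.im - s| < ω₂ * Real.pi / 2) :
    Integrable (fun x : ℝ => e₁ (x + s * Complex.I) * e₂ (z - (x + s * Complex.I))) := by
  have := (integrable_convKernel_laplaceLine ha hM₁ hM₂ h₁ h₂ (z := z) (τ := s - z.im)
    (by rwa [abs_sub_comm])
    (by rwa [Complex.neg_im, show -z.im - (s - z.im) = -s by ring, abs_neg])).comp_sub_right z.re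
  refine this.congr (Eventually.of_forall fun x => ?_)
  have h : ((x - z.re : ℝ) : ℂ) + ((s - z.im : ℝ) : ℂ) * Complex.I = x + s * Complex.I - z := by
    conv_rhs => rw [← Complex.re_add_im z]
    push_cast
    ring
  beta_reduce
  rw [h, sub_neg_eq_add, sub_add_cancel, neg_sub]

theorem differentiableAt_convKernel {z : ℂ} (hz : |z.im| < (ω₁ + ω₂) * Real.pi / 2) :
    DifferentiableAt ℂ (convKernel ω₁ ω₂ e₁ e₂) z := by
  have h := (isLaplaceTransform_convKernel hω₁ hω₂ ha hM₁ hM₂ h₁ h₂).holomorphic.differentiableAt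
    ((isOpen_sector _ _).mem_nhds (show -z ∈ sector 0 (ω₂ + ω₁) by
      simp only [sector, mem_ofPred_eq, sub_zero, Complex.neg_im, abs_neg]; linarith))
  have h2 := DifferentiableAt.comp z h differentiableAt_id.neg
  simpa [Function.comp_def] using h2

/-- The convolution inherits the kernel bound for the product sequence, by
`ω_{M₁ M₂}(st) ≤ ω_{M₁}(s) + ω_{M₂}(t)` inside the integral. Half of the exponent `a` is spent on
the convergence of the integral. -/
theorem hasKernelBound_convKernel :
    HasKernelBound (M₁ * M₂) ((ω₁ + ω₂) * Real.pi / 2) (a / 2) (convKernel ω₁ ω₂ e₁ e₂) where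
  differentiableAt z hz := differentiableAt_convKernel hω₁ hω₂ ha hM₁ hM₂ h₁ h₂ hz
  bound ψ hψ := by
    have hpi := Real.pi_pos
    have hψ' : ψ < ω₁ * Real.pi / 2 + ω₂ * Real.pi / 2 := by linarith
    -- the argument is split between the two kernels in the ratio of their openings
    set σ := ω₁ / (ω₁ + ω₂) with hσ
    have hσ0 : 0 < σ := by positivity
    have hσ1 : 0 < 1 - σ := by
      rw [hσ, one_sub_div (by positivity)]
      simpa using by positivity
    have e1 : σ * (ω₁ * Real.pi / 2 + ω₂ * Real.pi / 2) = ω₁ * Real.pi / 2 := by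
      rw [hσ]; field_simp
    have e2 : (1 - σ) * (ω₁ * Real.pi / 2 + ω₂ * Real.pi / 2) = ω₂ * Real.pi / 2 := by linarith
    have hθ₁ : σ * ψ < ω₁ * Real.pi / 2 := by
      rw [← e1]; exact mul_lt_mul_of_pos_left hψ' hσ0
    have hθ₂ : (1 - σ) * ψ < ω₂ * Real.pi / 2 := by
      rw [← e2]; exact mul_lt_mul_of_pos_left hψ' hσ1
    obtain ⟨C₁, hC₁, k₁, hk₁, H₁⟩ := h₁.bound _ hθ₁
    obtain ⟨C₂, hC₂, k₂, hk₂, H₂⟩ := h₂.bound _ hθ₂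
    have hI := integrable_exp_neg_mul_abs (half_pos ha) 0
    refine ⟨C₁ * C₂ * (1 + ∫ x : ℝ, Real.exp (-(a / 2) * |x - 0|)), ?_, k₁ * k₂, by positivity,
      fun z hz => ?_⟩
    · have : 0 ≤ ∫ x : ℝ, Real.exp (-(a / 2) * |x - 0|) :=
        integral_nonneg fun x => (Real.exp_pos _).le
      positivity
    have g1 : |σ * z.im| ≤ σ * ψ := by rw [abs_mul, abs_of_pos hσ0]; gcongr
    have g2 : |z.im - σ * z.im| ≤ (1 - σ) * ψ := by
      rw [show z.im - σ * z.im = (1 - σ) * z.im by ring, abs_mul, abs_of_pos hσ1]; gcongr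
    rw [convKernel_eq_integral hω₁ hω₂ ha hM₁ hM₂ h₁ h₂ (g1.trans_lt hθ₁) (g2.trans_lt hθ₂)]
    set P := Real.exp (-(a / 2) * |z.re|) * Real.exp (-assocFun (M₁ * M₂)
      (Real.exp z.re / (k₁ * k₂))) with hP
    have hP0 : 0 < P := by positivity
    have hbd : ∀ x : ℝ, ‖e₁ (x + (σ * z.im : ℝ) * Complex.I) *
        e₂ (z - (x + (σ * z.im : ℝ) * Complex.I))‖ ≤
        C₁ * C₂ * P * Real.exp (-(a / 2) * |x - 0|) := by
      intro x
      have b1 := H₁ (x + (σ * z.im : ℝ) * Complex.I) (by simpa using g1)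
      have b2 := H₂ (z - (x + (σ * z.im : ℝ) * Complex.I)) (by simpa using g2)
      have r1 : ((x : ℂ) + (σ * z.im : ℝ) * Complex.I).re = x := by simp
      rw [Complex.sub_re, r1] at b2
      rw [r1] at b1
      rw [norm_mul]
      refine (mul_le_mul b1 b2 (norm_nonneg _) (by positivity)).trans ?_
      have hW : assocFun (M₁ * M₂) (Real.exp z.re / (k₁ * k₂)) ≤
          assocFun M₁ (Real.exp x / k₁) + assocFun M₂ (Real.exp (z.re - x) / k₂) := by
        have := assocFun_mul_le hM₁ hM₂ (s := Real.exp x / k₁) (t := Real.exp (z.re - x) / k₂)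
          (by positivity) (by positivity)
        rwa [div_mul_div_comm, ← Real.exp_add, add_sub_cancel] at this
      rw [hP, sub_zero]
      calc _ = C₁ * C₂ * Real.exp (-a * |x| + -assocFun M₁ (Real.exp x / k₁) +
            (-a * |z.re - x| + -assocFun M₂ (Real.exp (z.re - x) / k₂))) := by
            simp only [Real.exp_add]; ring
        _ ≤ C₁ * C₂ * Real.exp (-(a / 2) * |z.re| + -assocFun (M₁ * M₂)
            (Real.exp z.re / (k₁ * k₂)) + -(a / 2) * |x|) := by
            refine mul_le_mul_of_nonneg_left (Real.exp_le_exp.2 ?_) (by positivity)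
            have t : |z.re| ≤ |z.re - x| + |x| := by
              simpa using abs_sub_le z.re x 0
            have := mul_nonneg ha.le (abs_nonneg (z.re - x))
            nlinarith
        _ = _ := by simp only [Real.exp_add]; ring
    refine (norm_integral_le_of_norm_le (hI.const_mul _) (Eventually.of_forall hbd)).trans ?_
    rw [integral_const_mul]
    have : 0 < C₁ * C₂ * P := by positivity
    nlinarith

end Conv

/-! ### Moments -/

theorem momentFun_integrand_eq (e : ℂ → ℂ) (lam : ℂ) {t : ℝ} (ht : 0 < t) :
    (t : ℂ) ^ (lam - 1) • e (polar t 0) =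
      Complex.exp (lam * Real.log t) * e (Real.log t) / t := by
  have ht' : (t : ℂ) ≠ 0 := Complex.ofReal_ne_zero.2 ht.ne'
  rw [smul_eq_mul, Complex.cpow_sub _ _ ht', Complex.cpow_one, Complex.cpow_def_of_ne_zero ht',
    ← Complex.ofReal_log ht.le, polar]
  simp only [Complex.ofReal_zero, zero_mul, add_zero]
  rw [mul_comm lam]
  ring

theorem mellinConvergent_iff_integrable (e : ℂ → ℂ) (lam : ℂ) :
    MellinConvergent (fun t : ℝ => e (polar t 0)) lam ↔
      Integrable (fun x : ℝ => Complex.exp (lam * x) * e x) := by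
  have := integrableOn_comp_log_div_iff
    (fun x : ℝ => Complex.exp (lam * x) * e x) MeasurableSet.univ
  rw [image_exp_univ, integrableOn_univ] at this
  rw [← this]
  exact integrableOn_congr_fun (fun t ht => momentFun_integrand_eq e lam ht) measurableSet_Ioi

theorem momentFun_eq_integral (e : ℂ → ℂ) (lam : ℂ) :
    momentFun e lam = ∫ x : ℝ, Complex.exp (lam * x) * e x := by
  have := setIntegral_comp_log_div
    (fun x : ℝ => Complex.exp (lam * x) * e x) MeasurableSet.univ
  rw [image_exp_univ, setIntegral_univ] at this
  rw [← this]
  exact setIntegral_congr_fun measurableSet_Ioi (fun t ht => momentFun_integrand_eq e lam ht)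

theorem HasKernelBound.continuous_real {B : ℝ} (h : HasKernelBound M B a e) (hB : 0 < B) :
    Continuous fun x : ℝ => e x := by
  have := continuous_horizontal (f := e) (c := 0) fun z hz =>
    (h.differentiableAt z (by simpa [hz] using hB)).continuousAt
  simpa using this

theorem HasKernelBound.integrable_exp_mul {B : ℝ} (h : HasKernelBound M B a e) (hB : 0 < B)
    (ha : 0 < a) (hM : IsWeightSequence M) {lam : ℂ} (hl : 0 ≤ lam.re) :
    Integrable (fun x : ℝ => Complex.exp (lam * x) * e x) := by
  obtain ⟨C, hC, k, hk, H⟩ := h.bound 0 hB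
  obtain ⟨N, hN⟩ := exists_nat_ge lam.re
  refine Integrable.mono' ((integrable_exp_neg_mul_abs ha 0).const_mul (C * (1 + M N * k ^ N)))
    (Continuous.mul (by fun_prop) (h.continuous_real hB)).aestronglyMeasurable
    (Eventually.of_forall fun x => ?_)
  have h1 := H x (by simp)
  rw [Complex.ofReal_re] at h1
  have h2 : ‖Complex.exp (lam * x)‖ ≤ 1 + Real.exp x ^ N := by
    rw [Complex.norm_exp, Complex.re_mul_ofReal, ← Real.exp_nat_mul]
    rcases le_total x 0 with hx | hx
    · have : Real.exp (lam.re * x) ≤ 1 :=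
        Real.exp_le_one_iff.2 (mul_nonpos_of_nonneg_of_nonpos hl hx)
      have := Real.exp_pos (N * x)
      linarith
    · have : Real.exp (lam.re * x) ≤ Real.exp (N * x) := by gcongr
      linarith
  have h3 := hM.pow_mul_exp_neg_le (t := Real.exp x / k) (by positivity) N
  rw [div_pow, div_mul_eq_mul_div, div_le_iff₀ (by positivity)] at h3
  have h4 : Real.exp (-assocFun M (Real.exp x / k)) ≤ 1 :=
    Real.exp_le_one_iff.2 (neg_nonpos.2 (hM.assocFun_nonneg (by positivity)))
  rw [norm_mul, sub_zero]
  calc _ ≤ (1 + Real.exp x ^ N) *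
        (C * (Real.exp (-a * |x|) * Real.exp (-assocFun M (Real.exp x / k)))) :=
        mul_le_mul h2 h1 (norm_nonneg _) (by positivity)
    _ = C * Real.exp (-a * |x|) * (Real.exp (-assocFun M (Real.exp x / k)) +
        Real.exp x ^ N * Real.exp (-assocFun M (Real.exp x / k))) := by ring
    _ ≤ C * Real.exp (-a * |x|) * (1 + M N * k ^ N) := by gcongr
    _ = _ := by ring

/-- The moment function turns the convolution of kernels into a product, by Fubini. -/
theorem momentFun_convKernel (hω₁ : 0 < ω₁) (hω₂ : 0 < ω₂) (ha : 0 < a)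
    (hM₁ : IsWeightSequence M₁) (hM₂ : IsWeightSequence M₂)
    (h₁ : HasKernelBound M₁ (ω₁ * Real.pi / 2) a e₁)
    (h₂ : HasKernelBound M₂ (ω₂ * Real.pi / 2) a e₂) {lam : ℂ} (hl : 0 ≤ lam.re) :
    momentFun (convKernel ω₁ ω₂ e₁ e₂) lam = momentFun e₁ lam * momentFun e₂ lam := by
  have hpi := Real.pi_pos
  simp only [momentFun_eq_integral]
  have i1 := h₁.integrable_exp_mul (by positivity) ha hM₁ hl
  have i2 := h₂.integrable_exp_mul (by positivity) ha hM₂ hl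
  have := integral_convolution (ContinuousLinearMap.mul ℝ ℂ) i1 i2
  rw [ContinuousLinearMap.mul_apply'] at this
  rw [← this]
  congr 1
  ext x
  rw [convKernel_eq_integral hω₁ hω₂ ha hM₁ hM₂ h₁ h₂ (s := 0) (by simp; positivity)
    (by simp; positivity), convolution_def, ← integral_const_mul]
  congr 1
  ext t
  rw [ContinuousLinearMap.mul_apply']
  push_cast
  rw [show lam * (x : ℂ) = lam * t + lam * (x - t) by ring, Complex.exp_add]
  simp only [zero_mul, add_zero]
  ring

theorem polar_exp_zero (x : ℝ) : polar (Real.exp x) 0 = x := by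
  simp [polar]

/-- On the positive real line the convolution is the integral of a positive function. -/
theorem convKernel_pos (hω₁ : 0 < ω₁) (hω₂ : 0 < ω₂) (ha : 0 < a)
    (hM₁ : IsWeightSequence M₁) (hM₂ : IsWeightSequence M₂)
    (h₁ : HasKernelBound M₁ (ω₁ * Real.pi / 2) a e₁)
    (h₂ : HasKernelBound M₂ (ω₂ * Real.pi / 2) a e₂)
    (p₁ : ∀ x : ℝ, 0 < x → ∃ y : ℝ, 0 < y ∧ e₁ (polar x 0) = y)
    (p₂ : ∀ x : ℝ, 0 < x → ∃ y : ℝ, 0 < y ∧ e₂ (polar x 0) = y) (x : ℝ) :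
    ∃ y : ℝ, 0 < y ∧ convKernel ω₁ ω₂ e₁ e₂ (polar x 0) = y := by
  have hpi := Real.pi_pos
  choose y₁ hy₁ he₁ using fun t : ℝ => p₁ (Real.exp t) (Real.exp_pos t)
  choose y₂ hy₂ he₂ using fun t : ℝ => p₂ (Real.exp t) (Real.exp_pos t)
  simp only [polar_exp_zero] at he₁ he₂
  have hs : |(0 : ℝ)| < ω₁ * Real.pi / 2 := by simp; positivity
  have hz : |(polar x 0).im - 0| < ω₂ * Real.pi / 2 := by simp [polar]; positivity
  have heq : (fun t : ℝ => e₁ (t + (0 : ℝ) * Complex.I) *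
      e₂ (polar x 0 - (t + (0 : ℝ) * Complex.I))) =
      fun t : ℝ => ((y₁ t * y₂ (Real.log x - t) : ℝ) : ℂ) := by
    ext t
    have : polar x 0 - ((t : ℂ) + (0 : ℝ) * Complex.I) = ((Real.log x - t : ℝ) : ℂ) := by
      simp [polar]
    rw [this, he₂, Complex.ofReal_zero, zero_mul, add_zero, he₁, Complex.ofReal_mul]
  have hi := integrable_convKernel ha hM₁ hM₂ h₁ h₂ hs hz
  rw [heq] at hi
  refine ⟨∫ t : ℝ, y₁ t * y₂ (Real.log x - t), ?_, ?_⟩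
  · have hr : Integrable fun t : ℝ => y₁ t * y₂ (Real.log x - t) := by
      simpa using hi.re
    rw [integral_pos_iff_support_of_nonneg (fun t => (mul_pos (hy₁ _) (hy₂ _)).le) hr]
    have : Function.support (fun t : ℝ => y₁ t * y₂ (Real.log x - t)) = univ :=
      eq_univ_of_forall fun t => (mul_pos (hy₁ _) (hy₂ _)).ne'
    rw [this]
    simp
  · rw [convKernel_eq_integral hω₁ hω₂ ha hM₁ hM₂ h₁ h₂ hs hz, heq]
    exact integral_ofReal

end Kernel

/-! ### Taylor coefficients by integration over circles -/

theorem integral_exp_int_mul_I (k : ℤ) (hk : k ≠ 0) (t₀ : ℝ) :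
    ∫ θ in t₀..(t₀ + 2 * Real.pi), Complex.exp ((k * Complex.I) * θ) = 0 := by
  have hc : (k : ℂ) * Complex.I ≠ 0 :=
    mul_ne_zero (Int.cast_ne_zero.2 hk) Complex.I_ne_zero
  rw [integral_exp_mul_complex hc, div_eq_zero_iff]
  left
  have : (k : ℂ) * Complex.I * ((t₀ + 2 * Real.pi : ℝ) : ℂ) =
      (k : ℂ) * Complex.I * t₀ + k * (2 * Real.pi * Complex.I) := by push_cast; ring
  rw [this, Complex.exp_periodic.int_mul k, sub_self]

/-- The coefficients of an absolutely convergent Fourier series. -/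
theorem integral_exp_neg_mul_of_hasSum {c : ℕ → ℂ} (hc : Summable fun j => ‖c j‖) {F : ℝ → ℂ}
    (hF : ∀ θ : ℝ, HasSum (fun j : ℕ => c j * Complex.exp (j * (θ * Complex.I))) (F θ)) (n : ℕ)
    (t₀ : ℝ) :
    ∫ θ in t₀..(t₀ + 2 * Real.pi), Complex.exp (-(n * (θ * Complex.I))) * F θ =
      2 * Real.pi * c n := by
  have hterm : ∀ (j : ℕ) (θ : ℝ), Complex.exp (-(n * (θ * Complex.I))) *
      (c j * Complex.exp (j * (θ * Complex.I))) =
      c j * Complex.exp ((((j : ℤ) - n : ℤ) * Complex.I) * θ) := by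
    intro j θ
    rw [mul_left_comm, ← Complex.exp_add]
    congr 2
    push_cast
    ring
  have h := intervalIntegral.hasSum_integral_of_dominated_convergence (a := t₀)
    (b := t₀ + 2 * Real.pi) (μ := volume)
    (F := fun (j : ℕ) (θ : ℝ) => c j * Complex.exp ((((j : ℤ) - n : ℤ) * Complex.I) * θ))
    (f := fun θ : ℝ => Complex.exp (-(n * (θ * Complex.I))) * F θ) (fun j _ => ‖c j‖)
    (fun j => (by fun_prop : Continuous fun θ : ℝ =>
      c j * Complex.exp ((((j : ℤ) - n : ℤ) * Complex.I) * θ)).aestronglyMeasurable)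
    (fun j => Eventually.of_forall fun θ _ => by
      rw [norm_mul, Complex.norm_exp]
      simp)
    (Eventually.of_forall fun θ _ => hc) intervalIntegrable_const
    (Eventually.of_forall fun θ _ => by
      simpa only [hterm] using (hF θ).mul_left (Complex.exp (-(n * (θ * Complex.I)))))
  refine h.unique ?_
  have h0 : ∀ j : ℕ, j ≠ n → ∫ θ in t₀..(t₀ + 2 * Real.pi),
      c j * Complex.exp ((((j : ℤ) - n : ℤ) * Complex.I) * θ) = 0 := by
    intro j hj
    rw [intervalIntegral.integral_const_mul, integral_exp_int_mul_I _ (by omega), mul_zero]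
  have h1 := hasSum_single n h0
  have h2 : ∫ θ in t₀..(t₀ + 2 * Real.pi),
      c n * Complex.exp ((((n : ℤ) - n : ℤ) * Complex.I) * θ) = 2 * Real.pi * c n := by
    simp [mul_comm]
  rwa [h2] at h1

section Borel

variable {M M₁ M₂ : ℕ → ℝ} {m m₁ m₂ : ℕ → ℂ} {E E₁ E₂ : ℂ → ℂ}

theorem summable_norm_of_hasSum (hE : ∀ z : ℂ, HasSum (fun n : ℕ => z ^ n / m n) (E z)) (z : ℂ) :
    Summable fun n : ℕ => ‖z ^ n / m n‖ :=
  summable_norm_iff.2 (hE z).summable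

theorem integral_circle_eq_coeff (hE : ∀ z : ℂ, HasSum (fun n : ℕ => z ^ n / m n) (E z)) (w : ℂ)
    (n : ℕ) (t₀ : ℝ) :
    ∫ θ in t₀..(t₀ + 2 * Real.pi), Complex.exp (-(n * (θ * Complex.I))) *
      E (w * Complex.exp (θ * Complex.I)) = 2 * Real.pi * (w ^ n / m n) := by
  refine integral_exp_neg_mul_of_hasSum (summable_norm_of_hasSum hE w) (fun θ => ?_) n t₀
  refine (hE (w * Complex.exp (θ * Complex.I))).congr_fun fun j => ?_
  rw [mul_pow, ← Complex.exp_nat_mul]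
  ring

theorem differentiable_of_hasSum (hE : ∀ z : ℂ, HasSum (fun n : ℕ => z ^ n / m n) (E z)) :
    Differentiable ℂ E := by
  intro z
  have hd : DifferentiableOn ℂ (fun w => ∑' n : ℕ, w ^ n / m n) (Metric.ball 0 (‖z‖ + 1)) := by
    refine Complex.differentiableOn_tsum_of_summable_norm
      (summable_norm_of_hasSum hE ((‖z‖ + 1 : ℝ) : ℂ)) (fun n => ?_) Metric.isOpen_ball
      (fun n w hw => ?_)
    · exact ((differentiable_id.pow n).div_const _).differentiableOn
    · rw [mem_ball_zero_iff] at hw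
      rw [norm_div, norm_div, norm_pow, norm_pow, Complex.norm_real, Real.norm_of_nonneg
        (by positivity)]
      gcongr
  have : (fun w => ∑' n : ℕ, w ^ n / m n) = E := funext fun w => (hE w).tsum_eq
  rw [this] at hd
  exact hd.differentiableAt (Metric.isOpen_ball.mem_nhds (by simp))

/-- Cauchy's estimate on the circle of radius `K M (n+1) / M n`, which is optimal by logarithmic
convexity. -/
theorem norm_inv_coeff_le (hM : IsWeightSequence M)
    (hE : ∀ z : ℂ, HasSum (fun n : ℕ => z ^ n / m n) (E z)) {C K : ℝ} (hK : 0 < K)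
    (hb : ∀ z : ℂ, ‖E z‖ ≤ C * Real.exp (assocFun M (‖z‖ / K))) (n : ℕ) :
    ‖(m n)⁻¹‖ ≤ C / (K ^ n * M n) := by
  have hr := hM.ratio_pos n
  set r := M (n + 1) / M n with hrdef
  have hMn := hM.pos n
  have hC : 0 ≤ C := nonneg_of_mul_nonneg_left ((norm_nonneg _).trans (hb 0)) (Real.exp_pos _)
  have h1 := integral_circle_eq_coeff hE ((K * r : ℝ) : ℂ) n 0
  have h2 : ‖∫ θ in (0 : ℝ)..(0 + 2 * Real.pi), Complex.exp (-(n * (θ * Complex.I))) *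
      E (((K * r : ℝ) : ℂ) * Complex.exp (θ * Complex.I))‖ ≤
      C * (r ^ n / M n) * |0 + 2 * Real.pi - 0| := by
    refine intervalIntegral.norm_integral_le_of_norm_le_const fun θ _ => ?_
    have h3 := hb (((K * r : ℝ) : ℂ) * Complex.exp (θ * Complex.I))
    rw [norm_mul, Complex.norm_exp_ofReal_mul_I, mul_one, Complex.norm_real,
      Real.norm_of_nonneg (by positivity), mul_div_cancel_left₀ _ hK.ne'] at h3
    have h4 : ‖Complex.exp (-(n * (θ * Complex.I)))‖ = 1 := by
      rw [Complex.norm_exp]; simp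
    rw [norm_mul, h4, one_mul]
    exact h3.trans (by gcongr; exact hM.exp_assocFun_ratio_le n)
  rw [h1, norm_mul, norm_div, norm_pow, Complex.norm_real, Real.norm_of_nonneg
    (by positivity)] at h2
  have hpi := Real.pi_pos
  have h5 : ‖(2 * Real.pi : ℂ)‖ = 2 * Real.pi := by
    rw [show (2 * Real.pi : ℂ) = ((2 * Real.pi : ℝ) : ℂ) by push_cast; ring, Complex.norm_real,
      Real.norm_of_nonneg (by positivity)]
  rw [h5, zero_add, sub_zero, abs_of_pos (by positivity), mul_comm, mul_le_mul_iff_left₀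
    (by positivity), div_eq_mul_inv, ← norm_inv, mul_pow] at h2
  rw [le_div_iff₀ (by positivity)]
  have h6 : 0 < r ^ n := by positivity
  refine le_of_mul_le_mul_left ?_ h6
  calc r ^ n * (‖(m n)⁻¹‖ * (K ^ n * M n)) = K ^ n * r ^ n * ‖(m n)⁻¹‖ * M n := by ring
    _ ≤ C * (r ^ n / M n) * M n := by gcongr
    _ = r ^ n * C := by field_simp

theorem IsWeightSequence.pow_div_le_exp_of_nonneg (hM : IsWeightSequence M) {t : ℝ} (ht : 0 ≤ t)
    (p : ℕ) : t ^ p / M p ≤ Real.exp (assocFun M t) := by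
  rcases ht.eq_or_lt with rfl | ht
  · have h0 : assocFun M 0 = 0 := by
      have : (fun p : ℕ => Real.log ((0 : ℝ) ^ p / M p)) = fun _ => 0 := by
        ext p
        rcases p with _ | p <;> simp [hM.zero]
      rw [assocFun, this, ciSup_const]
    rcases p with _ | p <;> simp [hM.zero, h0]
  · exact hM.pow_div_le_exp ht p

/-- The general term of the Hadamard product of two Borel kernels; halving the dilation constant
leaves a geometric factor to sum. -/
theorem norm_pow_div_mul_le (hM₁ : IsWeightSequence M₁) (hM₂ : IsWeightSequence M₂)
    {C₁ K₁ C₂ K₂ : ℝ} (hK₁ : 0 < K₁) (hK₂ : 0 < K₂) (hC₁ : 0 < C₁) (hC₂ : 0 < C₂)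
    (h₁ : ∀ n, ‖(m₁ n)⁻¹‖ ≤ C₁ / (K₁ ^ n * M₁ n)) (h₂ : ∀ n, ‖(m₂ n)⁻¹‖ ≤ C₂ / (K₂ ^ n * M₂ n))
    (z : ℂ) (n : ℕ) :
    ‖z ^ n / (m₁ n * m₂ n)‖ ≤
      C₁ * C₂ * Real.exp (assocFun (M₁ * M₂) (‖z‖ / (K₁ * K₂ / 2))) * (1 / 2) ^ n := by
  have a₁ := hM₁.pos n
  have a₂ := hM₂.pos n
  have h := (hM₁.mul hM₂).pow_div_le_exp_of_nonneg
    (t := ‖z‖ / (K₁ * K₂ / 2)) (by positivity) n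
  rw [div_eq_mul_inv, mul_inv, norm_mul, norm_mul, norm_pow]
  calc ‖z‖ ^ n * (‖(m₁ n)⁻¹‖ * ‖(m₂ n)⁻¹‖)
      ≤ ‖z‖ ^ n * (C₁ / (K₁ ^ n * M₁ n) * (C₂ / (K₂ ^ n * M₂ n))) := by
        gcongr
        exacts [h₁ n, h₂ n]
    _ = C₁ * C₂ * ((‖z‖ / (K₁ * K₂ / 2)) ^ n / (M₁ * M₂) n) * (1 / 2) ^ n := by
        rw [Pi.mul_apply, div_pow, div_pow, mul_pow, div_pow, one_pow]
        field_simp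
    _ ≤ _ := by gcongr

/-! ### Decay of the Borel kernel -/

theorem IsPreKernel.norm_borel_le {e : ℂ → ℂ} (h : IsPreKernel M e E) (hM : IsWeightSequence M)
    (x₀ : ℝ) : ∃ C > 0, ∀ s : ℂ, s.re ≤ x₀ → ‖E (Complex.exp s)‖ ≤ C := by
  obtain ⟨C, hC, K, hK, H⟩ := h.bound_borel
  refine ⟨C * Real.exp (assocFun M (Real.exp x₀ / K)), by positivity, fun s hs => ?_⟩
  refine (H _).trans ?_
  rw [Complex.norm_exp]
  gcongr
  exact hM.assocFun_mono (by positivity) (by gcongr)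

/-- The power decay of the Borel kernel at infinity, extended to every half-strip `x₀ ≤ re s`. -/
theorem IsStrongKernel.exists_borel_decay {e : ℂ → ℂ} (h : IsStrongKernel M e E)
    (hM : IsWeightSequence M) (hω : growthOrder M < 2) :
    ∃ b > 0, ∀ ψ < (2 - growthOrder M) * Real.pi / 2, ∀ x₀ : ℝ, ∃ K > 0, ∀ s : ℂ,
      |s.im - Real.pi| ≤ ψ → x₀ ≤ s.re → ‖E (Complex.exp s)‖ ≤ K * Real.exp (-b * s.re) := by
  have hpi := Real.pi_pos
  obtain ⟨b, hb, H⟩ := h.infinity_borel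
  refine ⟨b, hb, fun ψ hψ x₀ => ?_⟩
  have hτ : max (2 * ψ / Real.pi) 0 < 2 - growthOrder M :=
    max_lt (by rw [div_lt_iff₀ hpi]; linarith) (by linarith)
  obtain ⟨τ, hτ1, hτ2⟩ := exists_between hτ
  have hτψ := (le_max_left _ _).trans_lt hτ1
  rw [div_lt_iff₀ hpi] at hτψ
  obtain ⟨K, hK, R, hR, H'⟩ := H τ ((le_max_right _ _).trans_lt hτ1) hτ2
  obtain ⟨C, hC, HC⟩ := h.norm_borel_le hM (Real.log R)
  refine ⟨K + C * Real.exp (b * Real.log R), by positivity, fun s hs _ => ?_⟩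
  rcases le_or_gt (Real.log R) s.re with h1 | h1
  · have h2 := H' s (by simp only [sector, mem_ofPred_eq]; linarith)
      ((Real.log_le_iff_le_exp hR).1 h1)
    have h3 : K / modulus s ^ b = K * Real.exp (-b * s.re) := by
      rw [modulus, ← Real.exp_mul, div_eq_mul_inv, ← Real.exp_neg]
      ring_nf
    rw [h3] at h2
    refine h2.trans ?_
    gcongr
    have : 0 < C * Real.exp (b * Real.log R) := by positivity
    linarith
  · calc ‖E (Complex.exp s)‖ ≤ C * 1 := by rw [mul_one]; exact HC s h1.le
      _ ≤ C * (Real.exp (b * Real.log R) * Real.exp (-b * s.re)) := by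
        gcongr
        rw [← Real.exp_add]
        refine Real.one_le_exp ?_
        nlinarith
      _ = C * Real.exp (b * Real.log R) * Real.exp (-b * s.re) := by ring
      _ ≤ _ := by gcongr; linarith

/-! ### The Borel transform of an entire function -/

theorem integrableOn_borelRay_iff (E f : ℂ → ℂ) (u : ℂ) (θ : ℝ) {R : ℝ} (hR : 0 < R) :
    IntegrableOn (borelRay E f u θ) (Ioc 0 R) ↔
      IntegrableOn (fun x : ℝ => E (Complex.exp (u - (x + θ * Complex.I))) *
        f (x + θ * Complex.I)) (Iic (Real.log R)) := by
  have := integrableOn_comp_log_div_iff (fun x : ℝ =>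
    E (Complex.exp (u - (x + θ * Complex.I))) * f (x + θ * Complex.I))
    (measurableSet_Iic (a := Real.log R))
  rw [image_exp_Iic hR] at this
  exact this

theorem setIntegral_borelRay (E f : ℂ → ℂ) (u : ℂ) (θ : ℝ) {R : ℝ} (hR : 0 < R) :
    ∫ r in Ioc (0 : ℝ) R, borelRay E f u θ r =
      ∫ x in Iic (Real.log R), E (Complex.exp (u - (x + θ * Complex.I))) *
        f (x + θ * Complex.I) := by
  have := setIntegral_comp_log_div (fun x : ℝ =>
    E (Complex.exp (u - (x + θ * Complex.I))) * f (x + θ * Complex.I))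
    (measurableSet_Iic (a := Real.log R))
  rw [image_exp_Iic hR] at this
  exact this

theorem exp_sub_two_pi (s : ℂ) : Complex.exp (s - 2 * Real.pi * Complex.I) = Complex.exp s :=
  Complex.exp_periodic.sub_eq s

theorem exp_add_two_pi (s : ℂ) : Complex.exp (s + 2 * Real.pi * Complex.I) = Complex.exp s :=
  Complex.exp_periodic s

/-- The Hadamard product of two entire functions as an integral over a circle. -/
theorem integral_circle_hadamard (hE₁ : ∀ z : ℂ, HasSum (fun n : ℕ => z ^ n / m₁ n) (E₁ z))
    (hE₂ : ∀ z : ℂ, HasSum (fun n : ℕ => z ^ n / m₂ n) (E₂ z)) (u : ℂ) (x t₀ : ℝ) :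
    ∫ θ in t₀..(t₀ + 2 * Real.pi), E₂ (Complex.exp (u - (x + θ * Complex.I))) *
      E₁ (Complex.exp (x + θ * Complex.I)) =
      2 * Real.pi * ∑' n : ℕ, Complex.exp u ^ n / (m₁ n * m₂ n) := by
  have hpi := Real.pi_pos
  have hinner : ∀ n : ℕ, ∫ θ in t₀..(t₀ + 2 * Real.pi),
      E₂ (Complex.exp (u - (x + θ * Complex.I))) * (Complex.exp (x + θ * Complex.I) ^ n / m₁ n) =
      2 * Real.pi * (Complex.exp u ^ n / (m₁ n * m₂ n)) := by
    intro n
    have h := integral_circle_eq_coeff hE₂ (Complex.exp (u - x)) n (-t₀ - 2 * Real.pi)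
    have h' := intervalIntegral.integral_comp_neg (a := t₀) (b := t₀ + 2 * Real.pi)
      (fun θ : ℝ => Complex.exp (-(n * (θ * Complex.I))) *
        E₂ (Complex.exp (u - x) * Complex.exp (θ * Complex.I)))
    rw [sub_add_cancel] at h
    rw [neg_add', h] at h'
    have hfun : ∀ θ : ℝ, E₂ (Complex.exp (u - (x + θ * Complex.I))) *
        (Complex.exp (x + θ * Complex.I) ^ n / m₁ n) = Complex.exp (n * x) / m₁ n *
        (Complex.exp (-(n * (((-θ : ℝ) : ℂ) * Complex.I))) *
        E₂ (Complex.exp (u - x) * Complex.exp (((-θ : ℝ) : ℂ) * Complex.I))) := by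
      intro θ
      rw [← Complex.exp_nat_mul, ← Complex.exp_add, mul_add, Complex.exp_add,
        show u - (x + θ * Complex.I) = u - x + ((-θ : ℝ) : ℂ) * Complex.I by push_cast; ring,
        show -((n : ℂ) * (((-θ : ℝ) : ℂ) * Complex.I)) = n * (θ * Complex.I) by push_cast; ring]
      ring
    simp only [hfun]
    rw [intervalIntegral.integral_const_mul, h', ← Complex.exp_nat_mul, ← Complex.exp_nat_mul,
      mul_sub, Complex.exp_sub]
    have := Complex.exp_ne_zero (n * x)
    field_simp
  obtain ⟨B, hB⟩ : ∃ B, ∀ θ ∈ uIcc t₀ (t₀ + 2 * Real.pi),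
      ‖E₂ (Complex.exp (u - (x + θ * Complex.I)))‖ ≤ B := by
    have hc : Continuous fun θ : ℝ => E₂ (Complex.exp (u - (x + θ * Complex.I))) :=
      (differentiable_of_hasSum hE₂).continuous.comp (by fun_prop)
    exact isCompact_uIcc.exists_bound_of_continuousOn hc.continuousOn
  have h := intervalIntegral.hasSum_integral_of_dominated_convergence (a := t₀)
    (b := t₀ + 2 * Real.pi) (μ := volume)
    (F := fun (n : ℕ) (θ : ℝ) => E₂ (Complex.exp (u - (x + θ * Complex.I))) *
      (Complex.exp (x + θ * Complex.I) ^ n / m₁ n))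
    (f := fun θ : ℝ => E₂ (Complex.exp (u - (x + θ * Complex.I))) *
      E₁ (Complex.exp (x + θ * Complex.I)))
    (fun n _ => B * ‖((Real.exp x : ℝ) : ℂ) ^ n / m₁ n‖)
    (fun n => (Continuous.mul ((differentiable_of_hasSum hE₂).continuous.comp (by fun_prop))
      (by fun_prop)).aestronglyMeasurable)
    (fun n => Eventually.of_forall fun θ hθ => by
      have h1 := hB θ (uIoc_subset_uIcc hθ)
      rw [norm_mul, norm_div, norm_div, norm_pow, norm_pow, Complex.norm_exp, Complex.norm_real,
        Real.norm_of_nonneg (Real.exp_pos x).le]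
      have : ((x : ℂ) + θ * Complex.I).re = x := by simp
      rw [this]
      gcongr)
    (Eventually.of_forall fun θ _ => (summable_norm_of_hasSum hE₁ _).mul_left B)
    intervalIntegrable_const
    (Eventually.of_forall fun θ _ => (hE₁ _).mul_left _)
  simp only [hinner] at h
  rw [← h.tsum_eq, tsum_mul_left]

section BorelFormula

variable {e₁ e₂ : ℂ → ℂ} (hM₁ : IsWeightSequence M₁) (hM₂ : IsWeightSequence M₂)
  (h₁ : IsPreKernel M₁ e₁ E₁) (h₂ : IsStrongKernel M₂ e₂ E₂) (hω₂ : growthOrder M₂ < 2)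

include hM₁ hM₂ h₁ h₂ hω₂

/-- The integrand of the Borel transform decays exponentially towards the origin in the directions
in which `E₂` decays at infinity. -/
theorem exists_borel_integrand_le (u : ℂ) {ψ : ℝ} (hψ : ψ < (2 - growthOrder M₂) * Real.pi / 2)
    (x₀ : ℝ) : ∃ b > 0, ∃ C, ∀ ζ : ℂ, |u.im - ζ.im - Real.pi| ≤ ψ → ζ.re ≤ x₀ →
      ‖E₂ (Complex.exp (u - ζ)) * E₁ (Complex.exp ζ)‖ ≤ C * Real.exp (b * ζ.re) := by
  obtain ⟨b, hb, H⟩ := h₂.exists_borel_decay hM₂ hω₂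
  obtain ⟨K, hK, HK⟩ := H ψ hψ (u.re - x₀)
  obtain ⟨C, hC, HC⟩ := h₁.norm_borel_le hM₁ x₀
  refine ⟨b, hb, K * Real.exp (-b * u.re) * C, fun ζ h3 h4 => ?_⟩
  have h5 := HK (u - ζ) (by simpa using h3) (by rw [Complex.sub_re]; linarith)
  rw [norm_mul]
  calc _ ≤ K * Real.exp (-b * (u - ζ).re) * C :=
        mul_le_mul h5 (HC ζ h4) (norm_nonneg _) (by positivity)
    _ = _ := by
        rw [Complex.sub_re, show -b * (u.re - ζ.re) = -b * u.re + b * ζ.re by ring, Real.exp_add]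
        ring

theorem integrableOn_borelRay (u : ℂ) {θ R : ℝ} (hR : 0 < R)
    (hθ : |u.im - θ - Real.pi| < (2 - growthOrder M₂) * Real.pi / 2) :
    IntegrableOn (borelRay E₂ (fun z => E₁ (Complex.exp z)) u θ) (Ioc 0 R) := by
  rw [integrableOn_borelRay_iff _ _ _ _ hR]
  obtain ⟨b, hb, C, H⟩ := exists_borel_integrand_le hM₁ hM₂ h₁ h₂ hω₂ u hθ (Real.log R)
  refine Integrable.mono' ((integrableOn_exp_mul_Iic hb _).const_mul C) ?_ ?_
  · have c₁ := (differentiable_of_hasSum h₁.hasSum).continuous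
    have c₂ := (differentiable_of_hasSum h₂.hasSum).continuous
    exact (Continuous.mul (c₂.comp (by fun_prop)) (c₁.comp (by fun_prop))).aestronglyMeasurable
  · filter_upwards [ae_restrict_mem measurableSet_Iic] with x hx
    simpa using H (x + θ * Complex.I) (by simp) (by simpa using hx)

omit hM₁ hM₂ h₁ h₂ hω₂ in
theorem borelRay_sub_two_pi (E f : ℂ → ℂ) (hf : ∀ z, f (z - 2 * Real.pi * Complex.I) = f z)
    (u : ℂ) (θ : ℝ) :
    borelRay E f u (θ - 2 * Real.pi) = borelRay E f u θ := by
  ext r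
  have : polar r (θ - 2 * Real.pi) = polar r θ - 2 * Real.pi * Complex.I := by
    simp only [polar]; push_cast; ring
  rw [borelRay, borelRay, this, hf, sub_sub_eq_add_sub, add_sub_right_comm, exp_add_two_pi]

/-- The two rays of the Borel path may be rotated within the region where `E₂` decays until they
cancel by periodicity; what remains is an integral over a full circle. -/
theorem borelDir_eq (u : ℂ) {τ ε R : ℝ} (hR : 0 < R)
    (hu : |u.im - τ| < growthOrder M₂ * ε / 2)
    (hu' : |u.im - τ| + growthOrder M₂ * (Real.pi + ε) / 2 <
      2 * Real.pi - growthOrder M₂ * Real.pi / 2) :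
    IntegrableOn (borelRay E₂ (fun z => E₁ (Complex.exp z)) u
      (τ + growthOrder M₂ * (Real.pi + ε) / 2)) (Ioc 0 R) ∧
    IntegrableOn (borelRay E₂ (fun z => E₁ (Complex.exp z)) u
      (τ - growthOrder M₂ * (Real.pi + ε) / 2)) (Ioc 0 R) ∧
    borelDir (growthOrder M₂) E₂ (fun z => E₁ (Complex.exp z)) τ ε R u =
      ∑' n : ℕ, Complex.exp u ^ n / (momentFun e₁ n * momentFun e₂ n) := by
  have hpi := Real.pi_pos
  set ω := growthOrder M₂ with hω
  set h := ω * (Real.pi + ε) / 2 with hh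
  have hh' : h = ω * Real.pi / 2 + ω * ε / 2 := by rw [hh]; ring
  have hv := abs_lt.1 hu
  have hv' := abs_le.1 (le_refl |u.im - τ|)
  have hper : ∀ z : ℂ, (fun z => E₁ (Complex.exp z)) (z - 2 * Real.pi * Complex.I) =
      (fun z => E₁ (Complex.exp z)) z := fun z => by simp only [exp_sub_two_pi]
  have hm : |u.im - (τ - h) - Real.pi| < (2 - ω) * Real.pi / 2 := by
    rw [abs_lt]; constructor <;> linarith
  have hp : |u.im - (τ + h - 2 * Real.pi) - Real.pi| < (2 - ω) * Real.pi / 2 := by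
    rw [abs_lt]; constructor <;> linarith
  -- the upper ray, lowered by `2π`, lies with the lower ray in the strip where `E₂` decays
  have hray := borelRay_sub_two_pi E₂ (fun z => E₁ (Complex.exp z)) hper u (τ + h)
  refine ⟨?_, integrableOn_borelRay hM₁ hM₂ h₁ h₂ hω₂ u hR hm, ?_⟩
  · rw [← hray]
    exact integrableOn_borelRay hM₁ hM₂ h₁ h₂ hω₂ u hR hp
  have d₁ := differentiable_of_hasSum h₁.hasSum
  have d₂ := differentiable_of_hasSum h₂.hasSum
  set F : ℂ → ℂ := fun ζ => E₂ (Complex.exp (u - ζ)) * E₁ (Complex.exp ζ) with hF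
  have hFd : Differentiable ℂ F :=
    (d₂.comp ((differentiable_const u).sub differentiable_id).cexp).mul
      (d₁.comp Complex.differentiable_exp)
  obtain ⟨b, hb, C, H⟩ := exists_borel_integrand_le hM₁ hM₂ h₁ h₂ hω₂ u (max_lt hm hp)
    (Real.log R)
  have hstrip := integral_horizontal_Iic_sub (f := F) (c := τ - h) (d := τ + h - 2 * Real.pi)
    (x₀ := Real.log R) hb (fun z _ => hFd z) (fun z hz hz' => by
      refine H z ?_ hz'
      have key : ∀ p q r : ℝ, r ∈ uIcc p q →
          |u.im - r - Real.pi| ≤ max |u.im - p - Real.pi| |u.im - q - Real.pi| := by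
        intro p q r hr
        have g1 := neg_abs_le (u.im - p - Real.pi)
        have g2 := le_abs_self (u.im - p - Real.pi)
        have g3 := neg_abs_le (u.im - q - Real.pi)
        have g4 := le_abs_self (u.im - q - Real.pi)
        have g5 := le_max_left |u.im - p - Real.pi| |u.im - q - Real.pi|
        have g6 := le_max_right |u.im - p - Real.pi| |u.im - q - Real.pi|
        rcases mem_uIcc.1 hr with hr | hr <;>
          exact abs_le.2 ⟨by linarith, by linarith⟩
      exact key _ _ _ hz)
  have hcirc := integral_circle_hadamard h₁.hasSum h₂.hasSum u (Real.log R)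
    (τ + h - 2 * Real.pi)
  have hint : ∀ p q : ℝ, IntervalIntegrable
      (fun y : ℝ => F ((Real.log R : ℝ) + y * Complex.I)) volume p q := fun p q =>
    (hFd.continuous.comp (by fun_prop)).intervalIntegrable _ _
  rw [borelDir, ← hh, ← hray, setIntegral_borelRay _ _ _ _ hR, setIntegral_borelRay _ _ _ _ hR]
  -- the vertical edge of the half-strip is the arc of the path minus a full circle
  have hadd : (∫ y in (τ - h)..(τ + h - 2 * Real.pi), F ((Real.log R : ℝ) + y * Complex.I)) =
      -(∫ y in (τ + h)..(τ - h), F ((Real.log R : ℝ) + y * Complex.I)) -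
        ∫ y in (τ + h - 2 * Real.pi)..(τ + h), F ((Real.log R : ℝ) + y * Complex.I) := by
    have g1 := intervalIntegral.integral_add_adjacent_intervals
      (hint (τ + h - 2 * Real.pi) (τ + h)) (hint (τ + h) (τ - h))
    rw [intervalIntegral.integral_symm (τ + h - 2 * Real.pi) (τ - h), ← g1]
    ring
  have hcirc' : (∫ y in (τ + h - 2 * Real.pi)..(τ + h), F ((Real.log R : ℝ) + y * Complex.I)) =
      2 * Real.pi * ∑' n : ℕ, Complex.exp u ^ n / (momentFun e₁ n * momentFun e₂ n) := by
    rw [sub_add_cancel] at hcirc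
    exact hcirc
  rw [hadd, hcirc'] at hstrip
  have hpolar : (∫ θ in (τ + h)..(τ - h), E₂ (Complex.exp (u - polar R θ)) *
      E₁ (Complex.exp (polar R θ))) =
      ∫ y in (τ + h)..(τ - h), F ((Real.log R : ℝ) + y * Complex.I) := rfl
  rw [hpolar]
  have hA : (∫ x in Iic (Real.log R), E₂ (Complex.exp (u - (x + ((τ + h - 2 * Real.pi : ℝ) : ℂ) *
      Complex.I))) * E₁ (Complex.exp (x + ((τ + h - 2 * Real.pi : ℝ) : ℂ) * Complex.I))) =
      ∫ x : ℝ in Iic (Real.log R), F (x + ((τ + h - 2 * Real.pi : ℝ) : ℂ) * Complex.I) := rfl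
  have hB : (∫ x in Iic (Real.log R), E₂ (Complex.exp (u - (x + ((τ - h : ℝ) : ℂ) *
      Complex.I))) * E₁ (Complex.exp (x + ((τ - h : ℝ) : ℂ) * Complex.I))) =
      ∫ x : ℝ in Iic (Real.log R), F (x + ((τ - h : ℝ) : ℂ) * Complex.I) := rfl
  rw [hA, hB]
  have hpiC : (Real.pi : ℂ) ≠ 0 := Complex.ofReal_ne_zero.2 hpi.ne'
  have hI := Complex.I_ne_zero
  rw [div_mul_eq_mul_div, div_eq_iff (by simp [hpi.ne'])]
  linear_combination hstrip

end BorelFormula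

/-- Decay of the Hadamard product of two Borel kernels, read off from the Borel transform along the
path of radius `|z|`. -/
theorem exists_hadamard_decay {e₁ e₂ : ℂ → ℂ} (hM₁ : IsWeightSequence M₁)
    (hM₂ : IsWeightSequence M₂) (h₁ : IsStrongKernel M₁ e₁ E₁) (h₂ : IsStrongKernel M₂ e₂ E₂)
    (hω₁ : 0 < growthOrder M₁) (hω₂ : 0 < growthOrder M₂)
    (hω : growthOrder M₁ + growthOrder M₂ < 2) :
    ∃ b > (0 : ℝ), ∀ τ < 2 - (growthOrder M₁ + growthOrder M₂), 0 < τ → ∃ K > 0,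
      ∀ z ∈ sector Real.pi τ, 1 ≤ modulus z →
      ‖∑' n : ℕ, Complex.exp z ^ n / (momentFun e₁ n * momentFun e₂ n)‖ ≤ K / modulus z ^ b := by
  have hpi := Real.pi_pos
  obtain ⟨b₁, hb₁, H₁⟩ := h₁.exists_borel_decay hM₁ (by linarith)
  obtain ⟨b₂, hb₂, H₂⟩ := h₂.exists_borel_decay hM₂ (by linarith)
  set ω₁ := growthOrder M₁
  set ω₂ := growthOrder M₂ with hω₂def
  set b := min b₁ b₂ / 2 with hb
  have hb0 : 0 < b := by positivity
  have hbb₁ : b ≤ b₁ := by have := min_le_left b₁ b₂; have := lt_min hb₁ hb₂; linarith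
  have hbb₂ : b < b₂ := by have := min_le_right b₁ b₂; have := lt_min hb₁ hb₂; linarith
  refine ⟨b, hb0, fun τ hτ hτ0 => ?_⟩
  -- `ε` is chosen so small that the arc stays in the region where `E₁` decays
  set ε := min (Real.pi / 2) ((2 - ω₁ - ω₂ - τ) * Real.pi / (2 * ω₂)) with hε
  have hε0 : 0 < ε := lt_min (by positivity) (by
    have : 0 < 2 - ω₁ - ω₂ - τ := by linarith
    positivity)
  have hε2 : ω₂ * ε ≤ (2 - ω₁ - ω₂ - τ) * Real.pi / 2 := by
    have h1 : ε ≤ (2 - ω₁ - ω₂ - τ) * Real.pi / (2 * ω₂) := min_le_right _ _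
    rw [le_div_iff₀ (by positivity)] at h1
    linarith
  set h := ω₂ * (Real.pi + ε) / 2 with hh
  have hh' : h = ω₂ * Real.pi / 2 + ω₂ * ε / 2 := by rw [hh]; ring
  have hωε : 0 < ω₂ * ε := by positivity
  have hgap : 0 < (2 - ω₁ - ω₂ - τ) * Real.pi := by
    have : 0 < 2 - ω₁ - ω₂ - τ := by linarith
    positivity
  have hω₁pi : 0 < ω₁ * Real.pi := by positivity
  have hτpi : 0 < τ * Real.pi := by positivity
  have hψ₁ : τ * Real.pi / 2 + h < (2 - ω₁) * Real.pi / 2 := by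
    linarith
  have hψ₂ : |h - Real.pi| < (2 - ω₂) * Real.pi / 2 := by
    rw [abs_lt]; constructor <;> linarith
  obtain ⟨K₁, hK₁, B₁⟩ := H₁ _ hψ₁ 0
  obtain ⟨K₂, hK₂, B₂⟩ := H₂ _ hψ₂ 0
  obtain ⟨C₁, hC₁, D₁⟩ := h₁.norm_borel_le hM₁ 0
  obtain ⟨C₂, hC₂, D₂⟩ := h₂.norm_borel_le hM₂ 0
  have B₁' : ∀ s : ℂ, |s.im - Real.pi| ≤ τ * Real.pi / 2 + h →
      ‖E₁ (Complex.exp s)‖ ≤ (K₁ + C₁) * Real.exp (-b * s.re) := by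
    intro s hs
    rcases le_total 0 s.re with h0 | h0
    · refine (B₁ s hs h0).trans ?_
      gcongr
      linarith
    · calc _ ≤ C₁ * 1 := by rw [mul_one]; exact D₁ s h0
        _ ≤ (K₁ + C₁) * Real.exp (-b * s.re) := by
          gcongr
          · linarith
          · exact Real.one_le_exp (by nlinarith)
  set Kray := K₂ * (K₁ + C₁) / (b₂ - b) with hKray
  have hbb : 0 < b₂ - b := by linarith
  have hKray0 : 0 < Kray := by positivity
  refine ⟨(2 * Kray + C₂ * (K₁ + C₁) * (2 * h)) / (2 * Real.pi), by positivity, fun z hz hz1 => ?_⟩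
  have hzim : |z.im - Real.pi| < τ * Real.pi / 2 := hz
  obtain ⟨-, -, hform⟩ := borelDir_eq hM₁ hM₂ h₁.toIsPreKernel h₂ (by linarith) z (τ := z.im)
    (ε := ε) (Real.exp_pos z.re) (by rw [sub_self, abs_zero]; positivity)
    (by rw [sub_self, abs_zero, zero_add, ← hω₂def, ← hh]; linarith)
  rw [← hω₂def] at hform
  rw [← hform, borelDir, ← hh]
  have hper : ∀ z : ℂ, (fun z => E₁ (Complex.exp z)) (z - 2 * Real.pi * Complex.I) =
      (fun z => E₁ (Complex.exp z)) z := fun z => by simp only [exp_sub_two_pi]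
  have hexp : Real.exp (-b * z.re) = (modulus z ^ b)⁻¹ := by
    rw [modulus, ← Real.exp_mul, ← Real.exp_neg]; ring_nf
  have hE₂ : ∀ θ x : ℝ, (θ = z.im + h ∨ θ = z.im - h) → x ≤ z.re →
      ‖E₂ (Complex.exp (z - (x + θ * Complex.I)))‖ ≤ K₂ * Real.exp (-b₂ * (z.re - x)) := by
    intro θ x hθ hx
    rcases hθ with rfl | rfl
    · have := B₂ (z - (x + ((z.im + h : ℝ) : ℂ) * Complex.I) + 2 * Real.pi * Complex.I)
        (by
          have e : (z - (x + ((z.im + h : ℝ) : ℂ) * Complex.I) + 2 * Real.pi * Complex.I).im -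
              Real.pi = -(h - Real.pi) := by simp; ring
          rw [e, abs_neg]) (by simpa using hx)
      rw [exp_add_two_pi] at this
      simpa using this
    · have := B₂ (z - (x + ((z.im - h : ℝ) : ℂ) * Complex.I)) (by simp) (by simpa using hx)
      simpa using this
  have harg : ∀ θ : ℝ, |θ - z.im| ≤ h → |θ - Real.pi| ≤ τ * Real.pi / 2 + h := by
    intro θ hθ
    have := abs_sub_le θ z.im Real.pi
    linarith
  have hh0 : 0 < h := by rw [hh]; positivity
  have hray : ∀ θ : ℝ, (θ = z.im + h ∨ θ = z.im - h) →
      ‖∫ r in Ioc (0 : ℝ) (Real.exp z.re), borelRay E₂ (fun z => E₁ (Complex.exp z)) z θ r‖ ≤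
        Kray * Real.exp (-b * z.re) := by
    intro θ hθ
    rw [setIntegral_borelRay _ _ _ _ (Real.exp_pos _), Real.log_exp]
    have hθ' : |θ - z.im| ≤ h := by
      rcases hθ with rfl | rfl
      · rw [add_sub_cancel_left, abs_of_pos hh0]
      · rw [sub_sub_cancel_left, abs_neg, abs_of_pos hh0]
    refine (norm_integral_le_of_norm_le
      (g := fun x => K₂ * (K₁ + C₁) * Real.exp (-b₂ * z.re) * Real.exp ((b₂ - b) * x))
      ((integrableOn_exp_mul_Iic hbb _).const_mul _) ?_).trans ?_
    · filter_upwards [ae_restrict_mem measurableSet_Iic] with x hx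
      have g1 := hE₂ θ x hθ hx
      have g2 := B₁' (x + θ * Complex.I) (by simpa using harg θ hθ')
      rw [norm_mul]
      refine (mul_le_mul g1 g2 (norm_nonneg _) (by positivity)).trans (le_of_eq ?_)
      have : ((x : ℂ) + θ * Complex.I).re = x := by simp
      rw [this, show -b₂ * (z.re - x) = -b₂ * z.re + b₂ * x by ring,
        show (b₂ - b) * x = b₂ * x + -b * x by ring, Real.exp_add, Real.exp_add]
      ring
    · rw [integral_const_mul, integral_exp_mul_Iic hbb, hKray,
        show -b * z.re = -b₂ * z.re + (b₂ - b) * z.re by ring, Real.exp_add]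
      refine le_of_eq ?_
      field_simp
  have harc : ‖∫ θ in (z.im + h)..(z.im - h), E₂ (Complex.exp (z - polar (Real.exp z.re) θ)) *
      E₁ (Complex.exp (polar (Real.exp z.re) θ))‖ ≤
      C₂ * ((K₁ + C₁) * Real.exp (-b * z.re)) * |z.im - h - (z.im + h)| := by
    refine intervalIntegral.norm_integral_le_of_norm_le_const fun θ hθ => ?_
    have hθ' : |θ - z.im| ≤ h := by
      rcases mem_uIcc.1 (uIoc_subset_uIcc hθ) with g | g <;>
        exact abs_le.2 ⟨by linarith, by linarith⟩
    rw [polar, Real.log_exp, norm_mul]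
    have g2 := B₁' (z.re + θ * Complex.I) (by simpa using harg θ hθ')
    have g3 : ((z.re : ℂ) + θ * Complex.I).re = z.re := by simp
    rw [g3] at g2
    exact mul_le_mul (D₂ _ (by simp)) g2 (norm_nonneg _) hC₂.le
  rw [show z.im - h - (z.im + h) = -(2 * h) by ring, abs_neg, abs_of_pos (by positivity)] at harc
  have hnorm : ‖(-1 / (2 * Real.pi * Complex.I) : ℂ)‖ = 1 / (2 * Real.pi) := by
    rw [norm_div, norm_mul, norm_mul, Complex.norm_I, Complex.norm_real,
      Real.norm_of_nonneg hpi.le]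
    simp
  rw [norm_mul, hnorm, div_eq_mul_inv _ (modulus z ^ b), ← hexp]
  have g1 := hray _ (Or.inl rfl)
  have g2 := hray _ (Or.inr rfl)
  have g3 : ∀ A B C : ℂ, ‖A + Complex.I * B - C‖ ≤ ‖A‖ + ‖B‖ + ‖C‖ := fun A B C => by
    refine (norm_sub_le _ _).trans ?_
    have := norm_add_le A (Complex.I * B)
    rw [norm_mul, Complex.norm_I, one_mul] at this
    linarith
  refine (mul_le_mul_of_nonneg_left ((g3 _ _ _).trans (add_le_add (add_le_add g1 harc) g2))
    (by positivity)).trans (le_of_eq ?_)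
  field_simp
  ring

end Borel

/-! ### Functions of restricted growth on a sector -/

theorem nhdsOrigin_eq : nhdsOrigin = comap Complex.re atBot := by
  rw [nhdsOrigin, ← Real.comap_exp_nhds_zero, comap_comap]
  rfl

theorem abs_add_lt_of_closure_bddSector_subset {θ β r d α : ℝ} (hβ : 0 < β) (hr : 0 < r)
    (h : closure (bddSector θ β r) ⊆ sector d α) :
    |θ - d| + β * Real.pi / 2 < α * Real.pi / 2 := by
  have hpi := Real.pi_pos
  have hb : 0 < β * Real.pi / 2 := by positivity
  have hmaps : MapsTo (fun y : ℝ => ((Real.log r - 1 : ℝ) : ℂ) + y * Complex.I)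
      (Ioo (θ - β * Real.pi / 2) (θ + β * Real.pi / 2)) (bddSector θ β r) := by
    intro y hy
    rw [bddSector_eq _ _ hr]
    refine ⟨?_, ?_⟩
    · simp only [sector, mem_ofPred_eq, Complex.add_im, Complex.ofReal_im, Complex.mul_im,
        Complex.ofReal_re, Complex.I_im, Complex.I_re, mul_one, mul_zero, add_zero, zero_add]
      exact abs_lt.2 ⟨by linarith [hy.1], by linarith [hy.2]⟩
    · simp
  have hmem : ∀ y ∈ Icc (θ - β * Real.pi / 2) (θ + β * Real.pi / 2), |y - d| < α * Real.pi / 2 := by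
    intro y hy
    rw [← closure_Ioo (by linarith)] at hy
    have := h (map_mem_closure (by fun_prop) hy hmaps)
    simpa [sector] using this
  have h1 := abs_lt.1 (hmem _ (right_mem_Icc.2 (by linarith)))
  have h2 := abs_lt.1 (hmem _ (left_mem_Icc.2 (by linarith)))
  rcases abs_cases (θ - d) with ⟨h, -⟩ | ⟨h, -⟩ <;> rw [h] <;> linarith

theorem abs_add_lt_of_closure_sector_subset {θ β d α : ℝ} (hβ : 0 < β)
    (h : closure (sector θ β) ⊆ sector d α) :
    |θ - d| + β * Real.pi / 2 < α * Real.pi / 2 :=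
  abs_add_lt_of_closure_bddSector_subset hβ one_pos
    ((closure_mono fun _ hz => hz.1).trans h)

theorem closure_sector_subset {d β α : ℝ} (h : β < α) : closure (sector d β) ⊆ sector d α := by
  have hpi := Real.pi_pos
  have hc : IsClosed {z : ℂ | |z.im - d| ≤ β * Real.pi / 2} :=
    isClosed_le (Complex.continuous_im.sub continuous_const).abs continuous_const
  refine (closure_minimal (fun z hz => ?_) hc).trans fun z hz => ?_
  · exact le_of_lt (show |z.im - d| < β * Real.pi / 2 from hz)
  · exact lt_of_le_of_lt (show |z.im - d| ≤ β * Real.pi / 2 from hz) (by nlinarith)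

section MGrowth

variable {M M₁ M₂ : ℕ → ℝ} {e f e₁ e₂ h : ℂ → ℂ} {d α a ω₁ ω₂ : ℝ}

/-- It is enough to check the conditions of `HasMGrowth` on closed substrips of the logarithmic
coordinate. -/
theorem hasMGrowth_of_strips
    (hd : ∀ u : ℂ, |u.im - d| < α * Real.pi / 2 → DifferentiableAt ℂ f u)
    (ho : ∀ θ < α * Real.pi / 2, ∃ l : ℂ,
      Tendsto f (comap Complex.re atBot ⊓ 𝓟 {u | |u.im - d| ≤ θ}) (𝓝 l))
    (hg : ∀ θ < α * Real.pi / 2, ∃ C > 0, ∃ K > 0, ∀ u : ℂ, |u.im - d| ≤ θ →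
      ‖f u‖ ≤ C * Real.exp (assocFun M (Real.exp u.re / K))) : HasMGrowth M d α f where
  holomorphic u hu := (hd u hu).differentiableWithinAt
  origin θ β r hβ hr hcl := by
    have h1 := abs_add_lt_of_closure_bddSector_subset hβ hr hcl
    obtain ⟨l, hl⟩ := ho _ h1
    refine ⟨l, hl.mono_left ?_⟩
    rw [nhdsOrigin_eq]
    refine inf_le_inf_left _ (principal_mono.2 fun u hu => ?_)
    have h2 : |u.im - θ| < β * Real.pi / 2 := hu.1
    have h3 := abs_sub_le u.im θ d
    exact (by linarith : |u.im - d| ≤ |θ - d| + β * Real.pi / 2)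
  growth θ β hβ hcl := by
    have h1 := abs_add_lt_of_closure_sector_subset hβ hcl
    obtain ⟨C, hC, K, hK, H⟩ := hg _ h1
    refine ⟨1, one_pos, C, hC, K, hK, fun u hu _ => H u ?_⟩
    have h2 : |u.im - θ| < β * Real.pi / 2 := hu
    have h3 := abs_sub_le u.im θ d
    linarith

theorem exists_pos_between {θ α : ℝ} (hα : 0 < α) (hθ : θ < α * Real.pi / 2) :
    ∃ β, 0 < β ∧ β < α ∧ θ < β * Real.pi / 2 := by
  have hpi := Real.pi_pos
  have hτ : max (2 * θ / Real.pi) 0 < α := max_lt (by rw [div_lt_iff₀ hpi]; linarith) hα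
  obtain ⟨β, hβ1, hβ2⟩ := exists_between hτ
  have h1 := (le_max_left _ _).trans_lt hβ1
  rw [div_lt_iff₀ hpi] at h1
  exact ⟨β, (le_max_right _ _).trans_lt hβ1, hβ2, by linarith⟩

theorem HasMGrowth.exists_tendsto (hf : HasMGrowth M d α f) (hα : 0 < α) {θ : ℝ}
    (hθ : θ < α * Real.pi / 2) : ∃ l : ℂ,
      Tendsto f (comap Complex.re atBot ⊓ 𝓟 {u | |u.im - d| ≤ θ}) (𝓝 l) := by
  obtain ⟨β, hβ0, hβα, hβ⟩ := exists_pos_between hα hθ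
  obtain ⟨l, hl⟩ := hf.origin d β 1 hβ0 one_pos
    ((closure_mono fun _ hz => hz.1).trans (closure_sector_subset hβα))
  refine ⟨l, hl.mono_left ?_⟩
  rw [nhdsOrigin_eq, le_inf_iff]
  refine ⟨inf_le_left, ?_⟩
  rw [le_principal_iff]
  refine mem_inf_of_inter (preimage_mem_comap (Iio_mem_atBot 0)) (mem_principal_self _)
    fun u hu => ?_
  rw [bddSector_eq d β one_pos, Real.log_one]
  exact ⟨lt_of_le_of_lt (show |u.im - d| ≤ θ from hu.2) hβ, hu.1⟩

theorem HasMGrowth.differentiableAt (hf : HasMGrowth M d α f) {u : ℂ}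
    (hu : |u.im - d| < α * Real.pi / 2) : DifferentiableAt ℂ f u :=
  hf.holomorphic.differentiableAt ((isOpen_sector _ _).mem_nhds hu)

/-- The growth condition at infinity, the limit at the origin and compactness in between give one
bound on a whole closed substrip. -/
theorem HasMGrowth.exists_bound (hf : HasMGrowth M d α f) (hM : IsWeightSequence M) (hα : 0 < α)
    {θ : ℝ} (hθ : θ < α * Real.pi / 2) : ∃ C > 0, ∃ K > 0, ∀ u : ℂ, |u.im - d| ≤ θ →
      ‖f u‖ ≤ C * Real.exp (assocFun M (Real.exp u.re / K)) := by
  obtain ⟨β, hβ0, hβα, hβ⟩ := exists_pos_between hα hθ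
  obtain ⟨r, hr, c, hc, K, hK, H⟩ := hf.growth d β hβ0 (closure_sector_subset hβα)
  obtain ⟨l, hl⟩ := hf.exists_tendsto hα hθ
  have h1 := hl.eventually (Metric.ball_mem_nhds l one_pos)
  rw [eventually_inf_principal, ((atBot_basis.comap Complex.re).eventually_iff)] at h1
  obtain ⟨x₀, -, hx₀⟩ := h1
  have hcomp : IsCompact (Icc x₀ (Real.log r) ×ℂ Icc (d - θ) (d + θ)) :=
    isCompact_Icc.reProdIm isCompact_Icc
  obtain ⟨B, hB⟩ := hcomp.exists_bound_of_continuousOn (f := f) fun u hu =>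
    (hf.differentiableAt (lt_of_le_of_lt (abs_le.2 ⟨by linarith [hu.2.1], by linarith [hu.2.2]⟩)
      hθ)).continuousAt.continuousWithinAt
  refine ⟨(‖l‖ + 1) + c + |B|, by positivity, K, hK, fun u hu => ?_⟩
  have hexp : 1 ≤ Real.exp (assocFun M (Real.exp u.re / K)) :=
    Real.one_le_exp (hM.assocFun_nonneg (by positivity))
  have hl0 := norm_nonneg l
  have hB0 := abs_nonneg B
  have key : ∀ D ≤ (‖l‖ + 1) + c + |B|, D * Real.exp (assocFun M (Real.exp u.re / K)) ≤
      ((‖l‖ + 1) + c + |B|) * Real.exp (assocFun M (Real.exp u.re / K)) := fun D hD => by gcongr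
  rcases le_or_gt u.re x₀ with h2 | h2
  · have h3 := hx₀ (show u ∈ Complex.re ⁻¹' Iic x₀ from h2) hu
    have h4 : ‖f u‖ ≤ ‖l‖ + 1 := by
      have := norm_sub_norm_le (f u) l
      rw [dist_eq_norm] at h3
      linarith
    exact (h4.trans (le_mul_of_one_le_right (by positivity) hexp)).trans (key _ (by linarith))
  · rcases le_or_gt (Real.log r) u.re with h3 | h3
    · exact (H u (lt_of_le_of_lt hu hβ) ((Real.log_le_iff_le_exp hr).1 h3)).trans
        (key _ (by linarith))
    · have h4 := hB u ⟨⟨h2.le, h3.le⟩, by linarith [(abs_le.1 hu).1], by linarith [(abs_le.1 hu).2]⟩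
      exact ((h4.trans (le_abs_self B)).trans (le_mul_of_one_le_right hB0 hexp)).trans
        (key _ (by linarith))

theorem HasKernelBound.hasMGrowth_comp_neg (hM₁ : IsWeightSequence M₁)
    (hM₂ : IsWeightSequence M₂) (ha : 0 < a)
    (h₂ : HasKernelBound M₂ (ω₂ * Real.pi / 2) a e₂) :
    HasMGrowth M₁ 0 ω₂ (fun u => e₂ (-u)) := by
  refine hasMGrowth_of_strips h₂.differentiableAt_comp_neg (fun θ hθ => ⟨0, ?_⟩)
    fun θ hθ => ?_
  · obtain ⟨C, hC, H⟩ := h₂.exists_norm_le hM₂ hθ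
    refine squeeze_zero_norm' (a := fun u => C * Real.exp (-a * |u.re|)) ?_ ?_
    · rw [eventually_inf_principal]
      exact Eventually.of_forall fun u hu => by simpa using H (-u) (by simpa using hu)
    · refine Tendsto.mono_left ?_ inf_le_left
      have h1 : Tendsto (fun x : ℝ => C * Real.exp (-a * |x|)) atBot (𝓝 (C * 0)) :=
        ((tendsto_exp_neg_mul_atTop ha).comp tendsto_abs_atBot_atTop).const_mul C
      rw [mul_zero] at h1
      exact h1.comp tendsto_comap
  · obtain ⟨C, hC, H⟩ := h₂.exists_norm_le hM₂ hθ
    refine ⟨C, hC, 1, one_pos, fun u hu => (H (-u) (by simpa using hu)).trans ?_⟩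
    gcongr
    have h1 := hM₁.assocFun_nonneg (t := Real.exp u.re / 1) (by positivity)
    have h2 := mul_nonneg ha.le (abs_nonneg (-u).re)
    linarith

/-! ### The transform of a function of `M₁ M₂`-growth by a kernel for `M₂` -/

/-- A function of `M₁ M₂`-growth grows more slowly than every dilation of `exp ω_{M₂}`. -/
theorem HasMGrowth.exists_bound_forall (hf : HasMGrowth (M₁ * M₂) d α f)
    (hM₁ : IsWeightSequence M₁) (hM₂ : IsWeightSequence M₂) (hα : 0 < α) :
    ∀ θ < α * Real.pi / 2, ∀ K > 0, ∃ C, ∀ u : ℂ, |u.im - d| ≤ θ →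
      ‖f u‖ ≤ C * Real.exp (assocFun M₂ (Real.exp u.re / K)) := by
  intro θ hθ K' hK'
  obtain ⟨C, hC, K, hK, H⟩ := hf.exists_bound (hM₁.mul hM₂) hα hθ
  refine ⟨C * Real.exp (assocFun M₁ (K' / K)), fun u hu => (H u hu).trans ?_⟩
  rw [mul_assoc, ← Real.exp_add]
  gcongr
  have := assocFun_mul_le hM₁ hM₂ (s := K' / K) (t := Real.exp u.re / K') (by positivity)
    (by positivity)
  rwa [div_mul_div_comm, mul_comm K' (Real.exp u.re), mul_div_mul_right _ _ hK'.ne'] at this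

/-- The form of the Laplace integral in which the kernel no longer depends on `re z`. -/
theorem laplaceLine_eq_integral_translate (e f : ℂ → ℂ) (τ : ℝ) (z : ℂ) :
    laplaceLine e f τ z = ∫ x : ℝ, e (x + (τ - z.im : ℝ) * Complex.I) *
      f ((x + z.re : ℝ) + τ * Complex.I) := by
  rw [laplaceLine, ← integral_add_right_eq_self (μ := volume) _ z.re]
  congr 1
  ext x
  congr 2
  conv_lhs => rw [← Complex.re_add_im z]
  push_cast
  simp only [Complex.add_re, Complex.ofReal_re, Complex.mul_re, Complex.I_re, mul_zero,
    Complex.ofReal_im, Complex.I_im, mul_one, sub_self, add_zero]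
  ring

section Transform

variable (hα : 0 < α) (hω₂ : 0 < ω₂) (ha : 0 < a) (hM₁ : IsWeightSequence M₁)
  (hM₂ : IsWeightSequence M₂) (h₂ : HasKernelBound M₂ (ω₂ * Real.pi / 2) a e₂)
  (hf : HasMGrowth (M₁ * M₂) d α f)

include hα hω₂ ha hM₁ hM₂ h₂ hf

omit hω₂ ha in
theorem exists_laplaceDominated_of_hasMGrowth_mul (ρ : ℝ) :
    ∀ θ < α * Real.pi / 2, ∀ η < ω₂ * Real.pi / 2, ∃ C,
      LaplaceDominated e₂ f d a θ η ρ C := fun _ hθ _ hη =>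
  h₂.exists_laplaceDominated_of_forall hM₂ (hf.exists_bound_forall hM₁ hM₂ hα) ρ hθ hη

theorem isLaplaceTransform_of_hasMGrowth_mul :
    IsLaplaceTransform ω₂ e₂ f d α (sector d (α + ω₂)) (laplaceGlue e₂ f d (α / (α + ω₂))) :=
  isLaplaceTransform_sector hα hω₂ ha h₂.differentiableAt (fun _ hu => hf.differentiableAt hu)
    (exists_laplaceDominated_of_hasMGrowth_mul hα hM₁ hM₂ h₂ hf)

/-- The transform by a kernel for `M₂` takes `M₁ M₂`-growth to `M₁`-growth: after the translation by
`re z`, the integrand at `x` is bounded by `exp (ω_{M₁ M₂}(exp (x + re z) / K) - ω_{M₂}(exp x / k))`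
and the associated function of the product splits. -/
theorem hasMGrowth_laplaceGlue :
    HasMGrowth M₁ d (α + ω₂) (laplaceGlue e₂ f d (α / (α + ω₂))) := by
  have hpi := Real.pi_pos
  set s := α / (α + ω₂) with hs
  have hs0 : 0 < s := by positivity
  have hs1 : 0 < 1 - s := by
    rw [hs, one_sub_div (by positivity)]
    simpa using by positivity
  have hγ : (α + ω₂) * Real.pi / 2 = α * Real.pi / 2 + ω₂ * Real.pi / 2 := by ring
  have e1 : s * ((α + ω₂) * Real.pi / 2) = α * Real.pi / 2 := by
    rw [hs]; field_simp
  have e2 : (1 - s) * ((α + ω₂) * Real.pi / 2) = ω₂ * Real.pi / 2 := by linarith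
  -- bounds for the two factors along the direction attached to `z`
  have hdir : ∀ ψ : ℝ, ∀ z : ℂ, |z.im - d| ≤ ψ → |d + s * (z.im - d) - d| ≤ s * ψ ∧
      |d + s * (z.im - d) - z.im| ≤ (1 - s) * ψ := by
    intro ψ z hz
    constructor
    · rw [add_sub_cancel_left, abs_mul, abs_of_pos hs0]; gcongr
    · rw [show d + s * (z.im - d) - z.im = -((1 - s) * (z.im - d)) by ring, abs_neg, abs_mul,
        abs_of_pos hs1]
      gcongr
  have hbound : ∀ ψ < (α + ω₂) * Real.pi / 2, ∃ C > 0, ∃ K > 0, ∀ z : ℂ, |z.im - d| ≤ ψ →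
      ∀ x : ℝ, ‖e₂ (x + (d + s * (z.im - d) - z.im : ℝ) * Complex.I) *
        f ((x + z.re : ℝ) + (d + s * (z.im - d) : ℝ) * Complex.I)‖ ≤
        C * Real.exp (assocFun M₁ (Real.exp z.re / K)) * Real.exp (-a * |x - 0|) := by
    intro ψ hψ
    have hθ : s * ψ < α * Real.pi / 2 := by
      rw [← e1]; exact mul_lt_mul_of_pos_left hψ hs0
    have hη : (1 - s) * ψ < ω₂ * Real.pi / 2 := by
      rw [← e2]; exact mul_lt_mul_of_pos_left hψ hs1
    obtain ⟨C₂, hC₂, k, hk, H₂⟩ := h₂.bound _ hη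
    obtain ⟨C, hC, K, hK, H⟩ := hf.exists_bound (hM₁.mul hM₂) hα hθ
    refine ⟨C₂ * C, by positivity, K / k, by positivity, fun z hz x => ?_⟩
    obtain ⟨g1, g2⟩ := hdir ψ z hz
    have b1 := H₂ (x + (d + s * (z.im - d) - z.im : ℝ) * Complex.I) (by simpa using g2)
    have b2 := H ((x + z.re : ℝ) + (d + s * (z.im - d) : ℝ) * Complex.I) (by simpa using g1)
    have r1 : ((x : ℂ) + (d + s * (z.im - d) - z.im : ℝ) * Complex.I).re = x := by
      rw [Complex.add_re, Complex.re_ofReal_mul]; simp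
    have r2 : (((x + z.re : ℝ) : ℂ) + (d + s * (z.im - d) : ℝ) * Complex.I).re = x + z.re := by
      rw [Complex.add_re, Complex.re_ofReal_mul]; simp
    rw [r1] at b1
    rw [r2] at b2
    have hW := assocFun_mul_le hM₁ hM₂ (s := Real.exp z.re / (K / k)) (t := Real.exp x / k)
      (by positivity) (by positivity)
    have e3 : Real.exp z.re / (K / k) * (Real.exp x / k) = Real.exp (x + z.re) / K := by
      rw [Real.exp_add]; field_simp
    rw [e3] at hW
    rw [norm_mul, sub_zero]
    refine (mul_le_mul b1 b2 (norm_nonneg _) (by positivity)).trans ?_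
    calc _ = C₂ * C * Real.exp (-a * |x| + -assocFun M₂ (Real.exp x / k) +
          assocFun (M₁ * M₂) (Real.exp (x + z.re) / K)) := by
          simp only [Real.exp_add]; ring
      _ ≤ C₂ * C * Real.exp (assocFun M₁ (Real.exp z.re / (K / k)) + -a * |x|) := by
          refine mul_le_mul_of_nonneg_left (Real.exp_le_exp.2 ?_) (by positivity)
          linarith
      _ = _ := by rw [Real.exp_add]; ring
  have hI := integrable_exp_neg_mul_abs ha 0
  have hI0 : 0 ≤ ∫ x : ℝ, Real.exp (-a * |x - 0|) := integral_nonneg fun x => (Real.exp_pos _).le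
  refine hasMGrowth_of_strips (fun z hz => ?_) (fun ψ hψ => ?_) (fun ψ hψ => ?_)
  · exact (isLaplaceTransform_of_hasMGrowth_mul hα hω₂ ha hM₁ hM₂ h₂
      hf).holomorphic.differentiableAt ((isOpen_sector _ _).mem_nhds hz)
  · -- by dominated convergence the limit at the origin is `f(0)` times the zeroth moment of `e₂`
    have hθ : s * ψ < α * Real.pi / 2 := by
      rw [← e1]; exact mul_lt_mul_of_pos_left hψ hs0
    have hη : (1 - s) * ψ < ω₂ * Real.pi / 2 := by
      rw [← e2]; exact mul_lt_mul_of_pos_left hψ hs1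
    obtain ⟨l, hl⟩ := hf.exists_tendsto hα hθ
    obtain ⟨C, hC, K, hK, H⟩ := hbound ψ hψ
    obtain ⟨C₂, hC₂, H₂⟩ := h₂.exists_norm_le hM₂ hη
    have hline : ∀ t : ℝ, |t| ≤ (1 - s) * ψ → ∫ x : ℝ, e₂ (x + t * Complex.I) =
        ∫ x : ℝ, e₂ (x + (0 : ℝ) * Complex.I) := by
      intro t ht
      have hsub : ∀ y ∈ uIcc t 0, |y| ≤ (1 - s) * ψ := by
        intro y hy
        have := abs_le.1 ht
        rcases mem_uIcc.1 hy with h | h <;> exact abs_le.2 ⟨by linarith, by linarith⟩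
      exact integral_horizontal_eq_of_decay ha
        (fun z hz => h₂.differentiableAt z ((hsub _ hz).trans_lt hη))
        (fun z hz => H₂ z (hsub _ hz))
    have hmeas : ∀ z : ℂ, |z.im - d| ≤ ψ → Continuous fun x : ℝ =>
        e₂ (x + (d + s * (z.im - d) - z.im : ℝ) * Complex.I) := fun z hz =>
      continuous_horizontal fun w hw => (h₂.differentiableAt w
        (by rw [hw]; exact (hdir ψ z hz).2.trans_lt hη)).continuousAt
    have hmeasf : ∀ z : ℂ, |z.im - d| ≤ ψ → Continuous fun x : ℝ =>
        f ((x + z.re : ℝ) + (d + s * (z.im - d) : ℝ) * Complex.I) := fun z hz => by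
      have := continuous_horizontal (f := f) (c := d + s * (z.im - d)) fun w hw =>
        (hf.differentiableAt (by rw [hw]; exact (hdir ψ z hz).1.trans_lt hθ)).continuousAt
      exact this.comp (by fun_prop : Continuous fun x : ℝ => x + z.re)
    have hnorm₂ : ∀ z : ℂ, |z.im - d| ≤ ψ → ∀ x : ℝ,
        ‖e₂ (x + (d + s * (z.im - d) - z.im : ℝ) * Complex.I)‖ ≤
          C₂ * Real.exp (-a * |x - 0|) := fun z hz x => by
      have := H₂ (x + (d + s * (z.im - d) - z.im : ℝ) * Complex.I)
        (by simpa using (hdir ψ z hz).2)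
      have r1 : ((x : ℂ) + (d + s * (z.im - d) - z.im : ℝ) * Complex.I).re = x := by
        rw [Complex.add_re, Complex.re_ofReal_mul]; simp
      rw [sub_zero]
      rwa [r1] at this
    refine ⟨(∫ x : ℝ, e₂ (x + (0 : ℝ) * Complex.I)) * l, ?_⟩
    have hdct : Tendsto (fun z : ℂ => ∫ x : ℝ,
        e₂ (x + (d + s * (z.im - d) - z.im : ℝ) * Complex.I) *
        (f ((x + z.re : ℝ) + (d + s * (z.im - d) : ℝ) * Complex.I) - l))
        (comap Complex.re atBot ⊓ 𝓟 {u | |u.im - d| ≤ ψ}) (𝓝 (∫ _ : ℝ, (0 : ℂ))) := by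
      refine tendsto_integral_filter_of_dominated_convergence
        (fun x => (C * Real.exp (assocFun M₁ (Real.exp 0 / K)) + C₂ * ‖l‖) *
          Real.exp (-a * |x - 0|)) ?_ ?_ (hI.const_mul _) ?_
      · rw [eventually_inf_principal]
        exact Eventually.of_forall fun z hz =>
          ((hmeas z hz).mul ((hmeasf z hz).sub continuous_const)).aestronglyMeasurable
      · rw [eventually_inf_principal]
        filter_upwards [preimage_mem_comap (Iic_mem_atBot (0 : ℝ))] with z hz0 hz
        refine Eventually.of_forall fun x => ?_
        have g1 := H z hz x
        have g2 := hnorm₂ z hz x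
        have g3 : Real.exp (assocFun M₁ (Real.exp z.re / K)) ≤
            Real.exp (assocFun M₁ (Real.exp 0 / K)) := by
          have hz0' : z.re ≤ 0 := hz0
          exact Real.exp_le_exp.2 (hM₁.assocFun_mono (by positivity) (by gcongr))
        rw [mul_sub]
        refine (norm_sub_le _ _).trans ?_
        rw [norm_mul _ l, add_mul]
        refine add_le_add (g1.trans (by gcongr)) ?_
        calc _ ≤ C₂ * Real.exp (-a * |x - 0|) * ‖l‖ := by gcongr
          _ = _ := by ring
      · refine Eventually.of_forall fun x => ?_
        have g1 : Tendsto (fun z : ℂ => f ((x + z.re : ℝ) + (d + s * (z.im - d) : ℝ) * Complex.I))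
            (comap Complex.re atBot ⊓ 𝓟 {u | |u.im - d| ≤ ψ}) (𝓝 l) := by
          refine hl.comp (tendsto_inf.2 ⟨?_, ?_⟩)
          · rw [tendsto_comap_iff]
            have r2 : Complex.re ∘ (fun z : ℂ => ((x + z.re : ℝ) : ℂ) +
                (d + s * (z.im - d) : ℝ) * Complex.I) = fun z => x + z.re := by
              ext z
              simp only [Function.comp_apply]
              rw [Complex.add_re, Complex.re_ofReal_mul]; simp
            rw [r2]
            exact (tendsto_atBot_add_const_left _ x tendsto_comap).mono_left inf_le_left
          · refine tendsto_principal.2 ?_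
            rw [eventually_inf_principal]
            exact Eventually.of_forall fun z hz => by simpa using (hdir ψ z hz).1
        refine squeeze_zero_norm' (a := fun z => C₂ * Real.exp (-a * |x - 0|) *
          ‖f ((x + z.re : ℝ) + (d + s * (z.im - d) : ℝ) * Complex.I) - l‖) ?_ ?_
        · rw [eventually_inf_principal]
          refine Eventually.of_forall fun z hz => ?_
          rw [norm_mul]
          exact mul_le_mul_of_nonneg_right (hnorm₂ z hz x) (norm_nonneg _)
        · have := ((g1.sub_const l).norm).const_mul (C₂ * Real.exp (-a * |x - 0|))
          simpa using this
    rw [integral_zero] at hdct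
    have := hdct.add_const ((∫ x : ℝ, e₂ (x + (0 : ℝ) * Complex.I)) * l)
    rw [zero_add] at this
    refine this.congr' ?_
    rw [EventuallyEq, eventually_inf_principal]
    refine Eventually.of_forall fun z hz => ?_
    have i1 : Integrable fun x : ℝ =>
        e₂ (x + (d + s * (z.im - d) - z.im : ℝ) * Complex.I) *
        f ((x + z.re : ℝ) + (d + s * (z.im - d) : ℝ) * Complex.I) :=
      (hI.const_mul _).mono' ((hmeas z hz).mul (hmeasf z hz)).aestronglyMeasurable
        (Eventually.of_forall (H z hz))
    have i2 : Integrable fun x : ℝ =>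
        e₂ (x + (d + s * (z.im - d) - z.im : ℝ) * Complex.I) * l :=
      ((hI.const_mul _).mono' (hmeas z hz).aestronglyMeasurable
        (Eventually.of_forall (hnorm₂ z hz))).mul_const l
    simp only [mul_sub _ (f _) l]
    rw [integral_sub i1 i2, integral_mul_const, hline _ (hdir ψ z hz).2, sub_add_cancel,
      laplaceGlue, laplaceLine_eq_integral_translate]
  · obtain ⟨C, hC, K, hK, H⟩ := hbound ψ hψ
    refine ⟨C * (1 + ∫ x : ℝ, Real.exp (-a * |x - 0|)), by positivity, K, hK, fun z hz => ?_⟩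
    rw [laplaceGlue, laplaceLine_eq_integral_translate]
    refine (norm_integral_le_of_norm_le (hI.const_mul _) (Eventually.of_forall (H z hz))).trans ?_
    rw [integral_const_mul]
    have : 0 < C * Real.exp (assocFun M₁ (Real.exp z.re / K)) := by positivity
    nlinarith

end Transform

end MGrowth

/-! ### Composition of Laplace transforms -/

section Composition

variable {M₁ M₂ : ℕ → ℝ} {f e₁ e₂ : ℂ → ℂ} {d α a ω₁ ω₂ : ℝ}

/-- Two Laplace transforms of the same function agree near the origin: they coincide with the same
integral in the bisecting direction, hence on bounded subsectors by the identity theorem. -/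
theorem IsLaplaceTransform.exists_eqOn {ω : ℝ} {e h : ℂ → ℂ} {G G' : Set ℂ} {g g' : ℂ → ℂ}
    (hg : IsLaplaceTransform ω e h d α G g) (hg' : IsLaplaceTransform ω e h d α G' g')
    (hα : 0 < α) (hω : 0 < ω) {β : ℝ} (hβ : 0 < β) (hβ' : β < α + ω) :
    ∃ r > 0, ∀ z ∈ bddSector d β r, z ∈ G ∧ g z = g' z := by
  have hpi := Real.pi_pos
  obtain ⟨r, hr, H⟩ := hg.region.bddSector_subset β hβ hβ'
  obtain ⟨r', hr', H'⟩ := hg'.region.bddSector_subset β hβ hβ'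
  have hd : |d - d| < α * Real.pi / 2 := by simp; positivity
  obtain ⟨s, hs, L⟩ := hg.eq_laplaceDir d hd (ω / 2) (by positivity) (by linarith)
  obtain ⟨s', hs', L'⟩ := hg'.eq_laplaceDir d hd (ω / 2) (by positivity) (by linarith)
  have hR : 0 < min r r' := lt_min hr hr'
  have hsub : ∀ β : ℝ, ∀ {p q : ℝ}, p ≤ q → bddSector d β p ⊆ bddSector d β q :=
    fun β p q hpq z hz => ⟨hz.1, hz.2.trans_le hpq⟩
  have hG : bddSector d β (min r r') ⊆ G := (hsub β (min_le_left _ _)).trans H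
  have hG' : bddSector d β (min r r') ⊆ G' := (hsub β (min_le_right _ _)).trans H'
  refine ⟨min r r', hR, fun z hz => ⟨hG hz, ?_⟩⟩
  have hopen := isOpen_bddSector d β (min r r')
  set t := min (min r r') (min s s') with ht
  have ht0 : 0 < t := lt_min hR (lt_min hs hs')
  -- a point on the bisecting direction, so near the origin that both integrals represent there
  set z₀ : ℂ := ((Real.log t - 1 : ℝ) : ℂ) + d * Complex.I with hz₀
  have hz₀mem : ∀ γ > 0, z₀ ∈ bddSector d γ t := by
    intro γ hγ
    rw [bddSector_eq _ _ ht0, hz₀]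
    refine ⟨?_, ?_⟩
    · simp [sector]; positivity
    · simp
  have hev : g =ᶠ[𝓝 z₀] g' := by
    filter_upwards [(isOpen_bddSector d (ω / 2) t).mem_nhds (hz₀mem _ (by positivity))] with w hw
    have h1 := L w (hsub _ ((min_le_right _ _).trans (min_le_left _ _)) hw)
    have h2 := L' w (hsub _ ((min_le_right _ _).trans (min_le_right _ _)) hw)
    rw [h1.2.2, h2.2.2]
  exact ((hg.holomorphic.mono hG).analyticOnNhd hopen).eqOn_of_preconnected_of_eventuallyEq
    ((hg'.holomorphic.mono hG').analyticOnNhd hopen) (convex_bddSector d β hR).isPreconnected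
    (hsub _ (min_le_left _ _) (hz₀mem β hβ)) hev hz

variable (hω₁ : 0 < ω₁) (hω₂ : 0 < ω₂) (ha : 0 < a) (hM₁ : IsWeightSequence M₁)
  (hM₂ : IsWeightSequence M₂) (h₁ : HasKernelBound M₁ (ω₁ * Real.pi / 2) a e₁)
  (h₂ : HasKernelBound M₂ (ω₂ * Real.pi / 2) a e₂) (hα : 0 < α)
  (hf : HasMGrowth (M₁ * M₂) d α f)

include hω₁ hω₂ ha hM₁ hM₂ h₁ h₂ hα hf

/-- Fubini's theorem for the composition of the two Laplace integrals; it applies for `z` near the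
origin because `ω_{M₁ M₂}(st) ≤ ω_{M₁}(s) + ω_{M₂}(t)`. -/
theorem exists_laplaceLine_comp {θ η₁ η₂ : ℝ} (hθ : θ < α * Real.pi / 2)
    (hη₁ : η₁ < ω₁ * Real.pi / 2) (hη₂ : η₂ < ω₂ * Real.pi / 2) :
    ∃ ρ : ℝ, ∀ (τ τ' : ℝ) (z : ℂ), |τ - d| ≤ θ → |τ' - τ| ≤ η₂ → |z.im - τ'| ≤ η₁ → z.re ≤ ρ →
      Integrable (fun y : ℝ => e₁ (y + τ' * Complex.I - z) *
        laplaceGlue e₂ f d (α / (α + ω₂)) (y + τ' * Complex.I)) ∧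
      laplaceLine e₁ (laplaceGlue e₂ f d (α / (α + ω₂))) τ' z =
        laplaceLine (convKernel ω₁ ω₂ e₁ e₂) f τ z := by
  have hpi := Real.pi_pos
  obtain ⟨C₁, hC₁, k₁, hk₁, H₁⟩ := h₁.bound _ hη₁
  obtain ⟨C₂, hC₂, k₂, hk₂, H₂⟩ := h₂.bound _ hη₂
  obtain ⟨C, hC, K, hK, H⟩ := hf.exists_bound (hM₁.mul hM₂) hα hθ
  refine ⟨Real.log (K / (k₁ * k₂)), fun τ τ' z hτ hτ' hz hρ => ?_⟩
  have hs : α / (α + ω₂) * (α * Real.pi / 2 + ω₂ * Real.pi / 2) = α * Real.pi / 2 := by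
    field_simp
  set h := laplaceGlue e₂ f d (α / (α + ω₂)) with hh
  have hglue : ∀ y : ℝ, h (y + τ' * Complex.I) = laplaceLine e₂ f τ (y + τ' * Complex.I) := by
    intro y
    exact laplaceGlue_eq_laplaceLine ha (by positivity) (by positivity) hs h₂.differentiableAt
      (fun u hu => hf.differentiableAt hu)
      (exists_laplaceDominated_of_hasMGrowth_mul hα hM₁ hM₂ h₂ hf _) (hτ.trans_lt hθ)
      (by simpa using hτ'.trans_lt hη₂) le_rfl
  -- the integrand as a function of the pair `(x, y)`
  set Φ : ℝ × ℝ → ℂ := fun p => e₁ (p.2 + τ' * Complex.I - z) *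
    (e₂ (p.1 + τ * Complex.I - (p.2 + τ' * Complex.I)) * f (p.1 + τ * Complex.I)) with hΦ
  have hsplit : ∀ x y : ℝ, (x : ℂ) + τ * Complex.I - (y + τ' * Complex.I) =
      ((x - y : ℝ) : ℂ) + ((τ - τ' : ℝ) : ℂ) * Complex.I := by
    intro x y; push_cast; ring
  have hcont : Continuous Φ := by
    have c1 : Continuous fun y : ℝ => e₁ (y + τ' * Complex.I - z) := by
      refine continuous_horizontal (f := fun w => e₁ (w - z)) fun w hw => ?_
      have : DifferentiableAt ℂ e₁ (w - z) := h₁.differentiableAt _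
        (by rw [Complex.sub_im, hw, abs_sub_comm]; exact hz.trans_lt hη₁)
      exact (this.comp w (differentiableAt_id.sub_const z)).continuousAt
    have c2 : Continuous fun x : ℝ => e₂ (x + ((τ - τ' : ℝ) : ℂ) * Complex.I) :=
      continuous_horizontal fun w hw => (h₂.differentiableAt w
        (by rw [hw, abs_sub_comm]; exact hτ'.trans_lt hη₂)).continuousAt
    have c3 : Continuous fun x : ℝ => f (x + τ * Complex.I) :=
      continuous_horizontal fun w hw => (hf.differentiableAt
        (by rw [hw]; exact hτ.trans_lt hθ)).continuousAt
    simp only [hΦ, hsplit]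
    exact (c1.comp continuous_snd).mul
      ((c2.comp (continuous_fst.sub continuous_snd)).mul (c3.comp continuous_fst))
  have hbd : ∀ p : ℝ × ℝ, ‖Φ p‖ ≤ C₁ * C₂ * C *
      (Real.exp (-a * |p.2 - z.re|) * Real.exp (-a * |p.1 - p.2 - 0|)) := by
    rintro ⟨x, y⟩
    have b1 := H₁ (y + τ' * Complex.I - z)
      (by rw [abs_sub_comm] at hz; simpa using hz)
    have b2 := H₂ (x + τ * Complex.I - (y + τ' * Complex.I))
      (by rw [abs_sub_comm] at hτ'; simpa using hτ')
    have b3 := H (x + τ * Complex.I) (by simpa using hτ)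
    have r1 : ((y : ℂ) + τ' * Complex.I - z).re = y - z.re := by simp
    have r2 : ((x : ℂ) + τ * Complex.I - (y + τ' * Complex.I)).re = x - y := by simp
    have r3 : ((x : ℂ) + τ * Complex.I).re = x := by simp
    rw [r1] at b1
    rw [r2] at b2
    rw [r3] at b3
    have hW := assocFun_mul_le hM₁ hM₂ (s := Real.exp (y - z.re) / k₁)
      (t := Real.exp (x - y) / k₂) (by positivity) (by positivity)
    have hWm : assocFun (M₁ * M₂) (Real.exp x / K) ≤
        assocFun (M₁ * M₂) (Real.exp (y - z.re) / k₁ * (Real.exp (x - y) / k₂)) := by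
      refine (hM₁.mul hM₂).assocFun_mono (by positivity) ?_
      have h4 : Real.exp z.re ≤ K / (k₁ * k₂) := (Real.le_log_iff_exp_le (by positivity)).1 hρ
      rw [le_div_iff₀ (by positivity)] at h4
      rw [div_mul_div_comm, ← Real.exp_add, show y - z.re + (x - y) = x - z.re by ring,
        Real.exp_sub, div_div, div_le_div_iff₀ hK (by positivity)]
      gcongr
    simp only [hΦ, norm_mul, sub_zero]
    refine (mul_le_mul b1 (mul_le_mul b2 b3 (norm_nonneg _) (by positivity)) (by positivity)
      (by positivity)).trans ?_
    calc _ = C₁ * C₂ * C * Real.exp (-a * |y - z.re| + -a * |x - y| +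
          (-assocFun M₁ (Real.exp (y - z.re) / k₁) + -assocFun M₂ (Real.exp (x - y) / k₂) +
            assocFun (M₁ * M₂) (Real.exp x / K))) := by
          simp only [Real.exp_add]; ring
      _ ≤ C₁ * C₂ * C * Real.exp (-a * |y - z.re| + -a * |x - y|) := by
          refine mul_le_mul_of_nonneg_left (Real.exp_le_exp.2 ?_) (by positivity)
          linarith
      _ = _ := by rw [Real.exp_add]
  have hint : Integrable Φ (volume.prod volume) := by
    have i0 := (integrable_exp_neg_mul_abs ha z.re).convolution_integrand
      (ContinuousLinearMap.mul ℝ ℝ) (integrable_exp_neg_mul_abs ha 0)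
    exact (i0.const_mul (C₁ * C₂ * C)).mono' hcont.aestronglyMeasurable
      (Eventually.of_forall hbd)
  have hinner_x : ∀ y : ℝ, ∫ x : ℝ, Φ (x, y) =
      e₁ (y + τ' * Complex.I - z) * h (y + τ' * Complex.I) := by
    intro y
    simp only [hΦ]
    rw [integral_const_mul, hglue, laplaceLine]
  have hinner_y : ∀ x : ℝ, ∫ y : ℝ, Φ (x, y) =
      convKernel ω₁ ω₂ e₁ e₂ (x + τ * Complex.I - z) * f (x + τ * Complex.I) := by
    intro x
    rw [convKernel_eq_integral hω₁ hω₂ ha hM₁ hM₂ h₁ h₂ (s := τ' - z.im)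
      (by rw [abs_sub_comm]; exact hz.trans_lt hη₁)
      (by
        have : ((x : ℂ) + τ * Complex.I - z).im - (τ' - z.im) = -(τ' - τ) := by simp
        rw [this, abs_neg]; exact hτ'.trans_lt hη₂),
      ← integral_sub_right_eq_self (μ := volume) (fun y : ℝ =>
        e₁ (y + ((τ' - z.im : ℝ) : ℂ) * Complex.I) * e₂ (x + τ * Complex.I - z -
          (y + ((τ' - z.im : ℝ) : ℂ) * Complex.I))) z.re, ← integral_mul_const]
    congr 1
    ext y
    have e : ((y - z.re : ℝ) : ℂ) + ((τ' - z.im : ℝ) : ℂ) * Complex.I =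
        y + τ' * Complex.I - z := by
      conv_rhs => rw [← Complex.re_add_im z]
      push_cast
      ring
    rw [e, sub_sub_sub_cancel_right, mul_assoc]
  constructor
  · have := hint.integral_prod_right
    exact this.congr (Eventually.of_forall hinner_x)
  · have hswap := integral_integral_swap (f := fun x y => Φ (x, y)) hint
    simp only [hinner_x, hinner_y] at hswap
    exact hswap.symm

theorem isLaplaceTransform_comp_of {G : Set ℂ} {g : ℂ → ℂ}
    (hg : IsLaplaceTransform (ω₁ + ω₂) (convKernel ω₁ ω₂ e₁ e₂) f d α G g) :
    IsLaplaceTransform ω₁ e₁ (laplaceGlue e₂ f d (α / (α + ω₂))) d (α + ω₂) G g := by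
  have hpi := Real.pi_pos
  have hs : α / (α + ω₂) * (α * Real.pi / 2 + ω₂ * Real.pi / 2) = α * Real.pi / 2 := by
    field_simp
  refine ⟨?_, hg.holomorphic, fun τ' hτ' β hβ hβω => ?_⟩
  · rw [add_assoc, add_comm ω₂]; exact hg.region
  obtain ⟨g1, g2⟩ := abs_glue_direction_lt (A := α * Real.pi / 2) (B := ω₂ * Real.pi / 2)
    (by positivity) (by positivity) hs (y := τ') (d := d) (by linarith)
  set τ := d + α / (α + ω₂) * (τ' - d)
  have hβ1 : β * Real.pi / 2 < ω₁ * Real.pi / 2 := by nlinarith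
  obtain ⟨ρ, hρ⟩ := exists_laplaceLine_comp hω₁ hω₂ ha hM₁ hM₂ h₁ h₂ hα hf g1 hβ1 g2
  obtain ⟨β', hβ'0, hβ'ω, hβ'⟩ := exists_pos_between (θ := |τ' - τ| + β * Real.pi / 2)
    (add_pos hω₁ hω₂) (by linarith)
  obtain ⟨r, hr, H⟩ := hg.eq_laplaceDir τ g1 β' hβ'0 hβ'ω
  refine ⟨min r (Real.exp ρ), lt_min hr (Real.exp_pos _), fun z hz => ?_⟩
  have hz1 : |z.im - τ'| < β * Real.pi / 2 := hz.1
  have hz2 : modulus z < r := hz.2.trans_le (min_le_left _ _)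
  have hz3 : z.re < ρ := Real.exp_lt_exp.1 (hz.2.trans_le (min_le_right _ _))
  obtain ⟨m1, m2, m3⟩ := H z ⟨by have := abs_sub_le z.im τ' τ; linarith, hz2⟩
  obtain ⟨n1, n2⟩ := hρ τ τ' z le_rfl le_rfl hz1.le hz3.le
  refine ⟨m1, (integrableOn_laplaceIntegrand_iff _ _ _ _).2 n1, ?_⟩
  rw [m3, laplaceDir_eq_laplaceLine, laplaceDir_eq_laplaceLine, n2]

theorem exists_isLaplaceTransform_convKernel :
    ∃ G g, IsLaplaceTransform (ω₁ + ω₂) (convKernel ω₁ ω₂ e₁ e₂) f d α G g := by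
  have hK := hasKernelBound_convKernel hω₁ hω₂ ha hM₁ hM₂ h₁ h₂
  exact exists_isLaplaceTransform hα (add_pos hω₁ hω₂) (half_pos ha) hK.differentiableAt
    (fun u hu => hf.differentiableAt hu) fun θ hθ η hη =>
      hK.exists_laplaceDominated (hM₁.mul hM₂)
        (fun θ hθ => hf.exists_bound (hM₁.mul hM₂) hα hθ) hθ hη

/-- The Laplace operator of the convolution is the composition of the two Laplace operators. One
direction is Fubini's theorem; the other compares with a transform by the convolution, which exists,
through the uniqueness of Laplace transforms near the origin. -/
theorem isLaplaceTransform_comp_iff (G : Set ℂ) (g : ℂ → ℂ) :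
    IsLaplaceTransform ω₁ e₁ (laplaceGlue e₂ f d (α / (α + ω₂))) d (α + ω₂) G g ↔
      IsLaplaceTransform (ω₁ + ω₂) (convKernel ω₁ ω₂ e₁ e₂) f d α G g := by
  refine ⟨fun hg => ?_, isLaplaceTransform_comp_of hω₁ hω₂ ha hM₁ hM₂ h₁ h₂ hα hf⟩
  have hpi := Real.pi_pos
  obtain ⟨G₀, g₀, hg₀⟩ := exists_isLaplaceTransform_convKernel hω₁ hω₂ ha hM₁ hM₂ h₁ h₂ hα hf
  have hg₀' := isLaplaceTransform_comp_of hω₁ hω₂ ha hM₁ hM₂ h₁ h₂ hα hf hg₀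
  refine ⟨?_, hg.holomorphic, fun τ hτ β hβ hβω => ?_⟩
  · rw [add_comm ω₁, ← add_assoc]; exact hg.region
  have hβ1 : β * Real.pi / 2 < (ω₁ + ω₂) * Real.pi / 2 := by nlinarith
  obtain ⟨β', hβ'0, hβ'ω, hβ'⟩ := exists_pos_between (α := α + ω₂ + ω₁)
    (θ := |τ - d| + β * Real.pi / 2) (by positivity) (by linarith)
  obtain ⟨r, hr, H⟩ := hg.exists_eqOn hg₀' (by positivity) hω₁ hβ'0 hβ'ω
  obtain ⟨r', hr', H'⟩ := hg₀.eq_laplaceDir τ hτ β hβ hβω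
  refine ⟨min r r', lt_min hr hr', fun z hz => ?_⟩
  have hz1 : |z.im - τ| < β * Real.pi / 2 := hz.1
  obtain ⟨m1, m2⟩ := H z ⟨by have := abs_sub_le z.im τ d; linarith, hz.2.trans_le (min_le_left _ _)⟩
  obtain ⟨-, n2, n3⟩ := H' z ⟨hz1, hz.2.trans_le (min_le_right _ _)⟩
  exact ⟨m1, n2, m2.trans n3⟩

end Composition

/-! ### The function `1 / (1 - u)` -/

/-- The function `u ↦ 1 / (1 - u)` in the logarithmic coordinate. -/
noncomputable def geomFun (u : ℂ) : ℂ := (1 - Complex.exp u)⁻¹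

theorem geomFun_add_two_pi (u : ℂ) : geomFun (u + 2 * Real.pi * Complex.I) = geomFun u := by
  rw [geomFun, geomFun, exp_add_two_pi]

theorem sq_norm_one_sub_exp (u : ℂ) :
    ‖1 - Complex.exp u‖ ^ 2 =
      1 - 2 * Real.exp u.re * Real.cos u.im + Real.exp u.re ^ 2 := by
  rw [← Complex.normSq_eq_norm_sq, Complex.normSq_apply]
  simp only [Complex.sub_re, Complex.sub_im, Complex.one_re, Complex.one_im, Complex.exp_re,
    Complex.exp_im]
  linear_combination Real.exp u.re ^ 2 * Real.sin_sq_add_cos_sq u.im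

theorem le_norm_one_sub_exp {c : ℝ} (hc0 : 0 ≤ c) (hc1 : c < 1) {u : ℂ}
    (hu : Real.cos u.im ≤ c) :
    Real.sqrt (1 - c ^ 2) ≤ ‖1 - Complex.exp u‖ ∧
      Real.sqrt (1 - c ^ 2) * Real.exp u.re ≤ ‖1 - Complex.exp u‖ := by
  have hr := Real.exp_pos u.re
  have h := sq_norm_one_sub_exp u
  have h1 : 2 * Real.exp u.re * Real.cos u.im ≤ 2 * Real.exp u.re * c := by gcongr
  have hc2 : 0 ≤ 1 - c ^ 2 := by nlinarith
  constructor
  · refine (Real.sqrt_le_left (norm_nonneg _)).2 ?_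
    nlinarith [sq_nonneg (Real.exp u.re - c)]
  · refine le_of_sq_le_sq ?_ (norm_nonneg _)
    rw [mul_pow, Real.sq_sqrt hc2, h]
    nlinarith [sq_nonneg (1 - c * Real.exp u.re)]

theorem norm_geomFun_le {c : ℝ} (hc0 : 0 ≤ c) (hc1 : c < 1) {u : ℂ}
    (hu : Real.cos u.im ≤ c) :
    ‖geomFun u‖ ≤ (Real.sqrt (1 - c ^ 2))⁻¹ ∧
      ‖geomFun u‖ ≤ (Real.sqrt (1 - c ^ 2))⁻¹ * Real.exp (-u.re) := by
  have hc2 : 0 < Real.sqrt (1 - c ^ 2) := Real.sqrt_pos.2 (by nlinarith)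
  have hr := Real.exp_pos u.re
  obtain ⟨h1, h2⟩ := le_norm_one_sub_exp hc0 hc1 hu
  rw [geomFun, norm_inv]
  refine ⟨inv_anti₀ hc2 h1, ?_⟩
  rw [Real.exp_neg, ← mul_inv]
  exact inv_anti₀ (by positivity) h2

theorem exists_cos_le {θ : ℝ} (hθ : θ < Real.pi) :
    ∃ c, 0 ≤ c ∧ c < 1 ∧ ∀ y : ℝ, |y - Real.pi| ≤ θ → Real.cos y ≤ c := by
  rcases lt_or_ge θ 0 with h | h
  · exact ⟨0, le_rfl, one_pos, fun y hy => absurd (hy.trans_lt h) (not_lt.2 (abs_nonneg _))⟩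
  refine ⟨max (-Real.cos θ) 0, le_max_right _ _, max_lt ?_ one_pos, fun y hy => ?_⟩
  · have := Real.cos_lt_cos_of_nonneg_of_le_pi h le_rfl hθ
    rw [Real.cos_pi] at this
    linarith
  · refine le_trans ?_ (le_max_left _ _)
    have h1 : Real.cos y = -Real.cos |y - Real.pi| := by
      rw [Real.cos_abs, Real.cos_sub_pi, neg_neg]
    rw [h1]
    exact neg_le_neg (Real.cos_le_cos_of_nonneg_of_le_pi (abs_nonneg _) hθ.le hy)

theorem exists_norm_geomFun_le {θ : ℝ} (hθ : θ < Real.pi) :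
    ∃ C > 0, ∀ u : ℂ, |u.im - Real.pi| ≤ θ → ‖geomFun u‖ ≤ C := by
  obtain ⟨c, hc0, hc1, H⟩ := exists_cos_le hθ
  exact ⟨_, inv_pos.2 (Real.sqrt_pos.2 (by nlinarith)),
    fun u hu => (norm_geomFun_le hc0 hc1 (H _ hu)).1⟩

theorem one_sub_exp_ne_zero {u : ℂ} (hu : |u.im - Real.pi| < Real.pi) : 1 - Complex.exp u ≠ 0 := by
  obtain ⟨c, hc0, hc1, H⟩ := exists_cos_le hu
  have h1 := (le_norm_one_sub_exp hc0 hc1 (H _ le_rfl)).1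
  have h2 : 0 < Real.sqrt (1 - c ^ 2) := Real.sqrt_pos.2 (by nlinarith)
  exact norm_pos_iff.1 (h2.trans_le h1)

theorem differentiableAt_geomFun {u : ℂ} (hu : |u.im - Real.pi| < 2 * Real.pi / 2) :
    DifferentiableAt ℂ geomFun u := by
  rw [mul_div_cancel_left₀ _ two_ne_zero] at hu
  exact ((differentiableAt_const _).sub Complex.differentiableAt_exp).inv (one_sub_exp_ne_zero hu)

theorem hasMGrowth_geomFun {M : ℕ → ℝ} (hM : IsWeightSequence M) :
    HasMGrowth M Real.pi 2 geomFun := by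
  refine hasMGrowth_of_strips (fun _ => differentiableAt_geomFun) (fun θ _ => ⟨1, ?_⟩)
    fun θ hθ => ?_
  · refine Tendsto.mono_left ?_ inf_le_left
    have h := Complex.tendsto_exp_comap_re_atBot.const_sub 1
    have h2 : Tendsto geomFun (comap Complex.re atBot) (𝓝 (1 - 0)⁻¹) := h.inv₀ (by simp)
    simpa using h2
  · rw [mul_div_cancel_left₀ _ two_ne_zero] at hθ
    obtain ⟨C, hC, H⟩ := exists_norm_geomFun_le hθ
    refine ⟨C, hC, 1, one_pos, fun u hu => (H u hu).trans ?_⟩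
    exact le_mul_of_one_le_right hC.le (Real.one_le_exp (hM.assocFun_nonneg (by positivity)))

/-! ### The comparison function `-1 / sinh` -/

theorem integral_exp_div_one_add_exp_sq :
    ∫ x : ℝ, ((Real.exp x / (1 + Real.exp x ^ 2) : ℝ) : ℂ) = Real.pi / 2 := by
  have h := setIntegral_comp_log_div
    (fun x : ℝ => ((Real.exp x / (1 + Real.exp x ^ 2) : ℝ) : ℂ)) MeasurableSet.univ
  rw [image_exp_univ, setIntegral_univ] at h
  rw [← h]
  have h2 : ∫ t in Ioi (0 : ℝ),
      ((Real.exp (Real.log t) / (1 + Real.exp (Real.log t) ^ 2) : ℝ) : ℂ) / (t : ℂ) =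
        ∫ t in Ioi (0 : ℝ), (((1 + t ^ 2)⁻¹ : ℝ) : ℂ) := by
    refine setIntegral_congr_fun measurableSet_Ioi fun t ht => ?_
    have ht' : (0 : ℝ) < t := ht
    have hc : (t : ℂ) ≠ 0 := Complex.ofReal_ne_zero.2 ht'.ne'
    simp only [Real.exp_log ht']
    push_cast
    rw [div_right_comm, div_self hc, one_div]
  rw [h2]
  have h3 : ∫ t in Ioi (0 : ℝ), (((1 + t ^ 2)⁻¹ : ℝ) : ℂ) =
      ((∫ t in Ioi (0 : ℝ), (1 + t ^ 2)⁻¹ : ℝ) : ℂ) := integral_ofReal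
  rw [h3, integral_Ioi_inv_one_add_sq, Real.arctan_zero, sub_zero]
  push_cast
  rfl

/-- A comparison function with residue at the origin like that of `geomFun`, namely
`-1 / sinh ζ`, for which the jump across the real line can be computed. -/
noncomputable def cschFun (ζ : ℂ) : ℂ := 2 * Complex.exp ζ * geomFun (2 * ζ)

theorem norm_cschFun_le_of_norm_geomFun_le {K : ℝ} {ζ : ℂ} (h1 : ‖geomFun (2 * ζ)‖ ≤ K)
    (h2 : ‖geomFun (2 * ζ)‖ ≤ K * Real.exp (-(2 * ζ).re)) :
    ‖cschFun ζ‖ ≤ 2 * K * Real.exp (-1 * |ζ.re|) := by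
  have hre : (2 * ζ).re = 2 * ζ.re := by simp
  rw [hre] at h2
  rw [cschFun, norm_mul, norm_mul, Complex.norm_exp, RCLike.norm_ofNat]
  rcases le_total 0 ζ.re with h | h
  · rw [abs_of_nonneg h]
    calc _ ≤ 2 * Real.exp ζ.re * (K * Real.exp (-(2 * ζ.re))) := by gcongr
      _ = 2 * K * (Real.exp ζ.re * Real.exp (-(2 * ζ.re))) := by ring
      _ = _ := by rw [← Real.exp_add]; ring_nf
  · rw [abs_of_nonpos h]
    calc _ ≤ 2 * Real.exp ζ.re * K := by gcongr
      _ = _ := by ring_nf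

theorem norm_cschFun_le {c : ℝ} (hc0 : 0 ≤ c) (hc1 : c < 1) {ζ : ℂ}
    (hζ : Real.cos (2 * ζ.im) ≤ c) :
    ‖cschFun ζ‖ ≤ 2 * (Real.sqrt (1 - c ^ 2))⁻¹ * Real.exp (-1 * |ζ.re|) := by
  obtain ⟨h1, h2⟩ := norm_geomFun_le (u := 2 * ζ) hc0 hc1 (by simpa using hζ)
  exact norm_cschFun_le_of_norm_geomFun_le h1 h2

/-- Shifting the line to `im ζ = π / 2` makes the integrand `i / cosh`, with integral `π i`. -/
theorem integral_cschFun_upper {δ : ℝ} (hδ : 0 < δ) (hδ' : δ < Real.pi / 2) :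
    ∫ x : ℝ, cschFun (x + δ * Complex.I) = Real.pi * Complex.I := by
  have hθ : Real.pi - 2 * δ < Real.pi := by linarith
  obtain ⟨c, hc0, hc1, H⟩ := exists_cos_le hθ
  have key : ∀ y ∈ uIcc δ (Real.pi / 2), |2 * y - Real.pi| ≤ Real.pi - 2 * δ := by
    intro y hy
    rw [uIcc_of_le hδ'.le] at hy
    exact abs_le.2 ⟨by linarith [hy.1], by linarith [hy.2]⟩
  rw [integral_horizontal_eq_of_decay (f := cschFun) (d := Real.pi / 2) one_pos
    (fun z hz => ?_) (fun z hz => norm_cschFun_le hc0 hc1 (H _ (key _ hz)))]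
  · have hval : ∀ x : ℝ, cschFun (x + ((Real.pi / 2 : ℝ) : ℂ) * Complex.I) =
        2 * Complex.I * ((Real.exp x / (1 + Real.exp x ^ 2) : ℝ) : ℂ) := by
      intro x
      have e1 : Complex.exp (2 * (x + ((Real.pi / 2 : ℝ) : ℂ) * Complex.I)) =
          -(Complex.exp x ^ 2) := by
        rw [show (2 : ℂ) * (x + ((Real.pi / 2 : ℝ) : ℂ) * Complex.I) =
          (2 : ℕ) * (x : ℂ) + Real.pi * Complex.I by push_cast; ring, Complex.exp_add,
          Complex.exp_pi_mul_I, Complex.exp_nat_mul]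
        ring
      have e2 : Complex.exp (x + ((Real.pi / 2 : ℝ) : ℂ) * Complex.I) =
          Complex.exp x * Complex.I := by
        rw [Complex.exp_add]
        push_cast
        rw [Complex.exp_pi_div_two_mul_I]
      rw [cschFun, geomFun, e1, e2]
      push_cast
      rw [sub_neg_eq_add]
      ring
    simp only [hval]
    rw [integral_const_mul, integral_exp_div_one_add_exp_sq]
    ring
  · have h1 : DifferentiableAt ℂ geomFun (2 * z) := by
      refine differentiableAt_geomFun ?_
      have := key _ hz
      have e : (2 * z).im = 2 * z.im := by simp
      rw [e]
      linarith
    exact ((differentiableAt_const _).mul Complex.differentiableAt_exp).mul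
      (h1.comp z ((differentiableAt_const _).mul differentiableAt_id))

theorem cschFun_neg (ζ : ℂ) : cschFun (-ζ) = -cschFun ζ := by
  have h0 : Complex.exp ζ ≠ 0 := Complex.exp_ne_zero ζ
  have e1 : Complex.exp (2 * ζ) = Complex.exp ζ ^ 2 := by
    rw [← Complex.exp_nat_mul]; norm_num
  have e2 : Complex.exp (2 * -ζ) = (Complex.exp ζ ^ 2)⁻¹ := by
    rw [mul_neg, Complex.exp_neg, e1]
  rw [cschFun, cschFun, geomFun, geomFun, e1, e2, Complex.exp_neg]
  by_cases h : 1 - Complex.exp ζ ^ 2 = 0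
  · have h' : Complex.exp ζ ^ 2 = 1 := (sub_eq_zero.1 h).symm
    simp [h']
  · have h2 : Complex.exp ζ ^ 2 - 1 ≠ 0 := fun h' => h (by rw [← neg_sub, h', neg_zero])
    have h3 : 1 - (Complex.exp ζ ^ 2)⁻¹ ≠ 0 := by
      intro h'
      apply h2
      field_simp at h'
      simpa using h'
    field_simp
    ring

theorem integral_cschFun_lower {δ : ℝ} (hδ : 0 < δ) (hδ' : δ < Real.pi / 2) :
    ∫ x : ℝ, cschFun (x + ((-δ : ℝ) : ℂ) * Complex.I) = -(Real.pi * Complex.I) := by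
  rw [← integral_cschFun_upper hδ hδ', ← integral_neg_eq_self (μ := volume), ← integral_neg]
  congr 1
  ext x
  rw [← cschFun_neg]
  congr 1
  push_cast
  ring

/-! ### The jump relation and the recovery of the kernel -/

theorem norm_geomFun_le_of_one_le_abs_re {u : ℂ} (hu : 1 ≤ |u.re|) :
    ‖geomFun u‖ ≤ 2 ∧ ‖geomFun u‖ ≤ 2 * Real.exp (-u.re) := by
  have hr := Real.exp_pos u.re
  have h1 : |1 - Real.exp u.re| ≤ ‖1 - Complex.exp u‖ := by
    have := abs_norm_sub_norm_le 1 (Complex.exp u)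
    rwa [norm_one, Complex.norm_exp] at this
  have h2 : 1 / 2 ≤ |1 - Real.exp u.re| ∧ Real.exp u.re / 2 ≤ |1 - Real.exp u.re| := by
    rcases le_total 0 u.re with h | h
    · rw [abs_of_nonneg h] at hu
      have h3 : 2 ≤ Real.exp u.re := by linarith [Real.add_one_le_exp u.re]
      rw [abs_of_nonpos (by linarith)]
      constructor <;> linarith
    · rw [abs_of_nonpos h] at hu
      have h3 : 2 ≤ Real.exp (-u.re) := by linarith [Real.add_one_le_exp (-u.re)]
      have h4 : Real.exp u.re * Real.exp (-u.re) = 1 := by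
        rw [← Real.exp_add, add_neg_cancel, Real.exp_zero]
      have h5 : Real.exp u.re ≤ 1 / 2 := by nlinarith
      rw [abs_of_nonneg (by linarith)]
      constructor <;> linarith
  have h3 : 0 < ‖1 - Complex.exp u‖ := by linarith
  rw [geomFun, norm_inv, Real.exp_neg]
  constructor
  · rw [inv_le_comm₀ h3 two_pos]; linarith
  · rw [← div_eq_mul_inv, inv_le_comm₀ h3 (by positivity), inv_div]; linarith

theorem one_sub_exp_ne_zero_of_abs_im_lt {ζ : ℂ} (h : |ζ.im| < 2 * Real.pi) (h0 : ζ ≠ 0) :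
    1 - Complex.exp ζ ≠ 0 := by
  intro h1
  obtain ⟨n, hn⟩ := Complex.exp_eq_one_iff.1 (sub_eq_zero.1 h1).symm
  have hpi := Real.pi_pos
  have him : ζ.im = n * (2 * Real.pi) := by rw [hn]; simp
  rw [him, abs_mul, abs_of_pos (by positivity : (0 : ℝ) < 2 * Real.pi)] at h
  have h2 : |(n : ℝ)| < 1 := by nlinarith
  have h3 : n = 0 := Int.abs_lt_one_iff.1 (by exact_mod_cast h2)
  exact h0 (by rw [hn, h3]; simp)

/-- Off the pole, `cschFun` is a multiple of `geomFun` whose factor is `1` at the origin. -/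
theorem cschFun_eq (ζ : ℂ) :
    cschFun ζ = 2 * Complex.exp ζ / (1 + Complex.exp ζ) * geomFun ζ := by
  have e1 : Complex.exp (2 * ζ) = Complex.exp ζ ^ 2 := by
    rw [← Complex.exp_nat_mul]; norm_num
  rw [cschFun, geomFun, geomFun, e1, show 1 - Complex.exp ζ ^ 2 =
    (1 + Complex.exp ζ) * (1 - Complex.exp ζ) by ring, mul_inv]
  ring

theorem one_add_exp_ne_zero_of_abs_im_lt {ζ : ℂ} (h : |ζ.im| < Real.pi) :
    1 + Complex.exp ζ ≠ 0 := by
  have h1 := one_sub_exp_ne_zero (u := ζ + Real.pi * Complex.I) (by simpa using h)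
  rwa [Complex.exp_add, Complex.exp_pi_mul_I, mul_neg_one, sub_neg_eq_add] at h1

section Jump

variable {M : ℕ → ℝ} {e : ℂ → ℂ} {B a : ℝ}

/-- The jump relation across the pole of `1 / (1 - u)`. Subtracting a multiple of `cschFun` removes
the pole, so the difference of integrals above and below the real line is that of `cschFun`. -/
theorem laplaceLine_geomFun_sub (hM : IsWeightSequence M) (ha : 0 < a) (h : HasKernelBound M B a e)
    {z : ℂ} {δ : ℝ} (hδ : 0 < δ) (hδ' : δ < Real.pi / 2) (hz : |z.im| + δ < B)
    (h₁ : Integrable fun x : ℝ => e (x + δ * Complex.I - z) * geomFun (x + δ * Complex.I))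
    (h₂ : Integrable fun x : ℝ =>
      e (x + ((-δ : ℝ) : ℂ) * Complex.I - z) * geomFun (x + ((-δ : ℝ) : ℂ) * Complex.I)) :
    laplaceLine e geomFun δ z - laplaceLine e geomFun (-δ) z =
      2 * Real.pi * Complex.I * e (-z) := by
  have hpi := Real.pi_pos
  obtain ⟨δ', hδ1, hδ2⟩ := exists_between (lt_min hδ' (lt_sub_iff_add_lt'.2 hz))
  have hδ3 := hδ2.trans_le (min_le_left _ _)
  have hδ4 := hδ2.trans_le (min_le_right _ _)
  set S : Set ℂ := {ζ | |ζ.im| < δ'} with hS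
  have hSo : IsOpen S := isOpen_lt Complex.continuous_im.abs continuous_const
  have h0S : (0 : ℂ) ∈ S := by simpa [hS] using hδ.trans hδ1
  have hzS : ∀ ζ ∈ S, |(ζ - z).im| < B := by
    intro ζ hζ
    have h1 := abs_sub ζ.im z.im
    have h2 : |ζ.im| < δ' := hζ
    rw [Complex.sub_im]
    linarith
  have hπS : ∀ ζ ∈ S, |ζ.im| < Real.pi := fun ζ hζ =>
    (show |ζ.im| < δ' from hζ).trans (by linarith)
  -- `N` vanishes at the pole of `geomFun`, so `N * geomFun` extends to a holomorphic function `Q`,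
  -- written as a quotient of difference quotients
  set N : ℂ → ℂ := fun ζ =>
    e (ζ - z) - e (-z) * (2 * Complex.exp ζ / (1 + Complex.exp ζ)) with hN
  have hN0 : N 0 = 0 := by simp [hN]; norm_num
  have hNd : DifferentiableOn ℂ N S := by
    intro ζ hζ
    have d1 : DifferentiableAt ℂ (fun ζ => e (ζ - z)) ζ :=
      (h.differentiableAt _ (hzS ζ hζ)).comp ζ (differentiableAt_id.sub_const z)
    exact (d1.sub (((Complex.differentiableAt_exp.const_mul 2).div
      (Complex.differentiableAt_exp.const_add 1)
      (one_add_exp_ne_zero_of_abs_im_lt (hπS ζ hζ))).const_mul _)).differentiableWithinAt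
  set D : ℂ → ℂ := fun ζ => 1 - Complex.exp ζ with hD
  have hDd : Differentiable ℂ D := Complex.differentiable_exp.const_sub 1
  have hD0 : D 0 = 0 := by simp [hD]
  have hDS : ∀ ζ ∈ S, dslope D 0 ζ ≠ 0 := by
    intro ζ hζ
    rcases eq_or_ne ζ 0 with rfl | hne
    · have : deriv D 0 = -1 := by
        rw [hD, ((Complex.hasDerivAt_exp 0).const_sub 1).deriv, Complex.exp_zero]
      rw [dslope_same, this]
      norm_num
    · rw [dslope_of_ne _ hne, slope_def_field, hD0, sub_zero, sub_zero]
      exact div_ne_zero (one_sub_exp_ne_zero_of_abs_im_lt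
        ((hπS ζ hζ).trans (by linarith)) hne) hne
  set Q : ℂ → ℂ := fun ζ => dslope N 0 ζ / dslope D 0 ζ with hQ
  have hQd : DifferentiableOn ℂ Q S :=
    ((Complex.differentiableOn_dslope (hSo.mem_nhds h0S)).2 hNd).div
      ((Complex.differentiableOn_dslope (hSo.mem_nhds h0S)).2 hDd.differentiableOn) hDS
  have hQeq : ∀ ζ ∈ S, ζ ≠ 0 → Q ζ = e (ζ - z) * geomFun ζ - e (-z) * cschFun ζ := by
    intro ζ hζ hne
    rw [cschFun_eq]
    simp only [hQ]
    rw [dslope_of_ne _ hne, dslope_of_ne _ hne, slope_def_field, slope_def_field, hD0, hN0,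
      sub_zero, sub_zero, sub_zero, div_div_div_cancel_right₀ hne, div_eq_mul_inv]
    simp only [hN, hD, geomFun]
    ring
  -- exponential decay of `Q`: directly away from the origin, by compactness near it
  have hQb : ∃ C, ∀ ζ : ℂ, |ζ.im| ≤ δ → ‖Q ζ‖ ≤ C * Real.exp (-(min a 1) * |ζ.re|) := by
    have ha1 : 0 < min a 1 := lt_min ha one_pos
    obtain ⟨C, hC, hCb⟩ := h.exists_norm_le hM (θ := |z.im| + δ) hz
    have hcomp : IsCompact (uIcc (-1 : ℝ) 1 ×ℂ uIcc (-δ) δ) := isCompact_uIcc.reProdIm isCompact_uIcc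
    rw [uIcc_of_le (by linarith), uIcc_of_le (by linarith)] at hcomp
    obtain ⟨K, hK⟩ := hcomp.exists_bound_of_continuousOn (f := Q) (hQd.continuousOn.mono (by
      intro ζ hζ
      exact (abs_le.2 (Complex.mem_reProdIm.1 hζ).2).trans_lt hδ1))
    have hK0 : 0 ≤ K := (norm_nonneg _).trans (hK 0 (by
      rw [Complex.mem_reProdIm]; exact ⟨by simp, by simp [hδ.le]⟩))
    refine ⟨K * Real.exp (min a 1) + (2 * C * Real.exp (a * |z.re|) + ‖e (-z)‖ * 4),
      fun ζ hζ => ?_⟩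
    have hX := Real.exp_pos (-(min a 1) * |ζ.re|)
    have hP := Real.exp_pos (min a 1)
    have hR := Real.exp_pos (a * |z.re|)
    rcases le_total |ζ.re| 1 with hre | hre
    · have h1 := hK ζ (Complex.mem_reProdIm.2 ⟨abs_le.1 hre, abs_le.1 hζ⟩)
      have h2 : 1 ≤ Real.exp (min a 1) * Real.exp (-(min a 1) * |ζ.re|) := by
        rw [← Real.exp_add]
        exact Real.one_le_exp (by nlinarith)
      calc ‖Q ζ‖ ≤ K * (Real.exp (min a 1) * Real.exp (-(min a 1) * |ζ.re|)) :=
            h1.trans (le_mul_of_one_le_right hK0 h2)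
        _ = K * Real.exp (min a 1) * Real.exp (-(min a 1) * |ζ.re|) := by ring
        _ ≤ _ := by
          gcongr
          exact le_add_of_nonneg_right (by positivity)
    · have hne : ζ ≠ 0 := by
        rintro rfl
        norm_num at hre
      obtain ⟨g1, -⟩ := norm_geomFun_le_of_one_le_abs_re hre
      obtain ⟨g2, g3⟩ := norm_geomFun_le_of_one_le_abs_re (u := 2 * ζ) (by
        simp only [Complex.mul_re, Complex.re_ofNat, Complex.im_ofNat, zero_mul, sub_zero, abs_mul,
          Nat.abs_ofNat]
        linarith)
      have g4 := norm_cschFun_le_of_norm_geomFun_le g2 g3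
      have g5 := hCb (ζ - z) (by
        rw [Complex.sub_im]
        have := abs_sub ζ.im z.im
        linarith)
      rw [hQeq ζ (hζ.trans_lt hδ1) hne]
      have b1 : Real.exp (-a * |(ζ - z).re|) ≤
          Real.exp (a * |z.re|) * Real.exp (-(min a 1) * |ζ.re|) := by
        rw [← Real.exp_add]
        refine Real.exp_le_exp.2 ?_
        have h1 := abs_sub_abs_le_abs_sub ζ.re z.re
        have h2 := min_le_left a 1
        have h3 := abs_nonneg ζ.re
        rw [Complex.sub_re]
        nlinarith
      have b2 : Real.exp (-1 * |ζ.re|) ≤ Real.exp (-(min a 1) * |ζ.re|) := by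
        refine Real.exp_le_exp.2 ?_
        have h2 := min_le_right a 1
        have h3 := abs_nonneg ζ.re
        nlinarith
      calc _ ≤ ‖e (ζ - z)‖ * ‖geomFun ζ‖ + ‖e (-z)‖ * ‖cschFun ζ‖ := by
            refine (norm_sub_le _ _).trans ?_
            rw [norm_mul, norm_mul]
        _ ≤ C * (Real.exp (a * |z.re|) * Real.exp (-(min a 1) * |ζ.re|)) * 2 +
            ‖e (-z)‖ * (2 * 2 * Real.exp (-(min a 1) * |ζ.re|)) := by
          gcongr
          · exact g5.trans (by gcongr)
          · exact g4.trans (by gcongr)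
        _ = (2 * C * Real.exp (a * |z.re|) + ‖e (-z)‖ * 4) *
            Real.exp (-(min a 1) * |ζ.re|) := by ring
        _ ≤ _ := by
          exact mul_le_mul_of_nonneg_right
            (le_add_of_nonneg_left (mul_nonneg hK0 hP.le)) hX.le
  obtain ⟨C, hC⟩ := hQb
  have hmem : ∀ y ∈ uIcc δ (-δ), |y| ≤ δ := by
    intro y hy
    rw [uIcc_of_ge (by linarith)] at hy
    exact abs_le.2 hy
  have hshift := integral_horizontal_eq_of_decay (f := Q) (c := δ) (d := -δ) (lt_min ha one_pos)
    (fun ζ hζ => hQd.differentiableAt (hSo.mem_nhds ((hmem _ hζ).trans_lt hδ1)))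
    (fun ζ hζ => hC ζ (hmem _ hζ))
  have hline : ∀ s : ℝ, |s| = δ → ∀ x : ℝ, Q (x + s * Complex.I) =
      e (x + s * Complex.I - z) * geomFun (x + s * Complex.I) -
        e (-z) * cschFun (x + s * Complex.I) := by
    intro s hs x
    refine hQeq _ (by simpa [hS, hs] using hδ1) fun h0 => ?_
    have := congrArg Complex.im h0
    simp only [Complex.add_im, Complex.ofReal_im, Complex.mul_im, Complex.ofReal_re, Complex.I_im,
      mul_one, Complex.I_re, mul_zero, add_zero, zero_add, Complex.zero_im] at this
    rw [this, abs_zero] at hs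
    exact hδ.ne hs
  have c1 := integral_cschFun_upper hδ hδ'
  have c2 := integral_cschFun_lower hδ hδ'
  have hne : (Real.pi : ℂ) * Complex.I ≠ 0 :=
    mul_ne_zero (Complex.ofReal_ne_zero.2 hpi.ne') Complex.I_ne_zero
  -- a nonzero Bochner integral forces integrability
  have i1 : Integrable fun x : ℝ => cschFun (x + δ * Complex.I) := by
    by_contra hc
    exact hne (c1.symm.trans (integral_undef hc))
  have i2 : Integrable fun x : ℝ => cschFun (x + ((-δ : ℝ) : ℂ) * Complex.I) := by
    by_contra hc
    exact neg_ne_zero.2 hne (c2.symm.trans (integral_undef hc))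
  simp only [hline δ (abs_of_pos hδ), hline (-δ) (by rw [abs_neg, abs_of_pos hδ])] at hshift
  rw [integral_sub h₁ (i1.const_mul _), integral_sub h₂ (i2.const_mul _), integral_const_mul,
    integral_const_mul, c1, c2] at hshift
  rw [laplaceLine, laplaceLine]
  linear_combination hshift

theorem exists_laplaceDominated_geomFun (hM : IsWeightSequence M) (h : HasKernelBound M B a e)
    (ρ : ℝ) :
    ∀ θ < 2 * Real.pi / 2, ∀ η < B, ∃ C, LaplaceDominated e geomFun Real.pi a θ η ρ C := by
  intro θ hθ η hη
  rw [mul_div_cancel_left₀ _ two_ne_zero] at hθ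
  obtain ⟨C, hC, H⟩ := h.exists_norm_le hM hη
  obtain ⟨K, hK, HK⟩ := exists_norm_geomFun_le hθ
  refine ⟨C * K, fun ζ z h1 h2 _ => ?_⟩
  have h3 := H (ζ - z) (by rwa [Complex.sub_im, abs_sub_comm])
  rw [norm_mul, mul_right_comm, ← Complex.sub_re]
  exact mul_le_mul h3 (HK ζ h1) (norm_nonneg _) ((norm_nonneg _).trans h3)

/-- The kernel is recovered from the difference of two branches of its Laplace transform of
`1 / (1 - u)`. -/
theorem laplaceGlue_geomFun_sub {ω : ℝ} (hM : IsWeightSequence M) (ha : 0 < a) (hω : 0 < ω)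
    (h : HasKernelBound M (ω * Real.pi / 2) a e) {z : ℂ} (hz : z ∈ sector 0 ω) :
    laplaceGlue e geomFun Real.pi (2 / (2 + ω)) z -
      laplaceGlue e geomFun Real.pi (2 / (2 + ω)) (z + 2 * Real.pi * Complex.I) =
      2 * Real.pi * Complex.I * e (-z) := by
  have hpi := Real.pi_pos
  have hz' : |z.im| < ω * Real.pi / 2 := by simpa [sector] using hz
  obtain ⟨δ, hδ, hδ'⟩ := exists_between (lt_min (by positivity : (0 : ℝ) < Real.pi / 2)
    (sub_pos.2 hz'))
  have hδ1 := hδ'.trans_le (min_le_left _ _)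
  have hδ2 := hδ'.trans_le (min_le_right _ _)
  have hD := exists_laplaceDominated_geomFun hM h
  have him : (z + 2 * Real.pi * Complex.I).im = z.im + 2 * Real.pi := by simp
  -- the direction `δ` is admissible for `z`, and `2π - δ`, that is `-δ` up to the period, for the
  -- other branch
  have t1 : |δ - Real.pi| < 2 * Real.pi / 2 := abs_lt.2 ⟨by linarith, by linarith⟩
  have t2 : |2 * Real.pi - δ - Real.pi| < 2 * Real.pi / 2 := abs_lt.2 ⟨by linarith, by linarith⟩
  have z1 : |z.im - δ| < ω * Real.pi / 2 := by
    have := abs_sub z.im δ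
    rw [abs_of_pos hδ] at this
    linarith
  have z2 : |(z + 2 * Real.pi * Complex.I).im - (2 * Real.pi - δ)| < ω * Real.pi / 2 := by
    rw [him, show z.im + 2 * Real.pi - (2 * Real.pi - δ) = z.im + δ by ring]
    have := abs_add_le z.im δ
    rw [abs_of_pos hδ] at this
    linarith
  have hper : ∀ x : ℝ, e (x + ((2 * Real.pi - δ : ℝ) : ℂ) * Complex.I -
        (z + 2 * Real.pi * Complex.I)) * geomFun (x + ((2 * Real.pi - δ : ℝ) : ℂ) * Complex.I) =
      e (x + ((-δ : ℝ) : ℂ) * Complex.I - z) * geomFun (x + ((-δ : ℝ) : ℂ) * Complex.I) := by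
    intro x
    rw [show (x : ℂ) + ((2 * Real.pi - δ : ℝ) : ℂ) * Complex.I =
      x + ((-δ : ℝ) : ℂ) * Complex.I + 2 * Real.pi * Complex.I by push_cast; ring,
      geomFun_add_two_pi, add_sub_add_right_eq_sub]
  have hs : 2 / (2 + ω) * (2 * Real.pi / 2 + ω * Real.pi / 2) = 2 * Real.pi / 2 := by field_simp
  have i1 := integrable_of_laplaceDominated ha h.differentiableAt
    (fun _ => differentiableAt_geomFun) (hD z.re) t1 z1 le_rfl
  have i2 := integrable_of_laplaceDominated ha h.differentiableAt
    (fun _ => differentiableAt_geomFun) (hD (z + 2 * Real.pi * Complex.I).re) t2 z2 le_rfl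
  simp only [hper] at i2
  rw [laplaceGlue_eq_laplaceLine ha (by positivity) (by positivity) hs h.differentiableAt
      (fun _ => differentiableAt_geomFun) (hD z.re) t1 z1 le_rfl,
    laplaceGlue_eq_laplaceLine ha (by positivity) (by positivity) hs h.differentiableAt
      (fun _ => differentiableAt_geomFun) (hD (z + 2 * Real.pi * Complex.I).re) t2 z2 le_rfl,
    show laplaceLine e geomFun (2 * Real.pi - δ) (z + 2 * Real.pi * Complex.I) =
      laplaceLine e geomFun (-δ) z by simp only [laplaceLine, hper],
    laplaceLine_geomFun_sub hM ha h hδ hδ1 (by linarith) i1 i2]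

/-- The Laplace transform of `1 / (1 - u)` exists on the whole sector. -/
theorem isLaplaceTransform_geomFun {ω : ℝ} (hM : IsWeightSequence M) (ha : 0 < a) (hω : 0 < ω)
    (h : HasKernelBound M (ω * Real.pi / 2) a e) :
    IsLaplaceTransform ω e geomFun Real.pi 2 (sector Real.pi (2 + ω))
      (laplaceGlue e geomFun Real.pi (2 / (2 + ω))) :=
  isLaplaceTransform_sector two_pos hω ha h.differentiableAt
    (fun _ => differentiableAt_geomFun) (exists_laplaceDominated_geomFun hM h)

end Jump

/-! ### Kernels with vanishing moments -/

section Uniqueness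

variable {M : ℕ → ℝ} {e e' E E' D : ℂ → ℂ} {B a ω : ℝ}

/-- A kernel need not decay at the origin; multiplication by `z` makes it do so, and shifts the
moments by one. -/
theorem IsPreKernel.hasKernelBound_mul_exp (h : IsPreKernel M e E) (hM : IsWeightSequence M) :
    HasKernelBound M (growthOrder M * Real.pi / 2) 1 (fun w => e w * Complex.exp w) where
  differentiableAt w hw := by
    refine DifferentiableAt.mul ?_ Complex.differentiableAt_exp
    exact h.holomorphic.differentiableAt ((isOpen_sector _ _).mem_nhds
      (by simpa only [sector, mem_ofPred_eq, sub_zero] using hw))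
  bound θ hθ := by
    obtain ⟨c, hc, k, hk, H⟩ := h.exists_bound hM hθ
    have hM2 := hM.pos 2
    refine ⟨c * (M 2 * k ^ 2 + 1), by positivity, k, hk, fun w hw => ?_⟩
    rw [norm_mul, Complex.norm_exp]
    have hH := H w hw
    have hY1 := hM.pow_mul_exp_neg_le (t := Real.exp w.re / k) (by positivity) 2
    have hZ : Real.exp (-assocFun M (Real.exp w.re / k)) ≤ 1 :=
      Real.exp_le_one_iff.2 (neg_nonpos.2 (hM.assocFun_nonneg (by positivity)))
    have hY : 0 < Real.exp (-assocFun M (Real.exp w.re / k)) := Real.exp_pos _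
    set Y := Real.exp (-assocFun M (Real.exp w.re / k))
    have hX := Real.exp_pos (-1 * |w.re|)
    have key : Y * Real.exp w.re ≤ (M 2 * k ^ 2 + 1) * Real.exp (-1 * |w.re|) := by
      rcases le_total 0 w.re with hre | hre
      · rw [abs_of_nonneg hre, neg_one_mul]
        rw [abs_of_nonneg hre, neg_one_mul] at hX
        rw [div_pow, div_mul_eq_mul_div, div_le_iff₀ (by positivity)] at hY1
        have h1 : Real.exp w.re * Real.exp (-w.re) = 1 := by
          rw [← Real.exp_add, add_neg_cancel, Real.exp_zero]
        calc Y * Real.exp w.re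
            = Y * Real.exp w.re * (Real.exp w.re * Real.exp (-w.re)) := by rw [h1, mul_one]
          _ = Real.exp w.re ^ 2 * Y * Real.exp (-w.re) := by ring
          _ ≤ _ := mul_le_mul_of_nonneg_right (by linarith) hX.le
      · rw [abs_of_nonpos hre, neg_one_mul, neg_neg]
        exact mul_le_mul_of_nonneg_right (hZ.trans (le_add_of_nonneg_left (by positivity)))
          (Real.exp_pos _).le
    calc ‖e w‖ * Real.exp w.re ≤ c * (Y * Y) * Real.exp w.re := by gcongr
      _ = c * (Y * Real.exp w.re) * Y := by ring
      _ ≤ c * ((M 2 * k ^ 2 + 1) * Real.exp (-1 * |w.re|)) * Y := by gcongr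
      _ = _ := by ring

theorem HasKernelBound.sub (h : HasKernelBound M B a e) (h' : HasKernelBound M B a e')
    (hM : IsWeightSequence M) : HasKernelBound M B a (fun w => e w - e' w) where
  differentiableAt w hw := (h.differentiableAt w hw).sub (h'.differentiableAt w hw)
  bound θ hθ := by
    obtain ⟨C, hC, k, hk, H⟩ := h.bound θ hθ
    obtain ⟨C', hC', k', hk', H'⟩ := h'.bound θ hθ
    have hm : 0 < max k k' := lt_max_of_lt_left hk
    have key : ∀ l, 0 < l → l ≤ max k k' → ∀ w : ℂ,
        Real.exp (-assocFun M (Real.exp w.re / l)) ≤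
          Real.exp (-assocFun M (Real.exp w.re / max k k')) := by
      intro l hl hl' w
      refine Real.exp_le_exp.2 (neg_le_neg (hM.assocFun_mono (by positivity) ?_))
      gcongr
    refine ⟨C + C', by positivity, max k k', hm, fun w hw => ?_⟩
    rw [add_mul]
    refine (norm_sub_le _ _).trans (add_le_add ((H w hw).trans ?_) ((H' w hw).trans ?_))
    · have := key k hk (le_max_left _ _) w
      gcongr
    · have := key k' hk' (le_max_right _ _) w
      gcongr

/-- If all moments of `D` vanish, its Laplace transform of `1 / (1 - u)` has a null asymptotic
expansion: the first `N` terms of the geometric series contribute nothing, for every `N`. -/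
theorem exists_norm_laplaceGlue_geomFun_le (hM : IsWeightSequence M) (ha : 0 < a) (hω : 0 < ω)
    (h : HasKernelBound M (ω * Real.pi / 2) a D)
    (hmom : ∀ n : ℕ, ∫ x : ℝ, Complex.exp (n * x) * D x = 0) {θ : ℝ} (hθ : θ < Real.pi) :
    ∃ C > 0, ∃ k > 0, ∀ z : ℂ, |z.im - Real.pi| ≤ θ →
      ‖laplaceGlue D geomFun Real.pi (2 / (2 + ω)) z‖ ≤
        C * Real.exp (-assocFun M (Real.exp (-z.re) / k)) := by
  have hpi := Real.pi_pos
  have hB : 0 < ω * Real.pi / 2 := by positivity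
  obtain ⟨K, hK, HK⟩ := exists_norm_geomFun_le hθ
  obtain ⟨C, hC, k, hk, H⟩ := h.bound 0 hB
  have hI := integrable_exp_neg_mul_abs ha 0
  have hI0 : 0 ≤ ∫ x : ℝ, Real.exp (-a * |x - 0|) := integral_nonneg fun x => (Real.exp_pos _).le
  refine ⟨K * C * (1 + ∫ x : ℝ, Real.exp (-a * |x - 0|)), by positivity, k, hk, fun z hz => ?_⟩
  have him : ∀ x : ℝ, ((x : ℂ) + z).im = z.im := by simp
  have hg0 : ∀ x : ℝ, 1 - Complex.exp (x + z) ≠ 0 := fun x =>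
    one_sub_exp_ne_zero (by rw [him]; exact hz.trans_lt hθ)
  have hgc : Continuous fun x : ℝ => geomFun (x + z) := by
    unfold geomFun
    exact Continuous.inv₀ (by fun_prop) hg0
  have hintD : ∀ N : ℕ, Integrable fun x : ℝ => Complex.exp (N * x) * D x := fun N =>
    h.integrable_exp_mul hB ha hM (by simp)
  have hint1 : ∀ N : ℕ, Integrable fun x : ℝ => Complex.exp (N * (x + z)) * D x := by
    intro N
    refine ((hintD N).const_mul (Complex.exp (N * z))).congr (Eventually.of_forall fun x => ?_)
    simp only [mul_add, Complex.exp_add]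
    ring
  have hint2 : ∀ N : ℕ, Integrable fun x : ℝ => Complex.exp (N * (x + z)) * D x * geomFun (x + z) :=
    fun N => (hint1 N).mul_bdd (c := K) hgc.aestronglyMeasurable
      (Eventually.of_forall fun x => HK _ (by rwa [him]))
  -- splitting off one more term of the geometric series costs nothing, as its moment is zero
  have hrep : ∀ N : ℕ, laplaceGlue D geomFun Real.pi (2 / (2 + ω)) z =
      ∫ x : ℝ, Complex.exp (N * (x + z)) * D x * geomFun (x + z) := by
    intro N
    induction N with
    | zero =>
      rw [laplaceGlue_eq_laplaceLine (A := 2 * Real.pi / 2) (B := ω * Real.pi / 2) (τ := z.im) ha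
        (by positivity) hB (by field_simp) h.differentiableAt
        (fun _ => differentiableAt_geomFun) (exists_laplaceDominated_geomFun hM h z.re)
        (by rw [mul_div_cancel_left₀ _ two_ne_zero]; exact hz.trans_lt hθ)
        (by rw [sub_self, abs_zero]; exact hB) le_rfl, laplaceLine,
        ← integral_add_right_eq_self (μ := volume) _ z.re]
      congr 1
      ext x
      have e1 : ((x + z.re : ℝ) : ℂ) + z.im * Complex.I = x + z := by
        conv_rhs => rw [← Complex.re_add_im z]
        push_cast
        ring
      rw [e1, add_sub_cancel_right]
      simp
    | succ N ih =>
      have h0 : ∫ x : ℝ, Complex.exp (N * (x + z)) * D x = 0 := by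
        rw [← mul_zero (Complex.exp (N * z)), ← hmom N, ← integral_const_mul]
        congr 1
        ext x
        rw [mul_add, Complex.exp_add]
        ring
      rw [ih, ← sub_eq_zero, ← integral_sub (hint2 N) (hint2 (N + 1)), ← h0]
      congr 1
      ext x
      have e2 : (1 - Complex.exp (x + z)) * geomFun (x + z) = 1 := mul_inv_cancel₀ (hg0 x)
      push_cast
      rw [add_mul, one_mul, Complex.exp_add]
      linear_combination Complex.exp (N * (x + z)) * D x * e2
  have hbound : ∀ N : ℕ, ‖laplaceGlue D geomFun Real.pi (2 / (2 + ω)) z‖ *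
      (Real.exp (-z.re) / k) ^ N ≤ K * C * (1 + ∫ x : ℝ, Real.exp (-a * |x - 0|)) * M N := by
    intro N
    have hMN := hM.pos N
    have hbd : ∀ x : ℝ, ‖Complex.exp (N * (x + z)) * D x * geomFun (x + z)‖ ≤
        K * C * M N * (k * Real.exp z.re) ^ N * Real.exp (-a * |x - 0|) := by
      intro x
      have b1 := H x (by simp)
      have b2 := hM.pow_mul_exp_neg_le (t := Real.exp x / k) (by positivity) N
      rw [Complex.ofReal_re] at b1
      have b3 : ‖Complex.exp (N * (x + z))‖ = Real.exp x ^ N * Real.exp z.re ^ N := by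
        rw [Complex.norm_exp, ← mul_pow, ← Real.exp_add, ← Real.exp_nat_mul]
        simp
      rw [norm_mul, norm_mul, b3, sub_zero]
      have b4 := HK (x + z) (by rwa [him])
      rw [div_pow, div_mul_eq_mul_div, div_le_iff₀ (by positivity)] at b2
      calc _ ≤ Real.exp x ^ N * Real.exp z.re ^ N * (C * (Real.exp (-a * |x|) *
              Real.exp (-assocFun M (Real.exp x / k)))) * K := by gcongr
        _ = K * C * Real.exp z.re ^ N * (Real.exp x ^ N *
              Real.exp (-assocFun M (Real.exp x / k))) * Real.exp (-a * |x|) := by ring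
        _ ≤ K * C * Real.exp z.re ^ N * (M N * k ^ N) * Real.exp (-a * |x|) := by gcongr
        _ = _ := by ring
    have h1 := norm_integral_le_of_norm_le (hI.const_mul _) (Eventually.of_forall hbd)
    rw [← hrep N, integral_const_mul] at h1
    have e3 : (k * Real.exp z.re) ^ N * (Real.exp (-z.re) / k) ^ N = 1 := by
      rw [← mul_pow, Real.exp_neg]
      have := (Real.exp_pos z.re).ne'
      field_simp
      simp
    calc _ ≤ K * C * M N * (k * Real.exp z.re) ^ N * (∫ x : ℝ, Real.exp (-a * |x - 0|)) *
          (Real.exp (-z.re) / k) ^ N := by gcongr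
      _ = K * C * (∫ x : ℝ, Real.exp (-a * |x - 0|)) * M N *
          ((k * Real.exp z.re) ^ N * (Real.exp (-z.re) / k) ^ N) := by ring
      _ ≤ _ := by
        rw [e3, mul_one]
        gcongr
        linarith
  rcases (norm_nonneg (laplaceGlue D geomFun Real.pi (2 / (2 + ω)) z)).eq_or_lt with h0 | h0
  · rw [← h0]; positivity
  · have h2 := hM.exp_assocFun_le (t := Real.exp (-z.re) / k) (by positivity) fun N => by
      have h3 := hbound N
      rw [← le_div_iff₀' h0, mul_div_right_comm, ← div_le_iff₀ (hM.pos N)] at h3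
      exact h3
    rw [Real.exp_neg, ← div_eq_mul_inv, le_div_iff₀ (Real.exp_pos _), mul_comm]
    exact (le_div_iff₀ h0).1 h2

end Uniqueness

/-! ### A Watson lemma -/

section Watson

variable {M : ℕ → ℝ} {e e' E E' D g : ℂ → ℂ} {a ω : ℝ}

/-- Decay of order `exp (-c x^s)` with `s > 1` beats every power of `exp x`. -/
theorem superpolynomialDecay_exp_of_le {F : ℝ → ℝ} {C c s : ℝ} (hs : 1 < s) (hc : 0 < c)
    (hF0 : ∀ x, 0 ≤ F x) (hF : ∀ᶠ x in atTop, F x ≤ C * Real.exp (-(c * x ^ s))) :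
    Asymptotics.SuperpolynomialDecay atTop Real.exp F := by
  intro n
  have h1 : Tendsto (fun x : ℝ => c * x ^ (s - 1) - n) atTop atTop :=
    tendsto_atTop_add_const_right _ _
      ((tendsto_rpow_atTop (sub_pos.2 hs)).const_mul_atTop hc)
  have h2 : Tendsto (fun x : ℝ => C * Real.exp (-(x * (c * x ^ (s - 1) - n)))) atTop (𝓝 0) := by
    have := (Real.tendsto_exp_neg_atTop_nhds_zero.comp (tendsto_id.atTop_mul_atTop₀ h1)).const_mul C
    simpa using this
  refine squeeze_zero' (Eventually.of_forall fun x => by have := hF0 x; positivity) ?_ h2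
  filter_upwards [hF, eventually_gt_atTop 0] with x hx hx0
  calc Real.exp x ^ n * F x ≤ Real.exp x ^ n * (C * Real.exp (-(c * x ^ s))) := by gcongr
    _ = C * Real.exp (-(x * (c * x ^ (s - 1) - n))) := by
      rw [← Real.exp_nat_mul, mul_left_comm, ← Real.exp_add]
      congr 2
      have : x ^ s = x * x ^ (s - 1) := by
        rw [← Real.rpow_one_add' hx0.le (by linarith)]
        ring_nf
      rw [this]
      ring

/-- A Watson lemma: a function that is flat of order `exp (-ω_M)` at the origin in all sectors of
opening less than `2π` vanishes, provided the index of `M` is less than `2`. A sector of opening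
`γπ`, with `γ` between the index and `2`, is mapped to a half-plane on which the decay is
superexponential. -/
theorem eqOn_zero_of_flat (hM : IsWeightSequence M) (hω : 0 < ω) (hω2 : ω < 2)
    (hr : Tendsto (fun p : ℕ => Real.log (M (p + 1) / M p) / Real.log p) atTop (𝓝 ω))
    {A : ℝ} (hA : 2 ≤ A) (hg : DifferentiableOn ℂ g (sector Real.pi A))
    (hb : ∀ θ < Real.pi, ∃ C > 0, ∃ k > 0, ∀ z : ℂ, |z.im - Real.pi| ≤ θ →
      ‖g z‖ ≤ C * Real.exp (-assocFun M (Real.exp (-z.re) / k))) :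
    EqOn g 0 (sector Real.pi A) := by
  have hpi := Real.pi_pos
  obtain ⟨γ, hγ1, hγ2⟩ := exists_between hω2
  -- the decay exponent `γ / γ'` on the half-plane exceeds `1`
  obtain ⟨γ', hγ1', hγ2'⟩ := exists_between hγ1
  have hγ0 : 0 < γ := hω.trans hγ1
  have hγ0' : 0 < γ' := hω.trans hγ1'
  have hθ : γ * Real.pi / 2 < Real.pi := by nlinarith
  obtain ⟨C, hC, k, hk, H⟩ := hb _ hθ
  -- `φ` maps the right half-plane into the sector of opening `γπ` about the direction `π`, with
  -- infinity going to the origin; the shift by `1` keeps the boundary away from the branch point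
  set φ : ℂ → ℂ := fun ζ => Real.pi * Complex.I - γ * Complex.log (1 + ζ) with hφ
  have hφre : ∀ ζ, (φ ζ).re = -(γ * Real.log ‖1 + ζ‖) := fun ζ => by
    simp [hφ, Complex.log_re]
  have hφim : ∀ ζ, (φ ζ).im - Real.pi = -(γ * Complex.arg (1 + ζ)) := fun ζ => by
    simp [hφ, Complex.log_im]
  have hre : ∀ ζ : ℂ, 0 ≤ ζ.re → 0 < (1 + ζ).re := fun ζ hζ => by
    simp only [Complex.add_re, Complex.one_re]; linarith
  have harg : ∀ ζ : ℂ, 0 ≤ ζ.re → |(φ ζ).im - Real.pi| ≤ γ * Real.pi / 2 := by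
    intro ζ hζ
    rw [hφim, abs_neg, abs_mul, abs_of_pos hγ0]
    have := Complex.abs_arg_le_pi_div_two_iff.2 (hre ζ hζ).le
    nlinarith
  have hsec : ∀ ζ : ℂ, 0 ≤ ζ.re → φ ζ ∈ sector Real.pi A := by
    intro ζ hζ
    have := harg ζ hζ
    simp only [sector, mem_ofPred_eq]
    nlinarith
  have hFd : ∀ ζ : ℂ, 0 ≤ ζ.re → DifferentiableAt ℂ (fun ζ => g (φ ζ)) ζ := by
    intro ζ hζ
    have h1 : DifferentiableAt ℂ g (φ ζ) :=
      hg.differentiableAt ((isOpen_sector _ _).mem_nhds (hsec ζ hζ))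
    have h2 : DifferentiableAt ℂ φ ζ := by
      refine DifferentiableAt.const_sub (DifferentiableAt.const_mul ?_ _) _
      exact (differentiableAt_id.const_add 1).clog (Or.inl (hre ζ hζ))
    exact h1.comp ζ h2
  have hFC : ∀ ζ : ℂ, 0 ≤ ζ.re → ‖g (φ ζ)‖ ≤ C := by
    intro ζ hζ
    refine (H _ (harg ζ hζ)).trans (mul_le_of_le_one_right hC.le ?_)
    exact Real.exp_le_one_iff.2 (neg_nonpos.2 (hM.assocFun_nonneg (by positivity)))
  have hzero : EqOn (fun ζ => g (φ ζ)) 0 {ζ : ℂ | 0 ≤ ζ.re} := by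
    refine PhragmenLindelof.eq_zero_on_right_half_plane_of_superexponential_decay ?_ ?_ ?_ ?_
    · refine DifferentiableOn.diffContOnCl fun ζ hζ => ?_
      rw [Complex.closure_setOfPred_lt_re] at hζ
      exact (hFd ζ hζ).differentiableWithinAt
    · refine ⟨1, one_lt_two, 0, Asymptotics.IsBigO.of_bound C ?_⟩
      filter_upwards [mem_inf_of_right (mem_principal_self _)] with ζ hζ
      simpa using hFC ζ (le_of_lt hζ)
    · refine superpolynomialDecay_exp_of_le (C := C * Real.exp 1) (s := γ * (1 / γ'))
        (c := (1 / (k * Real.exp 1)) ^ (1 / γ')) ?_ (by positivity) (fun _ => norm_nonneg _) ?_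
      · rw [mul_one_div, one_lt_div hγ0']
        exact hγ2'
      · have h1 : Tendsto (fun x : ℝ => x ^ γ / k) atTop atTop :=
          (tendsto_rpow_atTop hγ0).atTop_div_const hk
        filter_upwards [h1.eventually (eventually_rpow_le_assocFun hM hω hγ1' hr),
          eventually_gt_atTop 0] with x hx hx0
        have h2 := H (φ x) (harg x (by simpa using hx0.le))
        have h3 : x ^ γ / k ≤ Real.exp (-(φ x).re) / k := by
          rw [hφre, neg_neg, show (1 : ℂ) + x = ((1 + x : ℝ) : ℂ) by push_cast; rfl,
            Complex.norm_real, Real.norm_of_nonneg (by linarith), mul_comm,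
            ← Real.rpow_def_of_pos (by linarith)]
          gcongr
          linarith
        have h4 := hM.assocFun_mono (by positivity) h3
        refine h2.trans ?_
        rw [mul_assoc, ← Real.exp_add]
        refine mul_le_mul_of_nonneg_left (Real.exp_le_exp.2 ?_) hC.le
        have h5 : (x ^ γ / k / Real.exp 1) ^ (1 / γ') =
            (1 / (k * Real.exp 1)) ^ (1 / γ') * x ^ (γ * (1 / γ')) := by
          rw [Real.rpow_mul hx0.le, ← Real.mul_rpow (by positivity) (by positivity)]
          congr 1
          field_simp
        rw [h5] at hx
        linarith
    · exact ⟨C, fun x => hFC _ (by simp)⟩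
  have hz₀ : φ 1 ∈ sector Real.pi A := hsec 1 (by simp)
  refine (hg.analyticOnNhd (isOpen_sector _ _)).eqOn_zero_of_preconnected_of_eventuallyEq_zero
    (convex_sector _ _).isPreconnected hz₀ ?_
  -- near `φ 1` the map `φ` has an explicit right inverse
  have hγc : (γ : ℂ) ≠ 0 := Complex.ofReal_ne_zero.2 hγ0.ne'
  set ψ : ℂ → ℂ := fun w => Complex.exp ((Real.pi * Complex.I - w) / γ) - 1 with hψ
  have hψc : Continuous ψ := by fun_prop
  have hψ1 : ψ (φ 1) = 1 := by
    simp only [hψ, hφ]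
    rw [sub_sub_cancel, mul_div_cancel_left₀ _ hγc, Complex.exp_log (by norm_num)]
    ring
  have e1 : ∀ᶠ w in 𝓝 (φ 1), 0 < (ψ w).re := by
    refine (Complex.continuous_re.comp hψc).continuousAt.eventually (lt_mem_nhds ?_)
    simp [hψ1]
  have e2 : ∀ᶠ w in 𝓝 (φ 1), |((Real.pi * Complex.I - w) / γ).im| < Real.pi := by
    have hcont : Continuous fun w : ℂ => |((Real.pi * Complex.I - w) / γ).im| := by fun_prop
    refine hcont.continuousAt.eventually (gt_mem_nhds ?_)
    simp only [hφ]
    rw [sub_sub_cancel, mul_div_cancel_left₀ _ hγc, Complex.log_im]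
    norm_num
    exact hpi
  filter_upwards [e1, e2] with w h1 h2
  have h3 : φ (ψ w) = w := by
    simp only [hφ, hψ]
    rw [add_sub_cancel, Complex.log_exp (abs_lt.1 h2).1 (abs_lt.1 h2).2.le,
      mul_div_cancel₀ _ hγc, sub_sub_cancel]
  rw [← h3]
  exact hzero h1.le

/-- If all moments of `D` vanish, so does its Laplace transform of `1 / (1 - u)`, and the jump of that
transform is `D`. -/
theorem eqOn_zero_of_moments (hM : IsWeightSequence M) (hω : 0 < ω) (hω2 : ω < 2)
    (hr : Tendsto (fun p : ℕ => Real.log (M (p + 1) / M p) / Real.log p) atTop (𝓝 ω))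
    (ha : 0 < a) (h : HasKernelBound M (ω * Real.pi / 2) a D)
    (hmom : ∀ n : ℕ, ∫ x : ℝ, Complex.exp (n * x) * D x = 0) : EqOn D 0 (sector 0 ω) := by
  have hpi := Real.pi_pos
  have hzero := eqOn_zero_of_flat hM hω hω2 hr (A := 2 + ω) (by linarith)
    (isLaplaceTransform_geomFun hM ha hω h).holomorphic
    (fun θ hθ => exists_norm_laplaceGlue_geomFun_le hM ha hω h hmom hθ)
  intro z hz
  have hz' : |(-z).im| < ω * Real.pi / 2 := by simpa [sector] using hz
  have h1 := laplaceGlue_geomFun_sub hM ha hω h (z := -z) (by simpa [sector] using hz')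
  rw [abs_lt] at hz'
  have him : (-z + 2 * Real.pi * Complex.I).im = (-z).im + 2 * Real.pi := by simp
  have m1 : -z ∈ sector Real.pi (2 + ω) := by
    simp only [sector, mem_ofPred_eq]
    exact abs_lt.2 ⟨by linarith, by linarith⟩
  have m2 : -z + 2 * Real.pi * Complex.I ∈ sector Real.pi (2 + ω) := by
    simp only [sector, mem_ofPred_eq, him]
    exact abs_lt.2 ⟨by linarith, by linarith⟩
  rw [hzero m1, hzero m2, neg_neg] at h1
  have h2 : (2 * Real.pi * Complex.I : ℂ) ≠ 0 := by
    simp [hpi.ne']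
  simpa [h2] using h1.symm

/-- A kernel is determined by its moments. -/
theorem IsPreKernel.eqOn_of_momentFun_eq (h : IsPreKernel M e E) (h' : IsPreKernel M e' E')
    (hM : IsWeightSequence M) (hω : 0 < growthOrder M) (hω2 : growthOrder M < 2)
    (hr : Tendsto (fun p : ℕ => Real.log (M (p + 1) / M p) / Real.log p) atTop
      (𝓝 (growthOrder M)))
    (hm : ∀ n : ℕ, momentFun e n = momentFun e' n) : EqOn e e' (sector 0 (growthOrder M)) := by
  have hB : 0 < growthOrder M * Real.pi / 2 := by have := Real.pi_pos; positivity
  have k := h.hasKernelBound_mul_exp hM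
  have k' := h'.hasKernelBound_mul_exp hM
  have hz := eqOn_zero_of_moments hM hω hω2 hr one_pos (k.sub k' hM) fun n => by
    have i := k.integrable_exp_mul hB one_pos hM (lam := n) (by simp)
    have i' := k'.integrable_exp_mul hB one_pos hM (lam := n) (by simp)
    have h0 := hm (n + 1)
    rw [momentFun_eq_integral, momentFun_eq_integral, ← sub_eq_zero] at h0
    have hx : ∀ (u : ℂ → ℂ) (x : ℝ), Complex.exp (((n + 1 : ℕ) : ℂ) * x) * u x =
        Complex.exp (n * x) * (u x * Complex.exp x) := by
      intro u x
      push_cast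
      rw [add_mul, one_mul, Complex.exp_add]
      ring
    simp only [hx] at h0
    rw [← integral_sub i i'] at h0
    simpa only [mul_sub] using h0
  intro z hzs
  have h1 : (e z - e' z) * Complex.exp z = 0 := by
    rw [sub_mul]; exact hz hzs
  exact sub_eq_zero.1 ((mul_eq_zero.1 h1).resolve_right (Complex.exp_ne_zero z))

end Watson

/-! ### Strong kernels -/

/-- A power bound at the origin, uniform on `U`, gives the integrability condition of kernels. -/
theorem lintegral_iSup_enorm_div_lt_top {U : Set ℂ} {F : ℂ → ℝ → ℂ} {K a : ℝ} (ha : 0 < a)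
    (h : ∀ z ∈ U, ∀ t ∈ Ioc (0 : ℝ) 1, ‖F z t‖ ≤ K * t ^ a) :
    ∫⁻ t in Ioc (0 : ℝ) 1, (⨆ z ∈ U, ‖F z t‖ₑ) / ENNReal.ofReal t < ⊤ := by
  have hI : IntegrableOn (fun t : ℝ => K * t ^ (a - 1)) (Ioc 0 1) := by
    rw [← intervalIntegrable_iff_integrableOn_Ioc_of_le zero_le_one]
    exact (intervalIntegral.intervalIntegrable_rpow' (by linarith)).const_mul K
  refine lt_of_le_of_lt (setLIntegral_mono' measurableSet_Ioc fun t ht => ?_) hI.lintegral_lt_top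
  have e1 : K * t ^ (a - 1) = K * t ^ a / t := by
    rw [Real.rpow_sub_one ht.1.ne', mul_div_assoc]
  rw [e1, ENNReal.ofReal_div_of_pos ht.1]
  refine ENNReal.div_le_div_right (iSup₂_le fun z hz => ?_) _
  rw [← ofReal_norm]
  exact ENNReal.ofReal_le_ofReal (h z hz t ht)

section StrongKernel

variable {M M₁ M₂ : ℕ → ℝ} {e E e₁ E₁ e₂ E₂ : ℂ → ℂ}

theorem exists_nhds_strip {d θ A : ℝ} {z₀ : ℂ} (h0 : |z₀.im - d| < θ) (hA : θ ≤ A) :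
    ∃ U ∈ 𝓝 z₀, ∀ z ∈ U, |z.im - d| < θ ∧ |z.im - d| < A ∧ |z.re - z₀.re| < 1 := by
  refine ⟨{z | |z.im - d| < θ ∧ |z.re - z₀.re| < 1}, ?_, fun z hz =>
    ⟨hz.1, hz.1.trans_le hA, hz.2⟩⟩
  refine ((isOpen_lt (Complex.continuous_im.sub continuous_const).abs continuous_const).and
    (isOpen_lt (Complex.continuous_re.sub continuous_const).abs continuous_const)).mem_nhds
    ⟨h0, by simp⟩

/-- The power bounds of a strong kernel imply the integrability conditions of a kernel. -/
theorem IsStrongKernel.isKernel (h : IsStrongKernel M e E) (hM : IsWeightSequence M)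
    (hω : 0 < growthOrder M) (hω2 : growthOrder M < 2) : IsKernel M e E where
  toIsPreKernel := h.toIsPreKernel
  integrable := by
    obtain ⟨a, ha, hk⟩ := h.exists_hasKernelBound hM hω
    refine ⟨1, one_pos, fun z₀ hz₀ => ?_⟩
    obtain ⟨θ, hθ1, hθ2⟩ := exists_between (show |z₀.im - 0| < growthOrder M * Real.pi / 2 from hz₀)
    obtain ⟨U, hU, HU⟩ := exists_nhds_strip hθ1 hθ2.le
    obtain ⟨C, hC, H⟩ := hk.exists_norm_le hM hθ2
    refine ⟨U, hU, fun z hz => (HU z hz).2.1, ?_⟩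
    refine lintegral_iSup_enorm_div_lt_top (K := C * Real.exp (a * (|z₀.re| + 1))) ha
      (F := fun z t => e (polar t 0 - z)) fun z hz t ht => ?_
    obtain ⟨h1, -, h3⟩ := HU z hz
    rw [sub_zero] at h1
    refine (H _ (by simpa [polar] using h1.le)).trans ?_
    rw [mul_assoc, Real.rpow_def_of_pos ht.1, ← Real.exp_add]
    refine mul_le_mul_of_nonneg_left (Real.exp_le_exp.2 ?_) hC.le
    have hre : (polar t 0 - z).re = Real.log t - z.re := by simp [polar]
    rw [hre]
    have h4 := neg_abs_le (Real.log t - z.re)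
    have h5 := (abs_lt.1 h3).1
    have h6 := neg_abs_le z₀.re
    nlinarith
  integrable_borel := by
    obtain ⟨b, hb, hk⟩ := h.exists_borel_decay hM hω2
    refine ⟨1, one_pos, fun z₀ hz₀ => ?_⟩
    obtain ⟨θ, hθ1, hθ2⟩ := exists_between
      (show |z₀.im - Real.pi| < (2 - growthOrder M) * Real.pi / 2 from hz₀)
    obtain ⟨U, hU, HU⟩ := exists_nhds_strip hθ1 hθ2.le
    obtain ⟨K, hK, H⟩ := hk θ hθ2 (z₀.re - 1)
    refine ⟨U, hU, fun z hz => (HU z hz).2.1, ?_⟩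
    refine lintegral_iSup_enorm_div_lt_top (K := K * Real.exp (-b * (z₀.re - 1))) hb
      (F := fun z t => E (Complex.exp (z - polar t 0))) fun z hz t ht => ?_
    obtain ⟨h1, -, h3⟩ := HU z hz
    have h4 := (abs_lt.1 h3).1
    have h5 : Real.log t ≤ 0 := Real.log_nonpos ht.1.le ht.2
    have hre : (z - polar t 0).re = z.re - Real.log t := by simp [polar]
    refine (H _ (by simpa [polar] using h1.le) (by rw [hre]; linarith)).trans ?_
    rw [mul_assoc, Real.rpow_def_of_pos ht.1, ← Real.exp_add, hre]
    refine mul_le_mul_of_nonneg_left (Real.exp_le_exp.2 ?_) hK.le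
    nlinarith

variable {a : ℝ} (hM₁ : IsWeightSequence M₁) (hM₂ : IsWeightSequence M₂)
  (h₁ : IsStrongKernel M₁ e₁ E₁) (h₂ : IsStrongKernel M₂ e₂ E₂)
  (hω₁ : 0 < growthOrder M₁) (hω₂ : 0 < growthOrder M₂)
  (hprod : growthOrder (M₁ * M₂) = growthOrder M₁ + growthOrder M₂)
  (hidx : growthIndex (M₁ * M₂) < 2) (hω : growthOrder M₁ + growthOrder M₂ < 2) (ha : 0 < a)
  (k₁ : HasKernelBound M₁ (growthOrder M₁ * Real.pi / 2) a e₁)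
  (k₂ : HasKernelBound M₂ (growthOrder M₂ * Real.pi / 2) a e₂)

include hM₁ hM₂ hω₁ hω₂ ha k₁ k₂ in
theorem borelKernel_convKernel (z : ℂ) :
    borelKernel (convKernel (growthOrder M₁) (growthOrder M₂) e₁ e₂) z =
      ∑' n : ℕ, z ^ n / (momentFun e₁ n * momentFun e₂ n) :=
  tsum_congr fun n => by
    rw [momentFun_convKernel hω₁ hω₂ ha hM₁ hM₂ k₁ k₂ (lam := n) (by simp)]

include hM₁ hM₂ h₁ h₂ hω₁ hω₂ hprod hidx hω ha k₁ k₂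

/-- The convolution of two strong kernels is a strong kernel for the product sequence. -/
theorem isStrongKernel_convKernel :
    IsStrongKernel (M₁ * M₂) (convKernel (growthOrder M₁) (growthOrder M₂) e₁ e₂)
      (borelKernel (convKernel (growthOrder M₁) (growthOrder M₂) e₁ e₂)) := by
  have hpi := Real.pi_pos
  have hM := hM₁.mul hM₂
  have hk := hasKernelBound_convKernel hω₁ hω₂ ha hM₁ hM₂ k₁ k₂
  obtain ⟨C₁, hC₁, K₁, hK₁, H₁⟩ := h₁.bound_borel
  obtain ⟨C₂, hC₂, K₂, hK₂, H₂⟩ := h₂.bound_borel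
  have hterm := norm_pow_div_mul_le hM₁ hM₂ hK₁ hK₂ hC₁ hC₂
    (norm_inv_coeff_le hM₁ h₁.hasSum hK₁ H₁) (norm_inv_coeff_le hM₂ h₂.hasSum hK₂ H₂)
  have hgeom := hasSum_geometric_of_lt_one (r := (1 / 2 : ℝ)) (by norm_num) (by norm_num)
  have hB := borelKernel_convKernel hM₁ hM₂ hω₁ hω₂ ha k₁ k₂
  refine
    { stronglyRegular := h₁.stronglyRegular.mul h₂.stronglyRegular hM₁ hM₂
      index_lt := hidx
      holomorphic := fun z hz => (hk.differentiableAt z ?_).differentiableWithinAt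
      bound := fun ε hε => ?_
      positive := fun x _ => convKernel_pos hω₁ hω₂ ha hM₁ hM₂ k₁ k₂ h₁.positive h₂.positive x
      hasSum := fun z => ?_
      bound_borel := ⟨C₁ * C₂ * 2, by positivity, K₁ * K₂ / 2, by positivity, fun z => ?_⟩
      origin := ⟨a / 2, half_pos ha, fun τ hτ hτ' => ?_⟩
      infinity_borel := ?_ }
  · rw [hprod] at hz
    simpa [sector] using hz
  · have hθ : (growthOrder M₁ + growthOrder M₂ - ε) * Real.pi / 2 <
        (growthOrder M₁ + growthOrder M₂) * Real.pi / 2 := by nlinarith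
    obtain ⟨C, hC, k, hk0, H⟩ := hk.bound _ hθ
    refine ⟨C, hC, k, hk0, fun z hz => ?_⟩
    rw [hprod] at hz
    refine (H z (le_of_lt (by simpa [sector] using hz))).trans ?_
    refine mul_le_mul_of_nonneg_left (mul_le_of_le_one_left (Real.exp_pos _).le ?_) hC.le
    refine Real.exp_le_one_iff.2 ?_
    have := mul_nonneg (half_pos ha).le (abs_nonneg z.re)
    linarith
  · refine Summable.hasSum (Summable.of_norm_bounded
      (hgeom.summable.mul_left (C₁ * C₂ * Real.exp (assocFun (M₁ * M₂) (‖z‖ / (K₁ * K₂ / 2)))))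
      fun n => ?_)
    rw [momentFun_convKernel hω₁ hω₂ ha hM₁ hM₂ k₁ k₂ (lam := n) (by simp)]
    exact hterm z n
  · rw [hB]
    refine (tsum_of_norm_bounded (hgeom.mul_left _) (hterm z)).trans (le_of_eq ?_)
    norm_num
    ring
  · rw [hprod] at hτ'
    have hθ : τ * Real.pi / 2 < (growthOrder M₁ + growthOrder M₂) * Real.pi / 2 := by nlinarith
    obtain ⟨C, hC, H⟩ := hk.exists_norm_le hM hθ
    refine ⟨C, hC, 1, one_pos, fun z hz hz1 => ?_⟩
    refine (H z (le_of_lt (by simpa [sector] using hz))).trans (le_of_eq ?_)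
    have hre : z.re ≤ 0 := Real.exp_le_one_iff.1 hz1
    rw [modulus, ← Real.exp_mul, abs_of_nonpos hre]
    congr 2
    ring
  · obtain ⟨b, hb, H⟩ := exists_hadamard_decay hM₁ hM₂ h₁ h₂ hω₁ hω₂ hω
    refine ⟨b, hb, fun τ hτ hτ' => ?_⟩
    rw [hprod] at hτ'
    obtain ⟨K, hK, HK⟩ := H τ hτ' hτ
    exact ⟨K, hK, 1, one_pos, fun z hz hz1 => by rw [hB]; exact HK z hz hz1⟩

end StrongKernel

end MSumm

theorem mainTheorem4 (M₁ M₂ : ℕ → ℝ)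
    (hM₁ : IsNormalizedWeightSequence M₁) (hM₂ : IsNormalizedWeightSequence M₂)
    (hP₁ : AdmitsNonzeroProximateOrder M₁) (hP₂ : AdmitsNonzeroProximateOrder M₂)
    (hω : growthIndex M₁ + growthIndex M₂ < 2)
    (e₁ E₁ e₂ E₂ : ℂ → ℂ)
    (h₁ : IsStrongKernel M₁ e₁ E₁) (h₂ : IsStrongKernel M₂ e₂ E₂)
    (ω₁ ω₂ : ℝ) (hω₁ : ω₁ = growthOrder M₁) (hω₂ : ω₂ = growthOrder M₂)
    (e : ℂ → ℂ) (he : e = convKernel ω₁ ω₂ e₁ e₂) :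
    -- the convolution is the Laplace transform of `e₂(1/u)`, in every admissible direction
    (HasMGrowth M₁ 0 ω₂ (fun u => e₂ (-u)) ∧
      IsLaplaceTransform ω₁ e₁ (fun u => e₂ (-u)) 0 ω₂ (sector 0 (ω₂ + ω₁)) (fun z => e (-z)) ∧
      ∀ z ∈ sector 0 (ω₁ + ω₂), ∀ τ : ℝ, |τ| < ω₂ * Real.pi / 2 →
        |(-z).im - τ| < ω₁ * Real.pi / 2 →
        IntegrableOn (laplaceIntegrand e₁ (fun u => e₂ (-u)) τ (-z)) (Ioi 0) ∧
        e z = laplaceDir e₁ (fun u => e₂ (-u)) τ (-z)) ∧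
    -- it is a strong kernel, with the product as its moment function
    IsStrongKernel (M₁ * M₂) e (borelKernel e) ∧
    (∀ lam : ℂ, 0 ≤ lam.re →
      MellinConvergent (fun t : ℝ => e (polar t 0)) lam ∧
      momentFun e lam = momentFun e₁ lam * momentFun e₂ lam) ∧
    -- its Borel kernel is the Borel transform of `E₁` by the kernel `e₂`
    (∀ (u : ℂ) (τ ε R : ℝ), 0 < ε → ε < Real.pi → 0 < R →
      |u.im - τ| < ω₂ * ε / 2 →
      |u.im - τ| + ω₂ * (Real.pi + ε) / 2 < 2 * Real.pi - ω₂ * Real.pi / 2 →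
      IntegrableOn
        (borelRay E₂ (fun z => E₁ (Complex.exp z)) u (τ + ω₂ * (Real.pi + ε) / 2)) (Ioc 0 R) ∧
      IntegrableOn
        (borelRay E₂ (fun z => E₁ (Complex.exp z)) u (τ - ω₂ * (Real.pi + ε) / 2)) (Ioc 0 R) ∧
      borelKernel e (Complex.exp u) = borelDir ω₂ E₂ (fun z => E₁ (Complex.exp z)) τ ε R u) ∧
    -- it is the unique kernel with its moment sequence
    (IsKernel (M₁ * M₂) e (borelKernel e) ∧
      ∀ e' E' : ℂ → ℂ, IsKernel (M₁ * M₂) e' E' →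
        (∀ p : ℕ, momentFun e' p = momentFun e₁ p * momentFun e₂ p) →
        EqOn e' e (sector 0 (ω₁ + ω₂)) ∧ E' = borelKernel e) ∧
    -- its Laplace operator is the composition of the Laplace operators of the two kernels
    (∀ (d α : ℝ), 0 < α → ∀ f : ℂ → ℂ, HasMGrowth (M₁ * M₂) d α f →
      ∃ h : ℂ → ℂ, IsLaplaceTransform ω₂ e₂ f d α (sector d (α + ω₂)) h ∧
        HasMGrowth M₁ d (α + ω₂) h ∧
        (∃ G g, IsLaplaceTransform ω₁ e₁ h d (α + ω₂) G g) ∧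
        ∀ G g, IsLaplaceTransform ω₁ e₁ h d (α + ω₂) G g ↔
          IsLaplaceTransform (growthOrder (M₁ * M₂)) e f d α G g) ∧
    -- recovery of the kernel from the transform of `1/(1-u)`
    (∃ h g : ℂ → ℂ,
      IsLaplaceTransform ω₂ e₂ (fun u => (1 - Complex.exp u)⁻¹) Real.pi 2
        (sector Real.pi (2 + ω₂)) h ∧
      HasMGrowth M₁ Real.pi (2 + ω₂) h ∧
      IsLaplaceTransform ω₁ e₁ h Real.pi (2 + ω₂) (sector Real.pi (2 + ω₂ + ω₁)) g ∧
      ∀ z ∈ sector 0 (ω₁ + ω₂),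
        e (-z) = (g z - g (z + 2 * Real.pi * Complex.I)) / (2 * Real.pi * Complex.I)) := by
  have hW₁ := hM₁.toIsWeightSequence
  have hW₂ := hM₂.toIsWeightSequence
  obtain ⟨w₁, hw₁, t₁⟩ := exists_tendsto_log_ratio hM₁ hP₁
  obtain ⟨w₂, hw₂, t₂⟩ := exists_tendsto_log_ratio hM₂ hP₂
  have t₁₂ := tendsto_log_ratio_mul hW₁ hW₂ t₁ t₂
  have o₁ := growthOrder_eq_of_tendsto t₁
  have o₂ := growthOrder_eq_of_tendsto t₂
  have o₁₂ := growthOrder_eq_of_tendsto t₁₂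
  have i₁₂ := growthIndex_eq_of_tendsto t₁₂
  rw [growthIndex_eq_of_tendsto t₁, growthIndex_eq_of_tendsto t₂] at hω
  have hidx : growthIndex (M₁ * M₂) < 2 := by rw [i₁₂, EReal.coe_add]; exact hω
  have hlt : w₁ + w₂ < 2 := by
    rw [← EReal.coe_lt_coe_iff, EReal.coe_add]
    exact hω
  rw [← o₁] at hw₁ hlt t₁₂ o₁₂
  rw [← o₂] at hw₂ hlt t₁₂ o₁₂
  subst hω₁ hω₂ he
  obtain ⟨a₁, ha₁, k₁⟩ := h₁.exists_hasKernelBound hW₁ hw₁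
  obtain ⟨a₂, ha₂, k₂⟩ := h₂.exists_hasKernelBound hW₂ hw₂
  -- both kernels are given the same exponent at the origin
  have ha : 0 < min a₁ a₂ := lt_min ha₁ ha₂
  replace k₁ := k₁.mono (min_le_left a₁ a₂)
  replace k₂ := k₂.mono (min_le_right a₁ a₂)
  have hW := hW₁.mul hW₂
  have hk := hasKernelBound_convKernel hw₁ hw₂ ha hW₁ hW₂ k₁ k₂
  have hS := isStrongKernel_convKernel hW₁ hW₂ h₁ h₂ hw₁ hw₂ o₁₂ hidx hlt ha k₁ k₂
  have hpos : 0 < growthOrder M₁ + growthOrder M₂ := add_pos hw₁ hw₂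
  have hmom := fun lam hl => momentFun_convKernel hw₁ hw₂ ha hW₁ hW₂ k₁ k₂ (lam := lam) hl
  refine ⟨⟨k₂.hasMGrowth_comp_neg hW₁ hW₂ ha,
    isLaplaceTransform_convKernel hw₁ hw₂ ha hW₁ hW₂ k₁ k₂, fun z _ τ hτ hzτ => ⟨?_, ?_⟩⟩, hS,
    fun lam hl => ⟨?_, hmom lam hl⟩, fun u τ ε R _ _ hR hu hu' => ?_,
    ⟨hS.isKernel hW (o₁₂ ▸ hpos) (o₁₂ ▸ hlt), fun e' E' hK hm => ⟨?_, ?_⟩⟩,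
    fun d α hα f hf => ?_, ?_⟩
  · rw [integrableOn_laplaceIntegrand_iff]
    exact integrable_convKernel_laplaceLine ha hW₁ hW₂ k₁ k₂ hτ hzτ
  · rw [laplaceDir_eq_laplaceLine]
    exact convKernel_eq_laplaceLine hw₁ hw₂ ha hW₁ hW₂ k₁ k₂ hτ hzτ
  · rw [mellinConvergent_iff_integrable]
    exact hk.integrable_exp_mul (by have := Real.pi_pos; positivity) (half_pos ha) hW hl
  · rw [borelKernel_convKernel hW₁ hW₂ hw₁ hw₂ ha k₁ k₂]
    obtain ⟨b₁, b₂, b₃⟩ := borelDir_eq hW₁ hW₂ h₁.toIsPreKernel h₂ (by linarith) u hR hu hu'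
    exact ⟨b₁, b₂, b₃.symm⟩
  · rw [← o₁₂]
    refine hK.toIsPreKernel.eqOn_of_momentFun_eq hS.toIsPreKernel hW (o₁₂ ▸ hpos) (o₁₂ ▸ hlt)
      (o₁₂ ▸ t₁₂) fun n => ?_
    rw [hm n, hmom n (by simp)]
  · ext z
    rw [← (hK.hasSum z).tsum_eq, borelKernel_convKernel hW₁ hW₂ hw₁ hw₂ ha k₁ k₂]
    exact tsum_congr fun n => by rw [hm n]
  · have hiff := isLaplaceTransform_comp_iff hw₁ hw₂ ha hW₁ hW₂ k₁ k₂ hα hf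
    refine ⟨_, isLaplaceTransform_of_hasMGrowth_mul hα hw₂ ha hW₁ hW₂ k₂ hf,
      hasMGrowth_laplaceGlue hα hw₂ ha hW₁ hW₂ k₂ hf, ?_, fun G g => ?_⟩
    · obtain ⟨G, g, hg⟩ := exists_isLaplaceTransform_convKernel hw₁ hw₂ ha hW₁ hW₂ k₁ k₂ hα hf
      exact ⟨G, g, (hiff G g).2 hg⟩
    · rw [o₁₂]
      exact hiff G g
  · have hf := hasMGrowth_geomFun hW
    refine ⟨_, laplaceGlue (convKernel (growthOrder M₁) (growthOrder M₂) e₁ e₂) geomFun Real.pi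
        (2 / (2 + (growthOrder M₁ + growthOrder M₂))),
      isLaplaceTransform_of_hasMGrowth_mul two_pos hw₂ ha hW₁ hW₂ k₂ hf,
      hasMGrowth_laplaceGlue two_pos hw₂ ha hW₁ hW₂ k₂ hf,
      (isLaplaceTransform_comp_iff hw₁ hw₂ ha hW₁ hW₂ k₁ k₂ two_pos hf _ _).2 ?_, fun z hz => ?_⟩
    · rw [add_assoc, add_comm (growthOrder M₂)]
      exact isLaplaceTransform_geomFun hW (half_pos ha) hpos hk
    · rw [laplaceGlue_geomFun_sub hW (half_pos ha) hpos hk hz, mul_div_cancel_left₀]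
      have := Real.pi_ne_zero
      simp [this]
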